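/- **Conventions.** All C*-algebras are finite-dimensional over $\mathbb C$, sub-C*-algebras are unital with the same unit, $\mathcal F'$ is the commutant of $\mathcal F$ in the ambient algebra $\Omega$, $\mathcal Z(\mathcal F)=\mathcal F\cap\mathcal F'$ is the centre, $\mathcal F\vee\mathcal G$ is the subalgebra generated by $\mathcal F\cup\mathcal G$, and a factor is an algebra whose centre is $\mathbb C\,\mathrm{id}$. Write $(\mathcal F_1,\mathcal F_2)\vdash\mathcal G$ if $\mathcal F_1,\mathcal F_2\subseteq\mathcal G$ and $\pi(\mathcal F_1'\cap\mathcal G)=\pi\mathcal F_2$ for every atomic (minimal non-zero) orthogonal projector $\pi$ of $\mathcal Z(\mathcal G)$. A *partition* of $\Omega$ over a finite set $\Gamma$ is a family $(\mathcal A_S)_{S\subseteq\Gamma}$ of sub-C*-algebras of $\Omega$ with $\mathcal A_\Gamma=\Omega$ and $(\mathcal A_S,\mathcal A_T)\vdash\mathcal A_{S\sqcup T}$ for all disjoint $S,T\subseteq\Gamma$; put $\mathcal Z_S=\mathcal Z(\mathcal A_S)$. Let $\Gamma$ be a cycle; $\llbracket m,n\rrbracket$ denotes the vertices met going from $m$ to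 $n$ in the positive direction. The partition is *connected* if $\mathcal A_{S\sqcup T}=\mathcal A_S\vee\mathcal A_T$ whenever $S,T$ are disjoint and no vertex of $S$ is adjacent to one of $T$; it is *strongly connected* if moreover every interval other than the whole cycle has $\mathcal Z_{\llbracket m,n\rrbracket}=(\mathcal Z_{m-1}\cap\mathcal Z_m)\vee(\mathcal Z_n\cap\mathcal Z_{n+1})$, where $m-1$ and $n+1$ are the neighbouring vertices. Given a distance $d$ on the vertices, the partition has *correlation length at most $l$* if, for every $S$ and with $T=\{x: d(s,x)>l\ \forall s\in S\}$, one has $ab\neq0$ for all non-zero $a\in\mathcal A_S$, $b\in\mathcal A_T$. **Lemma (vertex-splitting).** Let $l\ge 0$, $N\geq 4l+1$, and let $(\mathcal A_S)_{S\subseteq\Gamma_N}$ be a connected partition of a factor $\Omega$ over the cycle $\Gamma_N=\mathbb Z/N$, with correlation length at most $l$ for the graph distance of $\Gamma_N$. Put $p_-=-\lceil\frac{N-1}2\rceil$, $p_+=\lfloor\frac{N-1}2\rfloor$, $q_+=p_+-l$. Let $\mathcal A^{\rm split}_{\llbracket p_-,-\frac14\rrbracket}$ be a sub-C*-algebra of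 $\Omega$ and $\mathcal A^{\rm split}_{\llbracket\frac14,p_+\rrbracket}:=\big(\mathcal A^{\rm split}_{\llbracket p_-,-\frac14\rrbracket}\big)'$, and suppose $$\mathcal A_{\llbracket p_-,-1\rrbracket}\subseteq\mathcal A^{\rm split}_{\llbracket p_-,-\frac14\rrbracket}\subseteq\mathcal A_{\llbracket p_-,0\rrbracket},\qquad \mathcal A^{\rm split}_{\llbracket p_-,-\frac14\rrbracket}=\mathcal A_{\llbracket p_-,0\rrbracket}\cap\big(\mathcal A^{\rm split}_{\llbracket\frac14,p_+\rrbracket}\cap\mathcal A_{\llbracket0,q_+\rrbracket}\big)'.$$ Let $\Gamma^{\rm split}=(\Gamma_N\setminus\{0\})\cup\{-\frac14,\frac14\}$ be the cycle $\dots,-1,-\frac14,\frac14,1,\dots$ with $N+1$ vertices. Then the following rules are consistent and determine a unique family $(\mathcal A^{\rm split}_S)_{S\subseteq\Gamma^{\rm split}}$: 1. for $S\subseteq\Gamma_N\setminus\{0\}$: $\mathcal A^{\rm split}_S=\mathcal A_S$ and $\mathcal A^{\rm split}_{S\sqcup\{-\frac14,\frac14\}}=\mathcal A_{S\sqcup\{0\}}$;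 2. for $m\in\llbracket p_-,-\frac14\rrbracket$: $\mathcal A^{\rm split}_{\llbracket m,-\frac14\rrbracket}=\mathcal A_{\llbracket m,0\rrbracket}\cap\mathcal A^{\rm split}_{\llbracket p_-,-\frac14\rrbracket}$ (for $m=-\frac14$, read $\mathcal A_{\llbracket m,0\rrbracket}$ as $\mathcal A_{\{0\}}$); 3. for $m\in\llbracket\frac14,p_+\rrbracket$: $\mathcal A^{\rm split}_{\llbracket\frac14,m\rrbracket}=\mathcal A_{\llbracket0,m\rrbracket}\cap\mathcal A^{\rm split}_{\llbracket\frac14,p_+\rrbracket}$ (for $m=\frac14$, read $\mathcal A_{\llbracket 0,m\rrbracket}$ as $\mathcal A_{\{0\}}$); 4. for an interval $S$ with more than $N/2$ vertices: $\mathcal A^{\rm split}_S=(\mathcal A^{\rm split}_{\bar S})'$, $\bar S$ being the complement of $S$; 5. for $S$ not an interval: $\mathcal A^{\rm split}_S$ is generated by the algebras of the connected components of $S$. This family is a strongly connected (in particular connected) partition of $\Omega$ over $\Gamma^{\rm split}$, again with correlation length at most $l$, where distances between vertices of $\Gamma^{\rm split}$ are measured in $\Gamma_N$, both $\pm\frac14$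 being placed at the position $0$. -/

import Mathlib

namespace VertexSplitting

section Algebra

variable {Ω : Type*} [CStarAlgebra Ω]

/-- The commutant `A'` in the ambient algebra. -/
def commutant (A : StarSubalgebra ℂ Ω) : StarSubalgebra ℂ Ω :=
  StarSubalgebra.centralizer ℂ (A : Set Ω)

/-- The centre `Z(A) = A ∩ A'` of a subalgebra. -/
def centre (A : StarSubalgebra ℂ Ω) : StarSubalgebra ℂ Ω :=
  A ⊓ commutant A

/-- `π` is an atomic projector of `Z`: a minimal nonzero orthogonal projector. -/
def IsAtomProj (Z : StarSubalgebra ℂ Ω) (π : Ω) : Prop :=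
  π ∈ Z ∧ IsStarProjection π ∧ π ≠ 0 ∧
    ∀ ρ ∈ Z, IsStarProjection ρ → ρ * π = ρ → ρ = 0 ∨ ρ = π

/-- The bipartition relation `(A₁, A₂) ⊢ B`: in every block of `B`, the commutant of `A₁`
(relative to `B`) is `A₂`, that is `π (A₁' ∩ B) = π A₂` for every atomic projector `π` of the
centre of `B`. -/
def IsBipartition (A₁ A₂ B : StarSubalgebra ℂ Ω) : Prop :=
  A₁ ≤ B ∧ A₂ ≤ B ∧ ∀ π : Ω, IsAtomProj (centre B) π →
    (fun x : Ω => π * x) '' ((commutant A₁ ⊓ B : StarSubalgebra ℂ Ω) : Set Ω) =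
      (fun x : Ω => π * x) '' (A₂ : Set Ω)

/-- `(A_S)_{S ⊆ V}` is a partition of the whole algebra `Ω`. -/
def IsPartition {V : Type*} (A : Set V → StarSubalgebra ℂ Ω) : Prop :=
  A Set.univ = ⊤ ∧ ∀ S T : Set V, Disjoint S T → IsBipartition (A S) (A T) (A (S ∪ T))

/-- `A₁ ⊥ A₂`: the two algebras are uncorrelated, i.e. a product of a nonzero element of one with
a nonzero element of the other never vanishes. -/
def Uncorrelated (A₁ A₂ : StarSubalgebra ℂ Ω) : Prop :=
  ∀ a ∈ A₁, ∀ b ∈ A₂, a * b = 0 → a = 0 ∨ b = 0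

/-- Correlation length at most `l`, with respect to the distance `d` on the vertices: `A_S` is
uncorrelated with the algebra of the vertices at distance more than `l` from `S`. -/
def HasCorrelationLengthLE {V : Type*} (d : V → V → ℕ) (l : ℕ)
    (A : Set V → StarSubalgebra ℂ Ω) : Prop :=
  ∀ S : Set V, Uncorrelated (A S) (A {x | ∀ s ∈ S, l < d s x})

end Algebra

/-- `Ω` is a factor: its centre consists of the scalars. -/
def IsFactor (Ω : Type*) [CStarAlgebra Ω] : Prop :=
  centre (⊤ : StarSubalgebra ℂ Ω) = ⊥

section Cycle

/-- The interval `⟦m, n⟧` of the cycle `ZMod M`: the vertices met when going from `m` to `n` by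
successive steps `+1`. -/
def arc {M : ℕ} (m n : ZMod M) : Set (ZMod M) :=
  {x | (x - m).val ≤ (n - m).val}

/-- The graph distance on the cycle `ZMod M`. -/
def cycleDist {M : ℕ} (x y : ZMod M) : ℕ :=
  min (x - y).val (y - x).val

/-- No vertex of `S` is a neighbour, in the cycle `ZMod M`, of a vertex of `T`. -/
def NonAdjacent {M : ℕ} (S T : Set (ZMod M)) : Prop :=
  ∀ s ∈ S, ∀ t ∈ T, t ≠ s + 1 ∧ s ≠ t + 1

/-- `C` is a connected component of `S ≠ univ` in the cycle `ZMod M`: a maximal interval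
contained in `S`. -/
def IsComponent {M : ℕ} (S C : Set (ZMod M)) : Prop :=
  ∃ m n : ZMod M, C = arc m n ∧ C ⊆ S ∧ m - 1 ∉ S ∧ n + 1 ∉ S

variable {Ω : Type*} [CStarAlgebra Ω]

/-- A family over the cycle is connected if non-adjacent sets of vertices satisfy
`A_{S ⊔ T} = A_S ∨ A_T`. -/
def IsConnected {M : ℕ} (A : Set (ZMod M) → StarSubalgebra ℂ Ω) : Prop :=
  ∀ S T : Set (ZMod M), Disjoint S T → NonAdjacent S T → A (S ∪ T) = A S ⊔ A T

/-- A family over the cycle is strongly connected if every interval `⟦m, n⟧` other than the whole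
cycle has centre `(Z_{m-1} ∩ Z_m) ∨ (Z_n ∩ Z_{n+1})`. -/
def IsStronglyConnected {M : ℕ} (A : Set (ZMod M) → StarSubalgebra ℂ Ω) : Prop :=
  ∀ m n : ZMod M, n + 1 ≠ m →
    centre (A (arc m n)) =
      (centre (A {m - 1}) ⊓ centre (A {m})) ⊔ (centre (A {n}) ⊓ centre (A {n + 1}))

end Cycle

section Split

/-- `p₋ = -⌈(N-1)/2⌉`, where `⌈(N-1)/2⌉ = ⌊N/2⌋`. -/
def pMinus (N : ℕ) : ZMod N := -((N / 2 : ℕ) : ZMod N)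

/-- `p₊ = ⌊(N-1)/2⌋`. -/
def pPlus (N : ℕ) : ZMod N := (((N - 1) / 2 : ℕ) : ZMod N)

/-- `q₊ = p₊ - l`. -/
def qPlus (N l : ℕ) : ZMod N := pPlus N - (l : ZMod N)

/-- The split graph `…, -1, -1/4, 1/4, 1, …` is the cycle `ZMod (N + 1)`, labelled so that `-1/4`
is `0`, `1/4` is `1`, the old vertex `k > 0` is `k + 1`, and the old vertex `-k < 0` is `-k`
(the two last labellings agree: `-k` is `N - k` in `ZMod N` and `N - k + 1` in `ZMod (N + 1)`).
The map `collapse` to the original cycle sends `±1/4` to `0` and each old vertex to itself. -/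
def collapse (N : ℕ) (x : ZMod (N + 1)) : ZMod N := ((x.val - 1 : ℕ) : ZMod N)

/-- The distance on the split graph measured in the original cycle, `±1/4` being located at `0`. -/
def splitDist (N : ℕ) (x y : ZMod (N + 1)) : ℕ := cycleDist (collapse N x) (collapse N y)

variable {Ω : Type*} [CStarAlgebra Ω]

/-- The rules for the split family `B`, given the family `A` over the cycle `ZMod N` and the
subalgebra `L`, which stands for the one of `⟦p₋, -1/4⟧` (that of `⟦1/4, p₊⟧` being `L'`). -/
structure SplitRules (N : ℕ) (A : Set (ZMod N) → StarSubalgebra ℂ Ω) (L : StarSubalgebra ℂ Ω)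
    (B : Set (ZMod (N + 1)) → StarSubalgebra ℂ Ω) : Prop where
  /-- Sets containing none (`0 ∉ S`) or both (`0 ∈ S`) of `±1/4`. -/
  unsplit : ∀ S : Set (ZMod N), B (collapse N ⁻¹' S) = A S
  /-- The intervals `⟦m, -1/4⟧` for `m = -k` in `⟦p₋, -1/4⟧` (`k = 0` being `m = -1/4`). -/
  left : ∀ k : ℕ, k ≤ N / 2 → B (arc (-(k : ZMod (N + 1))) 0) = A (arc (-(k : ZMod N)) 0) ⊓ L
  /-- The intervals `⟦1/4, m⟧` for `m = k` in `⟦1/4, p₊⟧` (`k = 0` being `m = 1/4`). -/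
  right : ∀ k : ℕ, k ≤ (N - 1) / 2 →
    B (arc 1 ((k : ZMod (N + 1)) + 1)) = A (arc 0 (k : ZMod N)) ⊓ commutant L
  /-- Intervals of size larger than `N / 2`. -/
  large : ∀ m n : ZMod (N + 1), N < 2 * (arc m n).ncard →
    B (arc m n) = commutant (B (arc m n)ᶜ)
  /-- Sets that are not intervals. -/
  nonInterval : ∀ S : Set (ZMod (N + 1)), (∀ m n : ZMod (N + 1), S ≠ arc m n) →
    B S = ⨆ C ∈ {C : Set (ZMod (N + 1)) | IsComponent S C}, B C

end Split

end VertexSplitting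

namespace VertexSplitting

/-! ### The trace, conditional expectations and the double commutant theorem. -/

section FiniteDimensional

variable {Ω : Type*} [CStarAlgebra Ω]

/-! The split family is written down explicitly. The real work concerns intervals and is done with
commutants; a general argument then passes to arbitrary sets of vertices.

Tools. In a finite-dimensional factor `F ↦ F'` is an order-reversing involution
(`commutant_commutant`), so meets and joins are exchanged. The trace-preserving conditional
expectation gives `(F ∨ G) ∩ F₁' ⊆ (F ∩ F₁') ∨ G` for `F₁ ⊆ F`, `G ⊆ F'` (`sup_inf_commutant_le`). A
commutative algebra `D` that commutes with `G` and is independent of it, possibly conditionally on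
part of the centre of `G`, can be cancelled: `(V₁ ∨ D₁) ∩ (V₂ ∨ D) ⊆ (V₁ ∩ V₂) ∨ D₁`
(`sup_inf_sup_le_of_condIndep`).

The original partition is already strongly connected (`IntervalSystem.centre_le_wires`).
Connectedness confines the centre of an interval to the join of the centres of two flanking
intervals. Comparing flanks of different lengths and cancelling what is `l` away leaves only the
wires, the classical algebras shared by adjacent vertices. Long intervals are reached through their
complements, thanks to `N ≥ 4l+1`.

Write `R = L'`. The key fact on the splitting is `left_inf_sup_wire_le`: what lies in `L` and in
`A⟦-k,0⟧` up to a far wire lies in `L ∩ A⟦-k,0⟧` up to that wire. Indeed an element of `L` commutes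
with `Q = R ∩ A⟦0,q₊⟧`, this can be imposed on the part away from the wire since `q₊` stays `l`
short of the end, and by hypothesis commuting with `Q` inside `A⟦p₋,0⟧` leads back to `L`. The
hypothesis turns out to be invariant under the reflection exchanging `L` and `R` (`left_le_sup`,
`SplitData.mirror`), so each statement has a mirror twin. Duality, bipartitions and centres follow
for the intervals ending at the new cut, whose wire contains `L ∩ R ∩ A_{0}`.

`CycleFamily` carries duality and the partition property from intervals to all sets by adding
components one at a time. Connectedness of `splitFamily` is built into its generators. Its
correlation length is inherited because `±1/4` sit at the same place. It is unique because a proper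
interval is either a union of fibres of `collapse`, or ends at the new cut and is then short or has
a short complement. -/

theorem mem_commutant {F : StarSubalgebra ℂ Ω} {x : Ω} :
    x ∈ commutant F ↔ ∀ a ∈ F, a * x = x * a := by
  unfold commutant
  rw [StarSubalgebra.mem_centralizer_iff]
  exact ⟨fun h a ha => (h a ha).1, fun h a ha => ⟨h a ha, h _ (star_mem ha)⟩⟩

theorem le_commutant_iff {F G : StarSubalgebra ℂ Ω} :
    G ≤ commutant F ↔ ∀ a ∈ F, ∀ b ∈ G, a * b = b * a :=
  ⟨fun h a ha _ hb => mem_commutant.1 (h hb) a ha,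
    fun h b hb => mem_commutant.2 fun a ha => h a ha b hb⟩

theorem le_commutant_comm {F G : StarSubalgebra ℂ Ω} :
    G ≤ commutant F ↔ F ≤ commutant G := by
  rw [le_commutant_iff, le_commutant_iff]
  exact ⟨fun h b hb a ha => (h a ha b hb).symm, fun h b hb a ha => (h a ha b hb).symm⟩

/-- The trace of left multiplication. -/
noncomputable def traceForm (Ω : Type*) [CStarAlgebra Ω] : Ω →ₗ[ℂ] ℂ :=
  LinearMap.trace ℂ Ω ∘ₗ (Algebra.lmul ℂ Ω).toLinearMap

theorem traceForm_mul_comm (x y : Ω) : traceForm Ω (x * y) = traceForm Ω (y * x) := by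
  simp only [traceForm, LinearMap.comp_apply, AlgHom.toLinearMap_apply, map_mul]
  exact LinearMap.trace_mul_comm ℂ _ _

variable [FiniteDimensional ℂ Ω]

-- The trace of left multiplication by `x*x` is a sum of non-negative eigenvalues. If it vanishes
-- they all do, so `x*x` is nilpotent, and a self-adjoint nilpotent is zero.
open scoped ComplexOrder in
theorem eq_zero_of_traceForm_star_mul_self {x : Ω} (h : traceForm Ω (star x * x) = 0) :
    x = 0 := by
  set a := star x * x with ha
  have hsa : IsSelfAdjoint a := IsSelfAdjoint.star_mul_self x
  set f : Module.End ℂ Ω := Algebra.lmul ℂ Ω a with hf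
  have hsplit : f.charpoly.Splits := IsAlgClosed.splits _
  have hsum : f.charpoly.roots.sum = 0 := by
    rw [← Module.End.trace_eq_sum_roots_charpoly_of_splits hsplit]; exact h
  have hnonneg : ∀ μ ∈ f.charpoly.roots, 0 ≤ μ := by
    intro μ hμ
    have h1 : μ ∈ spectrum ℂ f :=
      (Module.End.mem_spectrum_iff_isRoot_charpoly f μ).2 (Polynomial.isRoot_of_mem_roots hμ)
    have h2 : μ ∈ spectrum ℂ a := AlgHom.spectrum_apply_subset (Algebra.lmul ℂ Ω) a h1
    have h3 := hsa.mem_spectrum_eq_re h2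
    rw [h3] at h2 ⊢
    have h4 : μ.re ∈ spectrum ℝ a := (spectrum.algebraMap_mem_iff ℂ).1 h2
    exact_mod_cast spectrum_star_mul_self_nonneg _ h4
  have hzero := Multiset.all_zero_of_le_zero_le_of_sum_eq_zero hnonneg hsum
  have hnil : IsNilpotent f := by
    refine ((LinearMap.charpoly_nilpotent_tfae f).out 0 1).2 ?_
    have h1 := hsplit.eq_prod_roots_of_monic f.charpoly_monic
    have h2 : f.charpoly.roots = Multiset.replicate f.charpoly.natDegree 0 :=
      Multiset.eq_replicate.2 ⟨(Polynomial.splits_iff_card_roots.1 hsplit), hzero⟩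
    rw [h1, h2]
    simp [LinearMap.charpoly_natDegree]
  obtain ⟨n, hn⟩ := hnil
  have hpow : a ^ n = 0 := by
    have : (f ^ n) 1 = a ^ n := by rw [hf, ← map_pow]; simp
    rw [← this, hn]; rfl
  -- The exponent is raised to a power of two, for which the norm of a self-adjoint power is the
  -- power of the norm.
  have h2n : a ^ 2 ^ n = 0 := by
    rw [← Nat.sub_add_cancel (Nat.lt_two_pow_self (n := n)).le, pow_add, hpow, mul_zero]
  have h3 := hsa.nnnorm_pow_two_pow n
  rw [h2n, nnnorm_zero] at h3
  have h4 : a = 0 := nnnorm_eq_zero.1 (pow_eq_zero_iff (by positivity) |>.1 h3.symm)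
  exact CStarRing.star_mul_self_eq_zero_iff x |>.1 h4

/-- A subspace on which the trace form is non-degenerate carries a trace-preserving projection. -/
theorem exists_trace_projection (U : Submodule ℂ Ω)
    (hU : ∀ x ∈ U, (∀ y ∈ U, traceForm Ω (x * y) = 0) → x = 0) :
    ∃ E : Ω →ₗ[ℂ] Ω, (∀ x, E x ∈ U) ∧
      ∀ x, ∀ y ∈ U, traceForm Ω (E x * y) = traceForm Ω (x * y) := by
  let Φ : Ω →ₗ[ℂ] Module.Dual ℂ U :=
    (Module.Dual.transpose U.subtype) ∘ₗ
      ((LinearMap.mul ℂ Ω).compr₂ (traceForm Ω))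
  have hΦ : ∀ (x : Ω) (y : U), Φ x y = traceForm Ω (x * y) := fun x y => rfl
  let Ψ : U →ₗ[ℂ] Module.Dual ℂ U := Φ ∘ₗ U.subtype
  have hinj : Function.Injective Ψ := by
    rw [← LinearMap.ker_eq_bot, LinearMap.ker_eq_bot']
    intro x hx
    refine Subtype.ext (hU x x.2 fun y hy => ?_)
    have : Ψ x ⟨y, hy⟩ = 0 := by rw [hx]; rfl
    exact this
  let e : U ≃ₗ[ℂ] Module.Dual ℂ U := LinearEquiv.ofInjectiveOfFinrankEq Ψ hinj
    (Subspace.dual_finrank_eq (K := ℂ) (V := U)).symm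
  refine ⟨U.subtype ∘ₗ e.symm.toLinearMap ∘ₗ Φ, fun x => (e.symm (Φ x)).2, fun x y hy => ?_⟩
  have h1 : e (e.symm (Φ x)) = Φ x := e.apply_symm_apply _
  have h2 : e (e.symm (Φ x)) ⟨y, hy⟩ = traceForm Ω ((e.symm (Φ x) : Ω) * y) := rfl
  rw [h1, hΦ] at h2
  exact h2.symm

theorem traceForm_nondegenerate_of_star_closed {F : StarSubalgebra ℂ Ω} {x : Ω} (hx : x ∈ F)
    (h : ∀ y ∈ F, traceForm Ω (x * y) = 0) : x = 0 := by
  apply eq_zero_of_traceForm_star_mul_self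
  rw [traceForm_mul_comm]
  exact h _ (star_mem hx)

/-- The trace-preserving conditional expectation onto a star subalgebra. -/
theorem exists_condExp (K : StarSubalgebra ℂ Ω) :
    ∃ E : Ω →ₗ[ℂ] Ω, (∀ x, E x ∈ K) ∧ (∀ x ∈ K, E x = x) ∧
      (∀ k ∈ K, ∀ x, E (k * x) = k * E x) ∧ ∀ k ∈ K, ∀ x, E (x * k) = E x * k := by
  obtain ⟨E, hE, hτ⟩ := exists_trace_projection (Subalgebra.toSubmodule K.toSubalgebra)
    fun x hx h => traceForm_nondegenerate_of_star_closed (F := K) hx h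
  -- `E x` is the only element of `K` with the same trace pairings against `K` as `x`; the bimodule
  -- properties are read off from this.
  have key : ∀ x, ∀ y ∈ K, (∀ k ∈ K, traceForm Ω (y * k) = traceForm Ω (x * k)) → E x = y := by
    intro x y hy h
    refine sub_eq_zero.1 (traceForm_nondegenerate_of_star_closed (F := K)
      (sub_mem (hE x) hy) fun k hk => ?_)
    rw [sub_mul, map_sub, hτ x k hk, h k hk, sub_self]
  refine ⟨E, hE, fun x hx => key x x hx fun _ _ => rfl, fun k hk x => ?_, fun k hk x => ?_⟩
  · refine key _ _ (mul_mem hk (hE x)) fun k' hk' => ?_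
    rw [mul_assoc, traceForm_mul_comm, mul_assoc, mul_assoc, traceForm_mul_comm k, mul_assoc,
      hτ x _ (show k' * k ∈ K from mul_mem hk' hk)]
  · refine key _ _ (mul_mem (hE x) hk) fun k' hk' => ?_
    rw [mul_assoc, mul_assoc, hτ x _ (show k * k' ∈ K from mul_mem hk hk')]

/-- A two-sided ideal of a star subalgebra has a central projection as a unit. -/
theorem exists_unit_of_ideal (X : StarSubalgebra ℂ Ω) (I : Submodule ℂ Ω)
    (hIX : ∀ y ∈ I, y ∈ X) (hl : ∀ x ∈ X, ∀ y ∈ I, x * y ∈ I) (hr : ∀ x ∈ X, ∀ y ∈ I, y * x ∈ I) :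
    ∃ e ∈ I, e ∈ centre X ∧ IsStarProjection e ∧ ∀ y ∈ I, e * y = y ∧ y * e = y := by
  have nondeg : ∀ x ∈ I, (∀ y ∈ I, traceForm Ω (x * y) = 0) → x = 0 := by
    intro x hx h
    -- Pairing `x` with `x* x x*` gives the trace of `(x x*)*(x x*)`, so `x x* = 0`.
    have h1 := h (star x * x * star x)
      (hr _ (star_mem (hIX x hx)) _ (hl _ (star_mem (hIX x hx)) _ hx))
    have h2 : x * star x = 0 := by
      apply eq_zero_of_traceForm_star_mul_self
      rw [← h1]; congr 1; simp [mul_assoc]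
    exact (CStarRing.mul_star_self_eq_zero_iff x).1 h2
  obtain ⟨E, hE, hτ⟩ := exists_trace_projection I nondeg
  set e := E 1
  have he : e ∈ I := hE 1
  have hτe : ∀ y ∈ I, traceForm Ω (e * y) = traceForm Ω y := fun y hy => by
    rw [hτ 1 y hy, one_mul]
  have hel : ∀ y ∈ I, e * y = y := fun y hy => by
    refine sub_eq_zero.1 (nondeg _ (sub_mem (hl _ (hIX _ he) _ hy) hy) fun z hz => ?_)
    rw [sub_mul, map_sub, mul_assoc, hτe _ (hl _ (hIX _ hy) _ hz), sub_self]
  have her : ∀ y ∈ I, y * e = y := fun y hy => by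
    refine sub_eq_zero.1 (nondeg _ (sub_mem (hl _ (hIX _ hy) _ he) hy) fun z hz => ?_)
    rw [sub_mul, map_sub, mul_assoc, traceForm_mul_comm, mul_assoc,
      hτe _ (hl _ (hIX _ hz) _ hy), traceForm_mul_comm, sub_self]
  have hcen : ∀ x ∈ X, x * e = e * x := fun x hx => by
    rw [← hel _ (hl x hx e he), ← mul_assoc, her _ (hr x hx e he)]
  have heX : e ∈ X := hIX e he
  have hidem : e * e = e := hel e he
  -- A central idempotent commutes with its adjoint, and the C*-identity then gives `e = e* e`.
  have hstar : IsSelfAdjoint e := by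
    have hc : star e * e = e * star e := hcen _ (star_mem heX)
    have hss : star e * star e = star e := by rw [← star_mul, hidem]
    have h0 : star e * e * (star e * e) = star e * e := by
      rw [mul_assoc, ← mul_assoc e, ← hc, mul_assoc, hidem, ← mul_assoc, hss]
    have h1 : e - star e * e = 0 := by
      rw [← CStarRing.star_mul_self_eq_zero_iff, star_sub, star_mul, star_star, sub_mul, mul_sub,
        mul_sub, h0, ← mul_assoc, hss, mul_assoc, hidem]
      simp
    have h2 : e = star e * e := sub_eq_zero.1 h1
    rw [h2]; exact IsSelfAdjoint.star_mul_self e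
  exact ⟨e, he, ⟨heX, mem_commutant.2 hcen⟩, ⟨hidem, hstar⟩, fun y hy => ⟨hel y hy, her y hy⟩⟩

/-- The unit of a two-sided ideal is central, hence scalar in a factor: it is zero or invertible. -/
theorem isSimpleRing_of_isFactor [Nontrivial Ω] (hΩ : IsFactor Ω) : IsSimpleRing Ω := by
  refine ⟨⟨fun I => ?_⟩⟩
  let I' : Submodule ℂ Ω :=
    { carrier := {x | x ∈ I}
      add_mem' := fun ha hb => I.add_mem ha hb
      zero_mem' := I.zero_mem
      smul_mem' := fun c x hx => by
        have := I.mul_mem_left (algebraMap ℂ Ω c) x hx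
        rwa [← Algebra.smul_def] at this }
  obtain ⟨e, heI, hec, hep, hu⟩ := exists_unit_of_ideal ⊤ I' (fun _ _ => trivial)
    (fun x _ y hy => I.mul_mem_left x y hy) (fun x _ y hy => I.mul_mem_right y x hy)
  rw [hΩ] at hec
  obtain ⟨c, hc⟩ := StarSubalgebra.mem_bot.1 hec
  by_cases h0 : e = 0
  · left
    refine le_antisymm (fun x hx => ?_) bot_le
    have := (hu x hx).1
    rw [h0, zero_mul] at this
    rw [← this]; exact zero_mem _
  · right
    have hc0 : c ≠ 0 := by rintro rfl; exact h0 (by rw [← hc]; simp)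
    have h1 : (1 : Ω) ∈ I := by
      have := I.mul_mem_left (algebraMap ℂ Ω c⁻¹) e heI
      rwa [← hc, ← map_mul, inv_mul_cancel₀ hc0, map_one] at this
    refine le_antisymm le_top (fun x _ => ?_)
    have := I.mul_mem_left x 1 h1
    rwa [mul_one] at this

/-- The double commutant theorem in a finite-dimensional factor. -/
theorem commutant_commutant (hΩ : IsFactor Ω) (F : StarSubalgebra ℂ Ω) :
    commutant (commutant F) = F := by
  refine le_antisymm (fun x hx => ?_) (le_commutant_comm.1 le_rfl)
  rcases subsingleton_or_nontrivial Ω with _ | _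
  · rw [Subsingleton.elim x 0]; exact zero_mem _
  have := isSimpleRing_of_isFactor hΩ
  obtain ⟨n, hn, ⟨φ⟩⟩ := IsSimpleRing.exists_algEquiv_matrix_of_isAlgClosed ℂ Ω
  have := IsAzumaya.matrix ℂ (Fin n)
  have : IsAzumaya ℂ Ω := IsAzumaya.of_AlgEquiv ℂ _ _ φ.symm
  obtain ⟨E, hE, hid, hl, -⟩ := exists_condExp F
  -- Every linear endomorphism of a matrix algebra is a sum of maps `y ↦ m y c`. With `c` in a fixed
  -- basis the coefficients `m` are unique, so left `F`-linearity of `E` puts them in `F'`. For `x ∈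
  -- F''` this yields `E x = x E 1 = x`.
  obtain ⟨t, ht⟩ := (IsAzumaya.AlgHom.mulLeftRight_bij ℂ Ω).2 E
  let 𝒞 := Module.Basis.ofVectorSpace ℂ Ωᵐᵒᵖ
  obtain ⟨m, rfl⟩ := TensorProduct.eq_repr_basis_right 𝒞 t
  have hEx : ∀ y, E y = m.sum fun i a => a * y * (𝒞 i).unop := fun y => by
    rw [← ht]; simp [Finsupp.sum, map_sum, LinearMap.sum_apply]
  have hm : ∀ i, m i ∈ commutant F := by
    intro i
    refine mem_commutant.2 fun f hf => ?_
    have hzero : ∑ j ∈ m.support, (f * m j - m j * f) ⊗ₜ[ℂ] 𝒞 j = 0 := by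
      apply (IsAzumaya.AlgHom.mulLeftRight_bij ℂ Ω).1
      ext y
      rw [map_zero, map_sum, LinearMap.sum_apply, LinearMap.zero_apply]
      simp only [AlgHom.mulLeftRight_apply, sub_mul, Finset.sum_sub_distrib]
      have h1 := hl f hf y
      rw [hEx, hEx, Finsupp.sum, Finsupp.sum, Finset.mul_sum] at h1
      rw [sub_eq_zero]
      refine Eq.trans ?_ (h1.symm.trans ?_)
      · exact Finset.sum_congr rfl fun j _ => by simp only [mul_assoc]
      · exact Finset.sum_congr rfl fun j _ => by simp only [mul_assoc]
    have h1 := TensorProduct.sum_tmul_basis_right_eq_zero 𝒞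
      (m.mapRange (fun a => f * a - a * f) (by simp)) (by
        rw [Finsupp.sum_mapRange_index (by simp)]; exact hzero)
    have h2 := DFunLike.congr_fun h1 i
    rw [Finsupp.mapRange_apply, Finsupp.zero_apply] at h2
    exact sub_eq_zero.1 h2
  have hx1 : E x = x * E 1 := by
    rw [hEx, hEx, Finsupp.mul_sum]
    refine Finsupp.sum_congr fun i _ => ?_
    rw [mem_commutant.1 hx _ (hm i), mul_one, mul_assoc]
  rw [hid 1 (one_mem _), mul_one] at hx1
  rw [← hx1]; exact hE x

end FiniteDimensional

/-! ### Calculus of commutants, joins and centres. -/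

section Lattice

variable {Ω : Type*} [CStarAlgebra Ω]

theorem commutant_anti {F G : StarSubalgebra ℂ Ω} (h : F ≤ G) : commutant G ≤ commutant F :=
  fun _ hx => mem_commutant.2 fun a ha => mem_commutant.1 hx a (h ha)

theorem le_commutant_commutant (F : StarSubalgebra ℂ Ω) : F ≤ commutant (commutant F) :=
  le_commutant_comm.1 le_rfl

theorem commutant_sup (F G : StarSubalgebra ℂ Ω) :
    commutant (F ⊔ G) = commutant F ⊓ commutant G := by
  refine le_antisymm (le_inf (commutant_anti le_sup_left) (commutant_anti le_sup_right)) ?_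
  rw [le_commutant_comm]
  exact sup_le (le_commutant_comm.1 inf_le_left) (le_commutant_comm.1 inf_le_right)

theorem commutant_bot : commutant (⊥ : StarSubalgebra ℂ Ω) = ⊤ := by
  refine top_le_iff.1 ?_
  rw [le_commutant_comm]
  exact bot_le

theorem centre_le (F : StarSubalgebra ℂ Ω) : centre F ≤ F := inf_le_left

theorem centre_le_commutant (F : StarSubalgebra ℂ Ω) : centre F ≤ commutant F := inf_le_right

theorem centre_comm (F : StarSubalgebra ℂ Ω) : centre F ≤ commutant (centre F) :=
  (centre_le_commutant F).trans (commutant_anti (centre_le F))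

theorem centre_le_centre_sup {F G : StarSubalgebra ℂ Ω} (h : G ≤ commutant F) :
    centre F ≤ centre (F ⊔ G) := by
  refine le_inf ((centre_le F).trans le_sup_left) ?_
  rw [commutant_sup]
  exact le_inf inf_le_right ((centre_le F).trans (le_commutant_comm.1 h))

/-- The elements of the algebra generated by two commuting subalgebras are sums of products. -/
theorem sup_induction {F G : StarSubalgebra ℂ Ω} (h : G ≤ commutant F) {p : Ω → Prop}
    (hmul : ∀ f ∈ F, ∀ g ∈ G, p (f * g)) (hadd : ∀ x y, p x → p y → p (x + y))
    {x : Ω} (hx : x ∈ F ⊔ G) : p x := by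
  let P : Submodule ℂ Ω :=
    Subalgebra.toSubmodule F.toSubalgebra * Subalgebra.toSubmodule G.toSubalgebra
  have hP : ∀ f ∈ F, ∀ g ∈ G, f * g ∈ P := fun f hf g hg => Submodule.mul_mem_mul hf hg
  let S : StarSubalgebra ℂ Ω :=
    { carrier := P
      mul_mem' := by
        intro a b ha hb
        refine Submodule.mul_induction_on (C := fun a => a * b ∈ P) ha ?_ ?_
        · intro f hf g hg
          refine Submodule.mul_induction_on (C := fun b => f * g * b ∈ P) hb ?_ ?_
          · intro f' hf' g' hg'
            have hc : f' * g = g * f' := le_commutant_iff.1 h f' hf' g hg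
            have : f * g * (f' * g') = f * f' * (g * g') := by
              rw [mul_assoc, ← mul_assoc g, ← hc]; simp only [mul_assoc]
            rw [this]
            exact hP _ (mul_mem hf hf') _ (mul_mem hg hg')
          · intro x y hx hy; rw [mul_add]; exact add_mem hx hy
        · intro x y hx hy; rw [add_mul]; exact add_mem hx hy
      add_mem' := fun ha hb => add_mem ha hb
      algebraMap_mem' := fun r => by
        have := hP _ (F.algebraMap_mem r) _ (one_mem G)
        rwa [mul_one] at this
      star_mem' := by
        intro a ha
        refine Submodule.mul_induction_on (C := fun a => star a ∈ P) ha ?_ ?_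
        · intro f hf g hg
          rw [star_mul, ← le_commutant_iff.1 h _ (star_mem hf) _ (star_mem hg)]
          exact hP _ (star_mem hf) _ (star_mem hg)
        · intro x y hx hy; rw [star_add]; exact add_mem hx hy }
  have hle : F ⊔ G ≤ S := by
    refine sup_le (fun f hf => ?_) (fun g hg => ?_)
    · have := hP f hf 1 (one_mem _); rwa [mul_one] at this
    · have := hP 1 (one_mem _) g hg; rwa [one_mul] at this
  exact Submodule.mul_induction_on (C := p) (hle hx) hmul hadd

variable [FiniteDimensional ℂ Ω]

theorem commutant_le_commutant (hΩ : IsFactor Ω) {F G : StarSubalgebra ℂ Ω}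
    (h : commutant F ≤ commutant G) : G ≤ F := by
  have := commutant_anti h
  rwa [commutant_commutant hΩ, commutant_commutant hΩ] at this

theorem commutant_inf (hΩ : IsFactor Ω) (F G : StarSubalgebra ℂ Ω) :
    commutant (F ⊓ G) = commutant F ⊔ commutant G := by
  rw [← commutant_commutant hΩ (commutant F ⊔ commutant G), commutant_sup,
    commutant_commutant hΩ, commutant_commutant hΩ]

theorem commutant_top (hΩ : IsFactor Ω) : commutant (⊤ : StarSubalgebra ℂ Ω) = ⊥ := by
  rw [← commutant_bot, commutant_commutant hΩ]

theorem centre_commutant (hΩ : IsFactor Ω) (F : StarSubalgebra ℂ Ω) :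
    centre (commutant F) = centre F := by
  unfold centre
  rw [commutant_commutant hΩ, inf_comm]

/-- Relative commutants pass through the join with a commuting subalgebra. -/
theorem sup_inf_commutant_le (hΩ : IsFactor Ω) {F F₁ G : StarSubalgebra ℂ Ω}
    (h₁ : F₁ ≤ F) (hG : G ≤ commutant F) :
    (F ⊔ G) ⊓ commutant F₁ ≤ (F ⊓ commutant F₁) ⊔ G := by
  -- `F₁'` contains `F'`, so this expectation commutes with multiplication by `F'` and maps `F =
  -- F''` to itself; it is right `G`-linear because `G ⊆ F' ⊆ F₁'`.
  obtain ⟨E, hE, hid, hl, hr⟩ := exists_condExp (commutant F₁)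
  have hEF : ∀ f ∈ F, E f ∈ F := fun f hf => by
    rw [← commutant_commutant hΩ F]
    refine mem_commutant.2 fun h hh => ?_
    have hh' := commutant_anti h₁ hh
    rw [← hl h hh', ← hr h hh', mem_commutant.1 hh f hf]
  rintro x ⟨hx, hx₁⟩
  rw [← hid x hx₁]
  refine sup_induction (p := fun x => E x ∈ (F ⊓ commutant F₁) ⊔ G) hG ?_ ?_ hx
  · intro f hf g hg
    rw [hr g (commutant_anti h₁ (hG hg))]
    exact StarSubalgebra.mul_mem_sup ⟨hEF f hf, hE f⟩ hg
  · intro x y hx hy; rw [map_add]; exact add_mem hx hy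

/-- The relative double commutant. -/
theorem inf_sup_commutant_le (hΩ : IsFactor Ω) {V G H : StarSubalgebra ℂ Ω} (hV : V ≤ G)
    (hH : H ≤ commutant G) :
    G ⊓ (V ⊔ H) ≤ V ⊔ centre G := by
  have h := sup_inf_commutant_le hΩ (F := commutant G) (F₁ := commutant G) (G := V) le_rfl
    (by rwa [commutant_commutant hΩ])
  rw [commutant_commutant hΩ] at h
  calc G ⊓ (V ⊔ H) ≤ (commutant G ⊔ V) ⊓ G :=
        le_inf (inf_le_right.trans (sup_le le_sup_right (hH.trans le_sup_left))) inf_le_left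
    _ ≤ _ := h
    _ ≤ _ := by rw [sup_comm, inf_comm]; rfl

/-- The commutant form of `inf_sup_commutant_le`. The hypothesis on `M` serves to make the centre of
`F` commute with `M`, which absorbs the extra centre. -/
theorem le_sup_inf_commutant (hΩ : IsFactor Ω) {F M : StarSubalgebra ℂ Ω} (hF : F ≤ M)
    (hM : M ≤ F ⊔ commutant F) : M ≤ F ⊔ (M ⊓ commutant F) := by
  refine commutant_le_commutant hΩ ?_
  rw [commutant_sup, commutant_inf hΩ, commutant_commutant hΩ]
  refine (inf_sup_commutant_le hΩ (commutant_anti hF) (le_commutant_commutant F)).trans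
    (sup_le le_rfl ?_)
  rw [centre_commutant hΩ, le_commutant_comm]
  refine hM.trans ?_
  rw [le_commutant_comm, commutant_sup, commutant_commutant hΩ]
  exact le_inf inf_le_right inf_le_left

/-- A modular law: `F ⊆ K` is pulled out of the meet at the price of enlarging `Y` by the centre of
`F`. -/
theorem inf_sup_le_sup_inf_centre (hΩ : IsFactor Ω) {F K Y : StarSubalgebra ℂ Ω} (hF : F ≤ K)
    (hY : Y ≤ commutant F) : K ⊓ (F ⊔ Y) ≤ F ⊔ (K ⊓ (Y ⊔ centre F)) := by
  refine (le_sup_inf_commutant hΩ (F := F) (le_inf hF le_sup_left)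
    (inf_le_right.trans (sup_le_sup le_rfl hY))).trans (sup_le_sup le_rfl ?_)
  rw [inf_assoc]
  refine inf_le_inf le_rfl ((sup_inf_commutant_le hΩ le_rfl hY).trans ?_)
  rw [sup_comm]; rfl

/-- A central element commutes with `F`, which puts it in `G ∨ Z(F)`; it also commutes with `G`,
which reduces `G` to its centre. -/
theorem centre_sup_le (hΩ : IsFactor Ω) {F G : StarSubalgebra ℂ Ω} (h : G ≤ commutant F) :
    centre (F ⊔ G) ≤ centre F ⊔ centre G := by
  have h1 : (F ⊔ G) ⊓ commutant F ≤ G ⊔ centre F := by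
    rw [sup_comm (a := G)]; exact sup_inf_commutant_le hΩ le_rfl h
  have h2 : (G ⊔ centre F) ⊓ commutant G ≤ centre G ⊔ centre F :=
    sup_inf_commutant_le hΩ le_rfl ((centre_le F).trans (le_commutant_comm.1 h))
  have h3 : centre (F ⊔ G) ≤ (G ⊔ centre F) ⊓ commutant G :=
    le_inf ((le_inf (centre_le _) ((centre_le_commutant _).trans
      (commutant_anti le_sup_left))).trans h1)
      ((centre_le_commutant _).trans (commutant_anti le_sup_right))
  exact (h3.trans h2).trans (sup_le le_sup_right le_sup_left)

/-- Taking commutants exchanges the two parts up to `G'`, and the relative double commutant replaces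
`G'` by the centre of `G`. -/
theorem bipartition_symm (hΩ : IsFactor Ω) {F₁ F₂ G : StarSubalgebra ℂ Ω} (h₁ : F₁ ≤ G)
    (h : G ⊓ commutant F₁ ≤ F₂ ⊔ centre G) : G ⊓ commutant F₂ ≤ F₁ ⊔ centre G := by
  have h3 : commutant (F₂ ⊔ centre G) ≤ F₁ ⊔ commutant G := by
    have := commutant_anti h
    rw [commutant_inf hΩ, commutant_commutant hΩ] at this
    exact this.trans (sup_le le_sup_right le_sup_left)
  refine le_trans (le_inf inf_le_left ?_) (inf_sup_commutant_le hΩ h₁ le_rfl)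
  refine le_trans ?_ h3
  rw [commutant_sup]
  refine le_inf inf_le_right (inf_le_left.trans ?_)
  exact (le_commutant_comm.1 (centre_le_commutant G))

end Lattice

/-! ### Atoms of commutative algebras, and cancellation of independent factors. -/

section Atoms

variable {Ω : Type*} [CStarAlgebra Ω]

theorem IsAtomProj.mul_self {D : StarSubalgebra ℂ Ω} {δ : Ω} (h : IsAtomProj D δ) : δ * δ = δ :=
  h.2.1.isIdempotentElem

theorem Uncorrelated.mono {F F' G G' : StarSubalgebra ℂ Ω} (h : Uncorrelated F G) (hF : F' ≤ F)
    (hG : G' ≤ G) : Uncorrelated F' G' :=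
  fun a ha b hb => h a (hF ha) b (hG hb)

theorem Uncorrelated.symm {F G : StarSubalgebra ℂ Ω} (h : Uncorrelated F G)
    (hc : G ≤ commutant F) : Uncorrelated G F :=
  fun b hb a ha hba => (h a ha b hb (by rw [le_commutant_iff.1 hc a ha b hb, hba])).symm

theorem uncorrelated_bot_left (F : StarSubalgebra ℂ Ω) : Uncorrelated ⊥ F := by
  intro a ha b _ hab
  obtain ⟨c, rfl⟩ := StarSubalgebra.mem_bot.1 ha
  rw [← Algebra.smul_def, smul_eq_zero] at hab
  rcases hab with h | h
  · left; rw [h, map_zero]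
  · exact Or.inr h

variable [FiniteDimensional ℂ Ω]

/-- An atomic projector of a commutative algebra diagonalizes it. -/
theorem IsAtomProj.exists_smul {D : StarSubalgebra ℂ Ω} (hD : D ≤ commutant D) {δ : Ω}
    (h : IsAtomProj D δ) {d : Ω} (hd : d ∈ D) : ∃ c : ℂ, d * δ = c • δ := by
  have comm : ∀ a ∈ D, ∀ b ∈ D, a * b = b * a := le_commutant_iff.1 hD
  let U : Submodule ℂ Ω :=
    (Subalgebra.toSubmodule D.toSubalgebra).map (LinearMap.mulRight ℂ δ)
  have hU : ∀ y ∈ U, y ∈ D ∧ y * δ = y := by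
    rintro y ⟨z, hz, rfl⟩
    exact ⟨mul_mem (S := StarSubalgebra ℂ Ω) hz h.1, by simp [mul_assoc, h.mul_self]⟩
  have hδU : δ ∈ U := ⟨1, one_mem D, by simp⟩
  have hmap : ∀ y ∈ U, LinearMap.mulLeft ℂ d y ∈ U := by
    rintro y ⟨z, hz, rfl⟩
    exact ⟨d * z, mul_mem (s := D) hd hz, by simp [mul_assoc]⟩
  have : Nontrivial U := ⟨⟨δ, hδU⟩, 0, fun h0 => h.2.2.1 (congrArg Subtype.val h0)⟩
  obtain ⟨c, hc⟩ := Module.End.exists_eigenvalue ((LinearMap.mulLeft ℂ d).restrict hmap)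
  obtain ⟨v, hv⟩ := hc.exists_hasEigenvector
  have hv1 : d * (v : Ω) = c • (v : Ω) := congrArg Subtype.val hv.apply_eq_smul
  have hv0 : (v : Ω) ≠ 0 := fun h0 => hv.2 (Subtype.ext h0)
  -- The eigenspace of `d` in `Dδ` is an ideal of `D`; its unit is a non-zero projector below `δ`,
  -- hence `δ` itself.
  let I : Submodule ℂ Ω := U ⊓ LinearMap.ker (LinearMap.mulLeft ℂ d - c • LinearMap.id)
  have hI : ∀ y, y ∈ I ↔ y ∈ U ∧ d * y = c • y := fun y => by
    simp [I, sub_eq_zero]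
  have hmulI : ∀ x ∈ D, ∀ y ∈ I, x * y ∈ I := by
    intro x hx y hy
    rw [hI] at hy ⊢
    obtain ⟨⟨z, hz, rfl⟩, hy2⟩ := hy
    refine ⟨⟨x * z, mul_mem (s := D) hx hz, by simp [mul_assoc]⟩, ?_⟩
    rw [← mul_assoc, comm d hd x hx, mul_assoc, hy2, mul_smul_comm]
  obtain ⟨e, heI, heD, hep, hu⟩ := exists_unit_of_ideal D I (fun y hy => (hU y ((hI y).1 hy).1).1)
    hmulI (fun x hx y hy => by
      rw [comm y (hU y ((hI y).1 hy).1).1 x hx]; exact hmulI x hx y hy)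
  have he : e = δ := by
    refine (h.2.2.2 e (centre_le D heD) hep (hU e ((hI e).1 heI).1).2).resolve_left fun h0 => ?_
    have := (hu v ((hI v).2 ⟨v.2, hv1⟩)).1
    rw [h0, zero_mul] at this
    exact hv0 this.symm
  exact ⟨c, by rw [← he]; exact ((hI e).1 heI).2⟩

/-- Among the non-zero projectors `q ≤ p` of `D`, one with `Dq` of least dimension is minimal. -/
theorem exists_atom_mul_eq {D : StarSubalgebra ℂ Ω} (hD : D ≤ commutant D) {p : Ω} (hp : p ∈ D)
    (hproj : IsStarProjection p) (h0 : p ≠ 0) : ∃ δ, IsAtomProj D δ ∧ δ * p = δ := by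
  have comm : ∀ a ∈ D, ∀ b ∈ D, a * b = b * a := le_commutant_iff.1 hD
  let r : Ω → ℕ := fun q => Module.finrank ℂ
    ((Subalgebra.toSubmodule D.toSubalgebra).map (LinearMap.mulRight ℂ q))
  let T : Set Ω := {q | q ∈ D ∧ IsStarProjection q ∧ q ≠ 0 ∧ q * p = q}
  have hT : T.Nonempty := ⟨p, hp, hproj, h0, hproj.isIdempotentElem⟩
  obtain ⟨δ, ⟨hδ1, hδ2, hδ3, hδ4⟩, hmin⟩ : ∃ δ ∈ T, ∀ q ∈ T, ¬ r q < r δ :=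
    ⟨_, Function.argminOn_mem r T hT, fun q hq => Function.not_lt_argminOn r T hq⟩
  refine ⟨δ, ⟨hδ1, hδ2, hδ3, fun ρ hρ hρp hρδ => ?_⟩, hδ4⟩
  by_contra hcon
  push Not at hcon
  have hρT : ρ ∈ T := ⟨hρ, hρp, hcon.1, by rw [← hρδ, mul_assoc, hδ4]⟩
  refine hmin ρ hρT (Submodule.finrank_lt_finrank_of_lt ?_)
  refine lt_of_le_of_ne ?_ fun heq => ?_
  · rintro y ⟨z, hz, rfl⟩
    exact ⟨z * ρ, mul_mem (s := D) hz hρ, by simp [mul_assoc, hρδ]⟩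
  · have : δ ∈ (Subalgebra.toSubmodule D.toSubalgebra).map (LinearMap.mulRight ℂ ρ) := by
      rw [heq]; exact ⟨1, one_mem D, by simp⟩
    obtain ⟨z, hz, hzδ⟩ := this
    apply hcon.2
    have h1 : δ * ρ = δ := by
      rw [← hzδ]; simp only [LinearMap.mulRight_apply, mul_assoc, hρp.isIdempotentElem.eq]
    rw [← hρδ, comm ρ hρ δ hδ1, h1]

/-- The span of the atoms is an ideal with a unit `e`. An atom below `1 - e` would be both fixed and
killed by `e`. -/
theorem one_mem_span_atoms {D : StarSubalgebra ℂ Ω} (hD : D ≤ commutant D) :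
    (1 : Ω) ∈ Submodule.span ℂ {δ | IsAtomProj D δ} := by
  have comm : ∀ a ∈ D, ∀ b ∈ D, a * b = b * a := le_commutant_iff.1 hD
  set I := Submodule.span ℂ {δ | IsAtomProj D δ}
  have hID : ∀ y ∈ I, y ∈ D := fun y hy =>
    (Submodule.span_le (p := Subalgebra.toSubmodule D.toSubalgebra)).2 (fun δ hδ => hδ.1) hy
  have hmul : ∀ x ∈ D, ∀ y ∈ I, x * y ∈ I := by
    intro x hx y hy
    induction hy using Submodule.span_induction with
    | mem δ hδ =>
      obtain ⟨c, hc⟩ := IsAtomProj.exists_smul hD hδ hx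
      rw [hc]; exact Submodule.smul_mem _ _ (Submodule.subset_span hδ)
    | zero => rw [mul_zero]; exact zero_mem _
    | add a b _ _ ha hb => rw [mul_add]; exact add_mem ha hb
    | smul c a _ ha => rw [mul_smul_comm]; exact Submodule.smul_mem _ _ ha
  obtain ⟨e, heI, heD, hep, hu⟩ := exists_unit_of_ideal D I hID hmul
    (fun x hx y hy => by rw [comm y (hID y hy) x hx]; exact hmul x hx y hy)
  by_cases h1 : 1 - e = 0
  · rw [sub_eq_zero.1 h1]; exact heI
  · exfalso
    obtain ⟨δ, hδ, hδe⟩ := exists_atom_mul_eq hD (sub_mem (one_mem D) (hID e heI)) hep.one_sub h1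
    have h2 := (hu δ (Submodule.subset_span hδ)).2
    rw [mul_sub, mul_one, h2, sub_self] at hδe
    exact hδ.2.2.1 hδe.symm

/-- An element is recovered from its products with the atoms of a commutative algebra. -/
theorem mem_of_mul_atom_mem {D F : StarSubalgebra ℂ Ω} (hD : D ≤ commutant D) {x : Ω}
    (h : ∀ δ, IsAtomProj D δ → x * δ ∈ F) : x ∈ F := by
  suffices ∀ y ∈ Submodule.span ℂ {δ | IsAtomProj D δ}, x * y ∈ F by
    simpa using this 1 (one_mem_span_atoms hD)
  intro y hy
  induction hy using Submodule.span_induction with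
  | mem δ hδ => exact h δ hδ
  | zero => rw [mul_zero]; exact zero_mem _
  | add a b _ _ ha hb => rw [mul_add]; exact add_mem ha hb
  | smul c a _ ha => rw [mul_smul_comm]; exact F.smul_mem ha c

theorem exists_atom_mul_ne_zero {D : StarSubalgebra ℂ Ω} (hD : D ≤ commutant D) {x : Ω}
    (hx : x ≠ 0) : ∃ δ, IsAtomProj D δ ∧ x * δ ≠ 0 := by
  by_contra hcon
  push Not at hcon
  suffices ∀ y ∈ Submodule.span ℂ {δ | IsAtomProj D δ}, x * y = 0 by
    apply hx; simpa using this 1 (one_mem_span_atoms hD)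
  intro y hy
  induction hy using Submodule.span_induction with
  | mem δ hδ => exact hcon δ hδ
  | zero => rw [mul_zero]
  | add a b _ _ ha hb => rw [mul_add, ha, hb, add_zero]
  | smul c a _ ha => rw [mul_smul_comm, ha, smul_zero]

/-- On an atom `D` acts by scalars, so cutting `V ∨ D` by it leaves only `V`. -/
theorem exists_mul_atom_eq {V D : StarSubalgebra ℂ Ω} (hD : D ≤ commutant D)
    (hVD : D ≤ commutant V) {x δ : Ω} (hx : x ∈ V ⊔ D) (hδ : IsAtomProj D δ) :
    ∃ v ∈ V, x * δ = v * δ := by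
  refine sup_induction (p := fun x => ∃ v ∈ V, x * δ = v * δ) hVD ?_ ?_ hx
  · intro v hv d hd
    obtain ⟨c, hc⟩ := IsAtomProj.exists_smul hD hδ hd
    exact ⟨c • v, V.smul_mem hv c, by rw [mul_assoc, hc, mul_smul_comm, smul_mul_assoc]⟩
  · rintro x y ⟨v, hv, hx⟩ ⟨v', hv', hy⟩
    exact ⟨v + v', add_mem hv hv', by rw [add_mul, hx, hy, add_mul]⟩

/-- Elements of `G` are recovered from their blocks, so agreement in every block is agreement once
the centre is adjoined. Atoms disappear from the relation. -/
theorem isBipartition_iff {F₁ F₂ G : StarSubalgebra ℂ Ω} :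
    IsBipartition F₁ F₂ G ↔ F₁ ≤ G ∧ F₂ ≤ G ∧ commutant F₁ ⊓ G = F₂ ⊔ centre G := by
  unfold IsBipartition
  refine and_congr_right fun h₁ => and_congr_right fun h₂ => ?_
  have hZ : centre G ≤ commutant F₁ ⊓ G :=
    le_inf ((centre_le_commutant G).trans (commutant_anti h₁)) (centre_le G)
  have hcomm : ∀ π, IsAtomProj (centre G) π → ∀ x ∈ G, x * π = π * x := fun π hπ x hx =>
    mem_commutant.1 (centre_le_commutant G hπ.1) x hx
  constructor
  · intro h
    refine le_antisymm (fun x hx => ?_) (sup_le (fun y hy => ?_) hZ)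
    · refine mem_of_mul_atom_mem (centre_comm G) fun π hπ => ?_
      have h1 : π * x ∈ (fun x : Ω => π * x) '' ((commutant F₁ ⊓ G : StarSubalgebra ℂ Ω) : Set Ω) :=
        ⟨x, hx, rfl⟩
      rw [h π hπ] at h1
      obtain ⟨f, hf, hfx⟩ := h1
      rw [hcomm π hπ x hx.2, ← hfx]
      exact mul_mem (StarSubalgebra.mem_sup_right hπ.1) (StarSubalgebra.mem_sup_left hf)
    · refine mem_of_mul_atom_mem (centre_comm G) fun π hπ => ?_
      have h1 : π * y ∈ (fun x : Ω => π * x) '' (F₂ : Set Ω) := ⟨y, hy, rfl⟩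
      rw [← h π hπ] at h1
      obtain ⟨f, hf, hfx⟩ := h1
      rw [hcomm π hπ y (h₂ hy), ← hfx]
      exact mul_mem (hZ hπ.1) hf
  · intro h π hπ
    have hF₂ : F₂ ≤ commutant F₁ ⊓ G := h ▸ le_sup_left
    apply Set.Subset.antisymm
    · rintro _ ⟨x, hx, rfl⟩
      have hx' : x ∈ F₂ ⊔ centre G := h ▸ hx
      obtain ⟨v, hv, hxv⟩ := exists_mul_atom_eq (centre_comm G)
        ((centre_le_commutant G).trans (commutant_anti h₂)) hx' hπ
      refine ⟨v, hv, ?_⟩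
      simp only
      rw [← hcomm π hπ v (h₂ hv), ← hcomm π hπ x hx.2, hxv]
    · rintro _ ⟨x, hx, rfl⟩
      exact ⟨x, hF₂ hx, rfl⟩

/-- `G` and `D` are independent given `Z`: this is tested block by block. -/
def CondIndep (G D Z : StarSubalgebra ℂ Ω) : Prop :=
  ∀ g ∈ G, ∀ ζ, IsAtomProj Z ζ → ∀ δ, IsAtomProj D δ → g * ζ * δ = 0 → g * ζ = 0 ∨ ζ * δ = 0

/-- On a block of `D₁` the element `x` is some `v ∈ V₁`; on a smaller atom `δ` of `D` it is also
some `v' ∈ V₂`. Then `(v - v')ζδ = 0`, and independence given the block `ζ` of `Z` yields `vζ =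
v'ζ`, an element of `V₁ ∩ V₂`. -/
theorem sup_inf_sup_le_of_condIndep {G D Z D₁ V₁ V₂ : StarSubalgebra ℂ Ω}
    (hD : D ≤ commutant D) (hGD : D ≤ commutant G) (hZG : Z ≤ centre G) (hD₁ : D₁ ≤ D)
    (hV₁ : V₁ ≤ G) (hV₂ : V₂ ≤ G) (hZ₁ : Z ≤ V₁) (hZ₂ : Z ≤ V₂) (hind : CondIndep G D Z) :
    (V₁ ⊔ D₁) ⊓ (V₂ ⊔ D) ≤ (V₁ ⊓ V₂) ⊔ D₁ := by
  have hZ : Z ≤ commutant Z := hZG.trans ((centre_comm G).trans (commutant_anti hZG))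
  have hD₁' : D₁ ≤ commutant D₁ := hD₁.trans (hD.trans (commutant_anti hD₁))
  have hcG : ∀ g ∈ G, ∀ d ∈ D, g * d = d * g := le_commutant_iff.1 hGD
  rintro x ⟨hx₁, hx₂⟩
  refine mem_of_mul_atom_mem hD₁' fun δ₁ hδ₁ => mem_of_mul_atom_mem hZ fun ζ hζ => ?_
  have hζG : ζ ∈ G := centre_le G (hZG hζ.1)
  obtain ⟨v, hv, hxv⟩ :=
    exists_mul_atom_eq hD₁' (hD₁.trans (hGD.trans (commutant_anti hV₁))) hx₁ hδ₁
  have hrw : x * δ₁ * ζ = v * ζ * δ₁ := by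
    rw [hxv, mul_assoc, ← hcG ζ hζG δ₁ (hD₁ hδ₁.1), mul_assoc]
  by_cases h0 : ζ * δ₁ = 0
  · rw [hrw, mul_assoc, h0, mul_zero]; exact zero_mem _
  obtain ⟨δ, hδ, hne⟩ := exists_atom_mul_ne_zero hD h0
  obtain ⟨c, hc⟩ := IsAtomProj.exists_smul hD hδ (hD₁ hδ₁.1)
  have hc0 : c ≠ 0 := by
    rintro rfl
    rw [mul_assoc, hc] at hne; simp at hne
  obtain ⟨v', hv', hxv'⟩ := exists_mul_atom_eq hD (hGD.trans (commutant_anti hV₂)) hx₂ hδ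
  have hζδ : ζ * δ ≠ 0 := by
    rw [mul_assoc, hc, mul_smul_comm] at hne
    exact fun h => hne (by rw [h, smul_zero])
  have hvδ : v * δ = v' * δ := by
    have h1 : x * (δ₁ * δ) = v * (δ₁ * δ) := by rw [← mul_assoc, hxv, mul_assoc]
    rw [hc, mul_smul_comm, mul_smul_comm] at h1
    rw [← hxv']
    exact (smul_right_injective Ω hc0 h1).symm
  have hvv : v * ζ = v' * ζ := by
    have h1 : (v - v') * ζ * δ = 0 := by
      rw [mul_assoc, hcG ζ hζG δ hδ.1, ← mul_assoc, sub_mul, hvδ, sub_self, zero_mul]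
    have h2 := (hind _ (sub_mem (hV₁ hv) (hV₂ hv')) ζ hζ δ hδ h1).resolve_right hζδ
    rwa [sub_mul, sub_eq_zero] at h2
  rw [hrw]
  exact StarSubalgebra.mul_mem_sup
    ⟨mul_mem hv (hZ₁ hζ.1), hvv ▸ mul_mem hv' (hZ₂ hζ.1)⟩ hδ₁.1

/-- The central support of an element. -/
theorem exists_central_support {G : StarSubalgebra ℂ Ω} {g : Ω} (hg : g ∈ G) :
    ∃ e ∈ centre G, e * g = g ∧ ∀ y ∈ commutant G, g * y = 0 → e * y = 0 := by
  let I : Submodule ℂ Ω := Submodule.span ℂ {z | ∃ a ∈ G, ∃ b ∈ G, z = a * g * b}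
  obtain ⟨e, heI, heC, -, hu⟩ := exists_unit_of_ideal G I
    (fun y hy => (Submodule.span_le (p := Subalgebra.toSubmodule G.toSubalgebra)).2
      (by rintro _ ⟨a, ha, b, hb, rfl⟩; exact mul_mem (s := G) (mul_mem ha hg) hb) hy)
    (fun x hx y hy => by
      induction hy using Submodule.span_induction with
      | mem z hz =>
        obtain ⟨a, ha, b, hb, rfl⟩ := hz
        exact Submodule.subset_span ⟨x * a, mul_mem hx ha, b, hb, by simp only [mul_assoc]⟩
      | zero => rw [mul_zero]; exact zero_mem _
      | add a b _ _ ha hb => rw [mul_add]; exact add_mem ha hb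
      | smul c a _ ha => rw [mul_smul_comm]; exact Submodule.smul_mem _ _ ha)
    (fun x hx y hy => by
      induction hy using Submodule.span_induction with
      | mem z hz =>
        obtain ⟨a, ha, b, hb, rfl⟩ := hz
        exact Submodule.subset_span ⟨a, ha, b * x, mul_mem hb hx, by simp only [mul_assoc]⟩
      | zero => rw [zero_mul]; exact zero_mem _
      | add a b _ _ ha hb => rw [add_mul]; exact add_mem ha hb
      | smul c a _ ha => rw [smul_mul_assoc]; exact Submodule.smul_mem _ _ ha)
  refine ⟨e, heC, (hu g (Submodule.subset_span ⟨1, one_mem G, 1, one_mem G, by simp⟩)).1,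
    fun y hy hgy => ?_⟩
  clear heC hu
  induction heI using Submodule.span_induction with
  | mem z hz =>
    obtain ⟨a, ha, b, hb, rfl⟩ := hz
    rw [mul_assoc, mem_commutant.1 hy b hb, ← mul_assoc, mul_assoc a, hgy]; simp
  | zero => rw [zero_mul]
  | add a b _ _ ha hb => rw [add_mul, ha, hb, add_zero]
  | smul c a _ ha => rw [smul_mul_assoc, ha, smul_zero]

/-- Replace `g` by its central support. On a block `ζ` of `Z` that support comes from `Z₁`, to which
the absence of correlation with `Z ∨ D` applies. -/
theorem condIndep_of_uncorrelated {G D Z Z₁ : StarSubalgebra ℂ Ω} (hGD : D ≤ commutant G)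
    (hZ : Z ≤ centre G) (hZ₁ : Z₁ ≤ commutant Z) (hG : centre G ≤ Z ⊔ Z₁)
    (h : Uncorrelated Z₁ (Z ⊔ D)) : CondIndep G D Z := by
  have hZZ : Z ≤ commutant Z := hZ.trans ((centre_comm G).trans (commutant_anti hZ))
  intro g hg ζ hζ δ hδ h0
  have hζG := hZ hζ.1
  obtain ⟨e, he, heg, hey⟩ := exists_central_support hg
  have h1 : e * (ζ * δ) = 0 :=
    hey _ (mul_mem (centre_le_commutant G hζG) (hGD hδ.1)) (by rw [← mul_assoc, h0])
  have he' : e ∈ Z₁ ⊔ Z := by rw [sup_comm]; exact hG he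
  obtain ⟨z, hz, hez⟩ := exists_mul_atom_eq hZZ (le_commutant_comm.1 hZ₁) he' hζ
  rw [← mul_assoc, hez, mul_assoc] at h1
  refine (h z hz _ (StarSubalgebra.mul_mem_sup hζ.1 hδ.1) h1).imp (fun hz0 => ?_) id
  rw [← heg, mul_assoc, mem_commutant.1 (centre_le_commutant G hζG) g hg, ← mul_assoc, hez, hz0]
  simp

/-- On an atom `φ` of the commutative `F`, an element of `G ∨ F` becomes some `g ∈ G`. From `φ(gy) =
0` one strips first `φ`, then `g`. -/
theorem Uncorrelated.assoc {F G H : StarSubalgebra ℂ Ω} (hF : F ≤ commutant F)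
    (hFG : G ≤ commutant F) (hFH : H ≤ commutant F) (h : Uncorrelated F (G ⊔ H))
    (hGH : Uncorrelated G H) : Uncorrelated (G ⊔ F) H := by
  intro x hx y hy hxy
  by_cases hy0 : y = 0
  · exact Or.inr hy0
  left
  by_contra hx0
  obtain ⟨φ, hφ, hne⟩ := exists_atom_mul_ne_zero hF hx0
  obtain ⟨g, hg, hxg⟩ := exists_mul_atom_eq hF (le_commutant_comm.1 hFG) hx hφ
  have h1 : φ * (g * y) = 0 := by
    rw [← mul_assoc, le_commutant_iff.1 hFG φ hφ.1 g hg, ← hxg, mul_assoc,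
      le_commutant_iff.1 hFH φ hφ.1 y hy, ← mul_assoc, hxy, zero_mul]
  rcases h φ hφ.1 _ (StarSubalgebra.mul_mem_sup hg hy) h1 with h2 | h2
  · exact hφ.2.2.1 h2
  · rcases hGH g hg y hy h2 with h3 | h3
    · rw [h3, zero_mul] at hxg; exact hne hxg
    · exact hy0 h3

/-- Independent algebras: the unconditional form of `sup_inf_sup_le_of_condIndep`. -/
theorem sup_inf_sup_le_of_uncorrelated {G D D₁ V₁ V₂ : StarSubalgebra ℂ Ω}
    (hD : D ≤ commutant D) (hGD : D ≤ commutant G) (hD₁ : D₁ ≤ D)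
    (hV₁ : V₁ ≤ G) (hV₂ : V₂ ≤ G) (h : Uncorrelated (centre G) D) :
    (V₁ ⊔ D₁) ⊓ (V₂ ⊔ D) ≤ (V₁ ⊓ V₂) ⊔ D₁ :=
  sup_inf_sup_le_of_condIndep (Z := ⊥) hD hGD bot_le hD₁ hV₁ hV₂ bot_le bot_le
    (condIndep_of_uncorrelated (Z₁ := centre G) hGD bot_le (by rw [commutant_bot]; exact le_top)
      (by rw [bot_sup_eq]) (by rwa [bot_sup_eq]))

/-- The case `V₁ = G`, `D₁ = ⊥`: an element of `G` has no use for an independent `D`. -/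
theorem inf_sup_le_of_uncorrelated {G D V : StarSubalgebra ℂ Ω}
    (hD : D ≤ commutant D) (hGD : D ≤ commutant G) (hV : V ≤ G)
    (h : Uncorrelated (centre G) D) : G ⊓ (V ⊔ D) ≤ V := by
  have := sup_inf_sup_le_of_uncorrelated (D₁ := ⊥) hD hGD bot_le le_rfl hV h
  rw [sup_bot_eq, sup_bot_eq] at this
  exact this.trans inf_le_right

end Atoms

/-! ### Intervals of the original cycle: wires and strong connectedness. -/

variable {Ω : Type*} [CStarAlgebra Ω]

/-- A family of algebras indexed by the intervals `[i, j)` of integers, periodic of period `N`: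
what a connected partition of a factor over a cycle, with correlation length at most `l`, induces
on the intervals of the cycle. -/
structure IntervalSystem (N l : ℕ) (a : ℤ → ℤ → StarSubalgebra ℂ Ω) : Prop where
  factor : IsFactor Ω
  large : 4 * l + 1 ≤ N
  periodic : ∀ i j, a (i + N) (j + N) = a i j
  mono : ∀ {i i' j' j : ℤ}, i ≤ i' → j' ≤ j → a i' j' ≤ a i j
  empty : ∀ {i j : ℤ}, j ≤ i → a i j = ⊥
  full : ∀ i, a i (i + N) = ⊤
  compl : ∀ {i j : ℤ}, i ≤ j → j ≤ i + N → commutant (a i j) = a j (i + N)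
  bipartition : ∀ {i j k : ℤ}, i ≤ j → j ≤ k → k ≤ i + N →
    a i k ⊓ a j (i + N) ≤ a j k ⊔ centre (a i k)
  gap : ∀ {i j k m : ℤ}, i < j → j < k → k < m → m < i + N →
    a i m ⊓ a k (j + N) ≤ a i j ⊔ a k m
  uncorrelated : ∀ {i j k m : ℤ}, i ≤ j → j + l ≤ k → k ≤ m → m + l ≤ i + N →
    Uncorrelated (a i j) (a k m)

/-- The classical algebra shared by the two vertices adjacent to the cut `i`. -/
def wire (a : ℤ → ℤ → StarSubalgebra ℂ Ω) (i : ℤ) : StarSubalgebra ℂ Ω :=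
  centre (a (i - 1) i) ⊓ centre (a i (i + 1))

/-- The mirror image of an interval family under the reflection `t ↦ -t` of the vertices. -/
def mirror (a : ℤ → ℤ → StarSubalgebra ℂ Ω) (i j : ℤ) : StarSubalgebra ℂ Ω :=
  a (1 - j) (1 - i)

theorem wire_mirror (a : ℤ → ℤ → StarSubalgebra ℂ Ω) (i : ℤ) :
    wire (mirror a) i = wire a (1 - i) := by
  unfold wire mirror
  rw [inf_comm]
  congr 3 <;> ring

theorem wire_comm_self (a : ℤ → ℤ → StarSubalgebra ℂ Ω) (i : ℤ) :
    wire a i ≤ commutant (wire a i) :=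
  inf_le_left.trans ((centre_comm _).trans (commutant_anti inf_le_left))

namespace IntervalSystem

variable {N l : ℕ} {a : ℤ → ℤ → StarSubalgebra ℂ Ω}

theorem wire_le_left (h : IntervalSystem N l a) {c i j : ℤ} (hi : i ≤ c - 1) (hj : c ≤ j) :
    wire a c ≤ a i j :=
  inf_le_left.trans ((centre_le _).trans (h.mono hi hj))

theorem wire_le_right (h : IntervalSystem N l a) {c i j : ℤ} (hi : i ≤ c) (hj : c + 1 ≤ j) :
    wire a c ≤ a i j :=
  inf_le_right.trans ((centre_le _).trans (h.mono hi hj))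

theorem wire_periodic (h : IntervalSystem N l a) (c : ℤ) : wire a (c + N) = wire a c := by
  unfold wire
  rw [show c + N - 1 = c - 1 + N by ring, show c + N + 1 = c + 1 + N by ring, h.periodic,
    h.periodic]

theorem comm (h : IntervalSystem N l a) {i j k m : ℤ} (hij : i ≤ j) (hjk : j ≤ k)
    (hj : j ≤ i + N) (hm : m ≤ i + N) : a k m ≤ commutant (a i j) := by
  rw [h.compl hij hj]
  exact h.mono hjk hm

theorem centre_eq (h : IntervalSystem N l a) {i j : ℤ} (hij : i ≤ j) (hj : j ≤ i + N) :
    centre (a i j) = a i j ⊓ a j (i + N) := by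
  rw [centre, h.compl hij hj]

theorem wire_comm (h : IntervalSystem N l a) {x y : ℤ} (hxy : x ≤ y) (hy : y ≤ x + N) :
    wire a y ≤ commutant (wire a x) := by
  rcases hxy.eq_or_lt with rfl | h1
  · exact wire_comm_self a x
  rcases hy.eq_or_lt with rfl | h2
  · rw [h.wire_periodic]; exact wire_comm_self a x
  exact (h.wire_le_right le_rfl le_rfl).trans ((h.comm (i := x) (j := x + 1) (by omega) (by omega)
    (by omega) (by omega)).trans (commutant_anti (h.wire_le_right le_rfl le_rfl)))

theorem wire_comm_interval (h : IntervalSystem N l a) {c i j : ℤ} (hij : i ≤ j) (hj : j < i + N)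
    (hc : j ≤ c) (hc' : c ≤ i + N) : wire a c ≤ commutant (a i j) := by
  rw [h.compl hij hj.le]
  rcases hc'.eq_or_lt with rfl | h1
  · exact h.wire_le_left (by omega) le_rfl
  · exact h.wire_le_right hc (by omega)

variable [FiniteDimensional ℂ Ω]

/-- Lets one-sided statements be proved once. Reflection exchanges the two parts of a bipartition,
hence the appeal to `bipartition_symm`. -/
theorem mirror (h : IntervalSystem N l a) : IntervalSystem N l (mirror a) where
  factor := h.factor
  large := h.large
  periodic i j := by
    unfold VertexSplitting.mirror
    rw [← h.periodic]; congr 1 <;> ring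
  mono h1 h2 := h.mono (by omega) (by omega)
  empty h1 := h.empty (by omega)
  full i := by
    unfold VertexSplitting.mirror
    rw [← h.full (1 - (i + N))]; congr 1; ring
  compl := by
    intro i j hij hj
    unfold VertexSplitting.mirror
    rw [h.compl (by omega) (by omega), ← h.periodic (1 - (i + N))]; congr 1; ring
  bipartition := by
    intro i j k hij hjk hk
    unfold VertexSplitting.mirror
    have h1 := bipartition_symm h.factor (F₁ := a (1 - k) (1 - j)) (F₂ := a (1 - j) (1 - i))
      (G := a (1 - k) (1 - i)) (h.mono (by omega) (by omega)) (by
        rw [h.compl (by omega) (by omega)]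
        exact h.bipartition (by omega) (by omega) (by omega))
    rw [h.compl (by omega) (by omega)] at h1
    rw [← h.periodic (1 - (i + N))]
    refine le_trans (le_of_eq ?_) h1
    congr 2; ring
  gap := by
    intro i j k m hij hjk hkm hm
    unfold VertexSplitting.mirror
    have h1 := h.gap (i := 1 - m) (j := 1 - k) (k := 1 - j) (m := 1 - i) (by omega) (by omega)
      (by omega) (by omega)
    rw [← h.periodic (1 - (j + N)), sup_comm]
    refine le_trans (le_of_eq ?_) h1
    congr 2; ring
  uncorrelated := by
    intro i j k m hij hjk hkm hm
    unfold VertexSplitting.mirror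
    rw [← h.periodic (1 - m)]
    exact h.uncorrelated (by omega) (by omega) (by omega) (by omega)

/-- By `gap`, the commutant of the two flanks is `[i, j)` joined with the commuting interval `[t, s
+ N)`. The centre of `[i, j)` is central there, and an algebra and its commutant share their centre.
-/
theorem centre_le_sup_centre (h : IntervalSystem N l a) {s i j t : ℤ} (hs : s < i) (hij : i < j)
    (hjt : j < t) (ht : t < s + N) :
    centre (a i j) ≤ centre (a s i) ⊔ centre (a j t) := by
  have hcomm : a j t ≤ commutant (a s i) := h.comm hs.le hij.le (by omega) (by omega)
  refine le_trans ?_ (centre_sup_le h.factor hcomm)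
  have heq : commutant (a s i ⊔ a j t) = a i j ⊔ a t (s + N) := by
    rw [commutant_sup, h.compl hs.le (by omega), h.compl hjt.le (by omega)]
    refine le_antisymm (h.gap hij hjt ht (by omega)) (sup_le (le_inf ?_ ?_) (le_inf ?_ ?_))
    · exact h.mono le_rfl (by omega)
    · rw [← h.periodic]; exact h.mono (by omega) (by omega)
    · exact h.mono (by omega) le_rfl
    · exact h.mono le_rfl (by omega)
  rw [← centre_commutant h.factor (a s i ⊔ a j t), heq]
  exact centre_le_centre_sup (h.comm hij.le hjt.le (by omega) (by omega))

/-- Flank `[i, i+l)` on the right by one vertex and by `l + 1` vertices. Both flanks are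
uncorrelated with the vertex `i - 1`, so the left flank cancels; what survives on the right is
central in both flanks. -/
theorem centre_of_length_le_wire_sup (h : IntervalSystem N l a) (hl : 1 ≤ l) (i : ℤ) :
    centre (a i (i + l)) ≤ wire a (i + l) ⊔ centre (a (i - 1) i) := by
  have hN := h.large
  obtain ⟨j, hj⟩ : ∃ j, j = i + (l : ℤ) := ⟨_, rfl⟩
  rw [← hj]
  have h1 : centre (a i j) ≤ centre (a j (j + 1)) ⊔ centre (a (i - 1) i) := by
    rw [sup_comm]
    exact h.centre_le_sup_centre (by omega) (by omega) (by omega) (by omega)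
  have h2 : centre (a i j) ≤ centre (a j (j + l + 1)) ⊔ centre (a (i - 1) i) := by
    rw [sup_comm]
    exact h.centre_le_sup_centre (by omega) (by omega) (by omega) (by omega)
  have hc : a j (j + l + 1) ≤ commutant (a (i - 1) i) :=
    h.comm (by omega) (by omega) (by omega) (by omega)
  have hu : Uncorrelated (a (i - 1) i) (a j (j + l + 1)) :=
    h.uncorrelated (by omega) (by omega) (by omega) (by omega)
  refine (le_inf h1 h2).trans ((sup_inf_sup_le_of_uncorrelated (G := a j (j + l + 1))
    (centre_comm _) ((centre_le _).trans (le_commutant_comm.1 hc)) le_rfl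
    ((centre_le _).trans (h.mono le_rfl (by omega))) (centre_le _)
    ((hu.symm hc).mono (centre_le _) (centre_le _))).trans (sup_le_sup ?_ le_rfl))
  -- Now `[j, j+l+1)` is flanked by single vertices, the right one being `l` away from `[j-1, j+1)`
  -- and thus cancelled. The survivor is central in the vertices on both sides of the cut `j`.
  have h3 : centre (a j (j + l + 1)) ≤
      centre (a (j - 1) j) ⊔ centre (a (j + l + 1) (j + l + 2)) :=
    h.centre_le_sup_centre (by omega) (by omega) (by omega) (by omega)
  have h4 : centre (a j (j + 1)) ⊓ centre (a j (j + l + 1)) ≤ centre (a (j - 1) j) := by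
    refine (inf_le_inf ((centre_le _).trans (h.mono (i := j - 1) (j := j + 1) (by omega) le_rfl))
      h3).trans (inf_sup_le_of_uncorrelated (centre_comm _) ((centre_le _).trans
        (h.comm (by omega) (by omega) (by omega) (by omega)))
        ((centre_le _).trans (h.mono le_rfl (by omega))) ?_)
    exact (h.uncorrelated (i := j - 1) (j := j + 1) (k := j + l + 1) (m := j + l + 2) (by omega)
      (by omega) (by omega) (by omega)).mono (centre_le _) (centre_le _)
  exact le_inf h4 inf_le_left

/-- The one-sided bound meets its mirror image; the vertices `i - 1` and `i + l` are far enough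
apart for cancellation. -/
theorem centre_of_length_le (h : IntervalSystem N l a) (hl : 1 ≤ l) (i : ℤ) :
    centre (a i (i + l)) ≤ wire a i ⊔ wire a (i + l) := by
  have hN := h.large
  have h1 := h.centre_of_length_le_wire_sup hl i
  have h2 := h.mirror.centre_of_length_le_wire_sup hl (1 - i - l)
  rw [wire_mirror, VertexSplitting.mirror, VertexSplitting.mirror,
    show (1 : ℤ) - (1 - i - l + l) = i by ring, show (1 : ℤ) - (1 - i - l) = i + l by ring,
    show (1 : ℤ) - (1 - i - l - 1) = i + l + 1 by ring] at h2
  have hc : a (i + l) (i + l + 1) ≤ commutant (a (i - 1) i) :=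
    h.comm (by omega) (by omega) (by omega) (by omega)
  have hu : Uncorrelated (a (i - 1) i) (a (i + l) (i + l + 1)) :=
    h.uncorrelated (by omega) (by omega) (by omega) (by omega)
  rw [sup_comm] at h2
  refine (le_inf h2 h1).trans ((sup_inf_sup_le_of_uncorrelated (G := a (i + l) (i + l + 1))
    (centre_comm _) ((centre_le _).trans (le_commutant_comm.1 hc)) inf_le_left (centre_le _)
    (h.wire_le_right le_rfl le_rfl) ((hu.symm hc).mono (centre_le _) (centre_le _))).trans ?_)
  rw [sup_comm]
  exact sup_le_sup le_rfl inf_le_right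

/-- For `l = 0` an interval is uncorrelated with its complement, while its centre lies in both. -/
theorem centre_le_bot (h : IntervalSystem N l a) (hl : l = 0) {i j : ℤ} (hij : i ≤ j)
    (hj : j ≤ i + N) : centre (a i j) ≤ ⊥ := by
  have hu : Uncorrelated (a i j) (a j (i + N)) :=
    h.uncorrelated hij (by omega) (by omega) (by omega)
  have hD : centre (a i j) ≤ a j (i + N) := by rw [h.centre_eq hij hj]; exact inf_le_right
  refine le_trans (le_inf (centre_le _) le_sup_right) (inf_sup_le_of_uncorrelated (G := a i j)
    (D := centre (a i j)) (centre_comm _) (centre_le_commutant _) bot_le ?_)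
  exact hu.mono (centre_le _) hD

theorem wire_eq_bot (h : IntervalSystem N l a) (hl : l = 0) (i : ℤ) : wire a i = ⊥ := by
  have hN := h.large
  exact le_bot_iff.1 (inf_le_right.trans (h.centre_le_bot hl (by omega) (by omega)))

/-- Strong connectedness. -/
theorem centre_le_wires (h : IntervalSystem N l a) {i j : ℤ} (hij : i ≤ j) (hj : j ≤ i + N) :
    centre (a i j) ≤ wire a i ⊔ wire a j := by
  have hN := h.large
  rcases Nat.eq_zero_or_pos l with hl | hl
  · exact (h.centre_le_bot hl hij hj).trans bot_le
  rcases hij.eq_or_lt with rfl | hij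
  · rw [h.empty le_rfl]; exact (centre_le _).trans bot_le
  rcases hj.eq_or_lt with rfl | hj
  · rw [h.full, h.factor]; exact bot_le
  -- Flanks of length `l` contribute the wires at `i - l`, `i`, `j` and `j + l`; the outer two are
  -- uncorrelated with `[i, j)` and cancel.
  have key : ∀ {i j : ℤ}, i < j → j - i + 2 * l + 1 ≤ N → centre (a i j) ≤ wire a i ⊔ wire a j := by
    intro i j hij hlen
    have h1 : centre (a i j) ≤ centre (a (i - l) i) ⊔ centre (a j (j + l)) :=
      h.centre_le_sup_centre (by omega) hij (by omega) (by omega)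
    have h2 := h.centre_of_length_le hl (i - l)
    rw [sub_add_cancel] at h2
    have h3 := h.centre_of_length_le hl j
    have hw1 : wire a (i - l) ≤ a (j + l) (i - l + N) := by
      rw [← h.wire_periodic]
      exact h.wire_le_left (by omega) le_rfl
    have hw2 : wire a (j + l) ≤ a (j + l) (i - l + N) := h.wire_le_right le_rfl (by omega)
    have hcw : wire a (j + l) ≤ commutant (wire a (i - l)) := h.wire_comm (by omega) (by omega)
    have hc : a (j + l) (i - l + N) ≤ commutant (a i j) :=
      h.comm (by omega) (by omega) (by omega) (by omega)
    have hD : wire a (i - l) ⊔ wire a (j + l) ≤ commutant (wire a (i - l) ⊔ wire a (j + l)) := by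
      rw [commutant_sup]
      exact sup_le (le_inf (wire_comm_self _ _) (le_commutant_comm.1 hcw))
        (le_inf hcw (wire_comm_self _ _))
    have hu : Uncorrelated (a i j) (a (j + l) (i - l + N)) :=
      h.uncorrelated (by omega) (by omega) (by omega) (by omega)
    refine le_trans (le_inf (centre_le _) (h1.trans (sup_le (h2.trans ?_) (h3.trans ?_))))
      (inf_sup_le_of_uncorrelated (G := a i j) (V := wire a i ⊔ wire a j) hD
        ((sup_le hw1 hw2).trans hc)
        (sup_le (h.wire_le_right le_rfl (by omega)) (h.wire_le_left (by omega) le_rfl))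
        (hu.mono (centre_le _) (sup_le hw1 hw2)))
    · exact sup_le (le_sup_left.trans le_sup_right) (le_sup_left.trans le_sup_left)
    · exact sup_le (le_sup_right.trans le_sup_left) (le_sup_right.trans le_sup_right)
  by_cases hlen : j - i + 2 * l + 1 ≤ N
  · exact key hij hlen
  -- The complement has the same centre and length at most `2l`, which is short enough because `4l +
  -- 1 ≤ N`.
  · have h1 := key (i := j) (j := i + N) hj (by omega)
    rw [h.wire_periodic, ← h.compl hij.le hj.le, centre_commutant h.factor, sup_comm] at h1
    exact h1

/-- Of the two wires in the centre of `[i, k)`, the one at `k` already lies in `[j, k)`. -/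
theorem inf_le_sup_wire (h : IntervalSystem N l a) {i j k : ℤ} (hij : i ≤ j) (hjk : j < k)
    (hk : k ≤ i + N) : a i k ⊓ a j (i + N) ≤ a j k ⊔ wire a i := by
  refine (h.bipartition hij hjk.le hk).trans (sup_le le_sup_left ((h.centre_le_wires
    (hij.trans hjk.le) hk).trans (sup_le le_sup_right ?_)))
  exact (h.wire_le_left (by omega) le_rfl).trans le_sup_left

/-- Cutting an interval at a point amounts to commuting with the wire there. -/
theorem inf_commutant_wire_le (h : IntervalSystem N l a) {i j k : ℤ} (hij : i ≤ j) (hjk : j ≤ k)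
    (hk : k < i + N ∨ (l = 0 ∧ k = i + N)) : a i k ⊓ commutant (wire a j) ≤ a i j ⊔ a j k := by
  have hk' : k ≤ i + N := by omega
  -- In commutant form this is `inf_le_sup_wire` for `[j, i + N)` cut at `k`. When `k = i + N` the
  -- inner interval is empty, hence the restriction to `l = 0`.
  refine commutant_le_commutant h.factor ?_
  rw [commutant_sup, commutant_inf h.factor, commutant_commutant h.factor, h.compl hij (by omega),
    h.compl hjk (by omega), h.compl (hij.trans hjk) hk']
  rcases hk with hk | ⟨hl, rfl⟩
  · exact h.inf_le_sup_wire hjk hk (by omega)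
  · rw [← h.compl hjk (by omega)]
    exact (h.centre_le_bot hl hjk (by omega)).trans bot_le

/-- A wire lies in the vertex on either side of its cut: the inner vertices serve when they are `l`
apart, the outer ones otherwise. -/
theorem wire_uncorrelated_wire (h : IntervalSystem N l a) {x y : ℤ} (hxy : x + l ≤ y)
    (hy : y + l ≤ x + N) : Uncorrelated (wire a x) (wire a y) := by
  have hN := h.large
  rcases Nat.eq_zero_or_pos l with hl | hl
  · rw [h.wire_eq_bot hl]; exact uncorrelated_bot_left _
  by_cases h1 : x + l + 2 ≤ y
  · exact (h.uncorrelated (i := x) (j := x + 1) (k := y - 1) (m := y) (by omega) (by omega)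
      (by omega) (by omega)).mono (h.wire_le_right le_rfl le_rfl) (h.wire_le_left le_rfl le_rfl)
  · exact (h.uncorrelated (i := x - 1) (j := x) (k := y) (m := y + 1) (by omega) (by omega)
      (by omega) (by omega)).mono (h.wire_le_left le_rfl le_rfl) (h.wire_le_right le_rfl le_rfl)

/-- If one of the gaps next to `x` exceeds `l`, the wire at `x` is placed in the vertex on that
side. If both equal `l`, the third gap is `N - 2l > l`: the wire at `y` is treated first, and
`Uncorrelated.assoc` moves the separation to `x`. -/
theorem wire_uncorrelated_sup (h : IntervalSystem N l a) {x y z : ℤ} (hxy : x + l ≤ y)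
    (hyz : y ≤ z) (hz : z + l ≤ x + N) : Uncorrelated (wire a x) (wire a y ⊔ wire a z) := by
  have hN := h.large
  rcases Nat.eq_zero_or_pos l with hl | hl
  · rw [h.wire_eq_bot hl]; exact uncorrelated_bot_left _
  rcases hyz.eq_or_lt with rfl | hyz
  · rw [sup_idem]; exact h.wire_uncorrelated_wire hxy hz
  have key : ∀ {x y z : ℤ}, x + l ≤ y → y < z → z + l ≤ x + N →
      (x + l < y ∨ z + l < x + N) → Uncorrelated (wire a x) (wire a y ⊔ wire a z) := by
    intro x y z hxy hyz hz hor
    have hle : wire a y ⊔ wire a z ≤ a y z :=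
      sup_le (h.wire_le_right le_rfl (by omega)) (h.wire_le_left (by omega) le_rfl)
    rcases hor with h1 | h1
    · exact (h.uncorrelated (i := x) (j := x + 1) (by omega) (by omega) hyz.le hz).mono
        (h.wire_le_right le_rfl le_rfl) hle
    · exact (h.uncorrelated (i := x - 1) (j := x) (by omega) (by omega) hyz.le (by omega)).mono
        (h.wire_le_left le_rfl le_rfl) hle
  by_cases hor : x + l < y ∨ z + l < x + N
  · exact key hxy hyz hz hor
  have h1 : Uncorrelated (wire a y) (wire a z ⊔ wire a (x + N)) :=
    key (by omega) (by omega) (by omega) (by omega)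
  rw [h.wire_periodic] at h1
  have hxz : Uncorrelated (wire a x) (wire a z) := h.wire_uncorrelated_wire (by omega) hz
  have cxy : wire a y ≤ commutant (wire a x) := h.wire_comm (by omega) (by omega)
  have cxz : wire a z ≤ commutant (wire a x) := h.wire_comm (by omega) (by omega)
  have cyz : wire a z ≤ commutant (wire a y) := h.wire_comm (by omega) (by omega)
  have h2 := Uncorrelated.assoc (F := wire a y) (G := wire a z) (H := wire a x)
    (wire_comm_self _ _) cyz (le_commutant_comm.1 cxy) h1 (hxz.symm cxz)
  rw [sup_comm] at h2
  refine h2.symm ?_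
  rw [commutant_sup]
  exact le_inf (le_commutant_comm.1 cxy) (le_commutant_comm.1 cxz)

end IntervalSystem

/-! ### Intervals ending at the new cut. -/

/-- The data of the splitting of the vertex `0`, with `R = L'`: the algebra `L` lies between those
of `[-n₁, 0)` and `[-n₁, 1)`, and `R` is generated by the algebra of `[1, n₂ + 1)` and its part in
`[0, n₂ - l + 1)`. -/
structure SplitData (N l n₁ n₂ : ℕ) (a : ℤ → ℤ → StarSubalgebra ℂ Ω) (L R : StarSubalgebra ℂ Ω) :
    Prop where
  sys : IntervalSystem N l a
  size : n₁ + n₂ + 1 = N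
  large_left : 2 * l ≤ n₁
  large_right : 2 * l ≤ n₂
  commutant_left : commutant L = R
  le_left : a (-n₁) 0 ≤ L
  left_le : L ≤ a (-n₁) 1
  restriction : a (-n₁) 1 ⊓ commutant (R ⊓ a 0 (n₂ - l + 1)) ≤ L

/-- The algebra of the interval of the split cycle that ends with the left half of `0`. -/
def leftAlg (a : ℤ → ℤ → StarSubalgebra ℂ Ω) (L : StarSubalgebra ℂ Ω) (k : ℤ) :
    StarSubalgebra ℂ Ω :=
  a (-k) 0 ⊔ (a (-k) 1 ⊓ L)

/-- The algebra of the interval of the split cycle that starts with the right half of `0`. -/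
def rightAlg (a : ℤ → ℤ → StarSubalgebra ℂ Ω) (R : StarSubalgebra ℂ Ω) (j : ℤ) :
    StarSubalgebra ℂ Ω :=
  a 1 (j + 1) ⊔ (a 0 (j + 1) ⊓ R)

theorem leftAlg_mirror (a : ℤ → ℤ → StarSubalgebra ℂ Ω) (R : StarSubalgebra ℂ Ω) (j : ℤ) :
    leftAlg (mirror a) R j = rightAlg a R j := by
  unfold leftAlg rightAlg mirror
  congr 2 <;> congr 1 <;> ring

theorem rightAlg_mirror (a : ℤ → ℤ → StarSubalgebra ℂ Ω) (L : StarSubalgebra ℂ Ω) (k : ℤ) :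
    rightAlg (mirror a) L k = leftAlg a L k := by
  unfold leftAlg rightAlg mirror
  congr 2 <;> congr 1 <;> ring

namespace SplitData

variable {N l n₁ n₂ : ℕ} {a : ℤ → ℤ → StarSubalgebra ℂ Ω} {L R : StarSubalgebra ℂ Ω}

theorem le_right (d : SplitData N l n₁ n₂ a L R) : a 1 (n₂ + 1) ≤ R := by
  have hs := d.size
  have h1 := commutant_anti d.left_le
  rw [d.commutant_left, d.sys.compl (by omega) (by omega)] at h1
  exact (d.sys.mono le_rfl (by omega)).trans h1

theorem right_le (d : SplitData N l n₁ n₂ a L R) : R ≤ a 0 (n₂ + 1) := by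
  have hs := d.size
  have h1 := commutant_anti d.le_left
  rw [d.commutant_left, d.sys.compl (by omega) (by omega)] at h1
  exact h1.trans (d.sys.mono le_rfl (by omega))

theorem wire_end (d : SplitData N l n₁ n₂ a L R) : wire a (n₂ + 1) = wire a (-n₁) := by
  have hs := d.size
  rw [← d.sys.wire_periodic (-n₁)]; congr 1; omega

/-- Up to `n₁` the first term lies in `L`, which gives rule 2. Beyond `n₁` the join is the commutant
of a short right interval, which is rule 4. -/
theorem leftAlg_eq (d : SplitData N l n₁ n₂ a L R) {k : ℤ} (hk : k ≤ n₁) :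
    leftAlg a L k = a (-k) 1 ⊓ L :=
  le_antisymm (sup_le (le_inf (d.sys.mono le_rfl (by omega))
    ((d.sys.mono (by omega) le_rfl).trans d.le_left)) le_rfl) le_sup_right

theorem rightAlg_eq (d : SplitData N l n₁ n₂ a L R) {j : ℤ} (hj : j ≤ n₂) :
    rightAlg a R j = a 0 (j + 1) ⊓ R :=
  le_antisymm (sup_le (le_inf (d.sys.mono (by omega) le_rfl)
    ((d.sys.mono le_rfl (by omega)).trans d.le_right)) le_rfl) le_sup_right

theorem leftAlg_le (d : SplitData N l n₁ n₂ a L R) (k : ℤ) : leftAlg a L k ≤ a (-k) 1 :=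
  sup_le (d.sys.mono le_rfl (by omega)) inf_le_left

variable [FiniteDimensional ℂ Ω]

theorem commutant_right (d : SplitData N l n₁ n₂ a L R) : commutant R = L := by
  rw [← d.commutant_left, commutant_commutant d.sys.factor]

theorem wire_le_left (d : SplitData N l n₁ n₂ a L R) {k : ℤ} (h0 : 0 ≤ k) (hk : k ≤ n₁) :
    wire a (-k) ≤ L := by
  have h1 := d.large_left
  rcases Nat.eq_zero_or_pos l with hl | hl
  · rw [d.sys.wire_eq_bot hl]; exact bot_le
  refine le_trans ?_ d.le_left
  rcases hk.eq_or_lt with rfl | hk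
  · exact d.sys.wire_le_right le_rfl (by omega)
  · exact d.sys.wire_le_left (by omega) (by omega)

/-- The part of `L` in an interval together with a wire further left is generated by the part of
`L` in the interval and the wire. -/
theorem left_inf_sup_wire_le (d : SplitData N l n₁ n₂ a L R) {k k₁ : ℤ} (h0 : 0 ≤ k)
    (hk : k ≤ k₁) (hk₁ : k₁ ≤ n₁) :
    L ⊓ (a (-k) 1 ⊔ wire a (-k₁)) ≤ (L ⊓ a (-k) 1) ⊔ wire a (-k₁) := by
  have hs := d.size
  have hl₁ := d.large_left
  have hl₂ := d.large_right
  have hN := d.sys.large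
  rcases Nat.eq_zero_or_pos l with hl | hl
  · rw [d.sys.wire_eq_bot hl, sup_bot_eq, sup_bot_eq]
  rcases hk.eq_or_lt with rfl | hk
  · exact (inf_le_inf le_rfl (sup_le le_rfl (d.sys.wire_le_right le_rfl (by omega)))).trans
      le_sup_left
  -- The cut after `q₊` lies `l` before `n₂ + 1`, the same cut as `-n₁`, so its wire is uncorrelated
  -- with those at `-k` and `-k₁` together.
  obtain ⟨q, hq⟩ : ∃ q : ℤ, q = n₂ - l + 1 := ⟨_, rfl⟩
  set Q := R ⊓ a 0 (n₂ - l + 1) with hQ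
  rw [← hq] at hQ
  have hLQ : L ≤ commutant Q := by
    rw [le_commutant_comm, d.commutant_left]; exact inf_le_left
  have hper : wire a (N - k₁) = wire a (-k₁) := by
    rw [← d.sys.wire_periodic (-k₁)]; congr 1; ring
  have hper' : wire a (N - k) = wire a (-k) := by
    rw [← d.sys.wire_periodic (-k)]; congr 1; ring
  set G := a (-k) q with hG
  have hDG : wire a (-k₁) ≤ commutant G := by
    rw [← hper]
    exact d.sys.wire_comm_interval (by omega) (by omega) (by omega) (by omega)
  have hQG : Q ≤ G := by rw [hQ]; exact inf_le_right.trans (d.sys.mono (by omega) le_rfl)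
  have hV : a (-k) 1 ≤ G := d.sys.mono le_rfl (by omega)
  have hwV : wire a (-k) ≤ a (-k) 1 := d.sys.wire_le_right le_rfl (by omega)
  have hwL : wire a (-k) ≤ L := d.wire_le_left h0 (by omega)
  have hwG : wire a (-k) ≤ centre G := by
    refine le_inf (hwV.trans hV) ?_
    rw [← hper']
    exact d.sys.wire_comm_interval (by omega) (by omega) (by omega) (by omega)
  have hind : CondIndep G (wire a (-k₁)) (wire a (-k)) := by
    refine condIndep_of_uncorrelated (Z₁ := wire a q) hDG hwG
      (d.sys.wire_comm (by omega) (by omega)) (d.sys.centre_le_wires (by omega) (by omega)) ?_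
    rw [← hper, ← hper', sup_comm]
    exact d.sys.wire_uncorrelated_sup (by omega) (by omega) (by omega)
  -- Elements of `L` commute with `Q ⊆ R`, and the far wire can be set aside before this is imposed.
  have h1 : L ⊓ (a (-k) 1 ⊔ wire a (-k₁)) ≤ (G ⊓ commutant Q) ⊔ wire a (-k₁) :=
    (le_inf (inf_le_right.trans (sup_le_sup hV le_rfl)) (inf_le_left.trans hLQ)).trans
      (sup_inf_commutant_le d.sys.factor hQG hDG)
  refine (le_inf inf_le_right h1).trans ((sup_inf_sup_le_of_condIndep (wire_comm_self _ _) hDG hwG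
    le_rfl hV inf_le_left hwV (le_inf (hwG.trans (centre_le _)) (hwL.trans hLQ)) hind).trans
      (sup_le_sup (le_inf ?_ inf_le_left) le_rfl))
  -- Commuting with `Q` inside `A⟦p₋,0⟧` leads back to `L`.
  refine le_trans ?_ d.restriction
  exact le_inf (inf_le_left.trans (d.sys.mono (by omega) le_rfl)) (inf_le_right.trans inf_le_right)

/-- `L` is generated by the algebra of `[-n₁, 0)` and its part in `[-(n₁ - l), 1)`. -/
theorem left_le_sup (d : SplitData N l n₁ n₂ a L R) :
    L ≤ a (-n₁) 0 ⊔ (L ⊓ a (-(n₁ - l)) 1) := by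
  have hs := d.size
  have hl₁ := d.large_left
  have hl₂ := d.large_right
  have hN := d.sys.large
  rcases Nat.eq_zero_or_pos l with hl | hl
  · refine le_trans (le_inf le_rfl (d.left_le.trans (d.sys.mono ?_ le_rfl))) le_sup_right
    omega
  obtain ⟨k, hk⟩ : ∃ k : ℤ, k = n₁ - l := ⟨_, rfl⟩
  rw [← hk]
  -- In commutant form: the wire at `-k` is at least `l` away from both ends of `[0, n₂ + 1)`, hence
  -- useless for generating an element of that interval from `R`.
  have h1 : L ≤ a (-n₁) 0 ⊔ (L ⊓ commutant (wire a (-k))) := by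
    refine commutant_le_commutant d.sys.factor ?_
    rw [commutant_sup, commutant_inf d.sys.factor, commutant_commutant d.sys.factor,
      d.commutant_left, d.sys.compl (by omega) (by omega)]
    have hend : a 0 (-n₁ + N) = a 0 (n₂ + 1) := by congr 1; omega
    rw [hend]
    have hper : wire a (N - k) = wire a (-k) := by
      rw [← d.sys.wire_periodic (-k)]; congr 1; ring
    have hcomm : wire a (-k) ≤ commutant (a 0 (n₂ + 1)) := by
      rw [← hper]
      exact d.sys.wire_comm_interval (by omega) (by omega) (by omega) (by omega)
    refine inf_sup_le_of_uncorrelated (wire_comm_self _ _) hcomm d.right_le ?_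
    have hu : Uncorrelated (wire a (-k)) (wire a 0 ⊔ wire a (n₂ + 1)) :=
      d.sys.wire_uncorrelated_sup (by omega) (by omega) (by omega)
    have hc : wire a 0 ⊔ wire a (n₂ + 1) ≤ commutant (wire a (-k)) :=
      sup_le (d.sys.wire_comm (by omega) (by omega)) (d.sys.wire_comm (by omega) (by omega))
    exact (hu.symm hc).mono (d.sys.centre_le_wires (by omega) (by omega)) le_rfl
  refine h1.trans (sup_le le_sup_left ?_)
  have hF : a (-n₁) (-k) ≤ L := (d.sys.mono le_rfl (by omega)).trans d.le_left
  -- Commuting with the wire allows a cut at `-k`. The modular law pulls out `[-n₁, -k)`, and the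
  -- remaining far wire is handled by `left_inf_sup_wire_le`.
  have h2 : L ⊓ commutant (wire a (-k)) ≤ L ⊓ (a (-n₁) (-k) ⊔ a (-k) 1) :=
    le_inf inf_le_left ((inf_le_inf_right _ d.left_le).trans
      (d.sys.inf_commutant_wire_le (by omega) (by omega) (by omega)))
  have hw : wire a (-k) ≤ a (-k) 1 := d.sys.wire_le_right le_rfl (by omega)
  have h3 : centre (a (-n₁) (-k)) ≤ wire a (-n₁) ⊔ wire a (-k) :=
    d.sys.centre_le_wires (by omega) (by omega)
  have h4 : a (-k) 1 ⊔ centre (a (-n₁) (-k)) ≤ a (-k) 1 ⊔ wire a (-n₁) :=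
    sup_le le_sup_left (h3.trans (sup_le le_sup_right (hw.trans le_sup_left)))
  refine h2.trans ((inf_sup_le_sup_inf_centre d.sys.factor hF
    (d.sys.comm (by omega) (by omega) (by omega) (by omega))).trans
      (sup_le ((d.sys.mono le_rfl (by omega)).trans le_sup_left) ?_))
  refine (inf_le_inf le_rfl h4).trans ((d.left_inf_sup_wire_le (by omega) (by omega) le_rfl).trans
    (sup_le le_sup_right ((d.sys.wire_le_right le_rfl ?_).trans le_sup_left)))
  omega

/-- The restriction condition for `R` is the commutant of `left_le_sup`: the hypotheses are
symmetric although stated on one side only. -/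
theorem mirror (d : SplitData N l n₁ n₂ a L R) : SplitData N l n₂ n₁ (mirror a) R L where
  sys := d.sys.mirror
  size := by have := d.size; omega
  large_left := d.large_right
  large_right := d.large_left
  commutant_left := d.commutant_right
  le_left := le_trans (le_of_eq (by unfold VertexSplitting.mirror; congr 1; ring)) d.le_right
  left_le := d.right_le.trans (le_of_eq (by unfold VertexSplitting.mirror; congr 1; ring))
  restriction := by
    have h1 := commutant_anti d.left_le_sup
    have hs := d.size
    rw [commutant_sup, d.commutant_left, d.sys.compl (by omega) (by omega)] at h1
    refine le_trans (le_of_eq ?_) h1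
    unfold VertexSplitting.mirror
    congr 2
    · omega
    · congr 2; ring

theorem right_inf_sup_wire_le (d : SplitData N l n₁ n₂ a L R) {j j₁ : ℤ} (h0 : 0 ≤ j)
    (hj : j ≤ j₁) (hj₁ : j₁ ≤ n₂) :
    R ⊓ (a 0 (j + 1) ⊔ wire a (j₁ + 1)) ≤ (R ⊓ a 0 (j + 1)) ⊔ wire a (j₁ + 1) := by
  have h1 := d.mirror.left_inf_sup_wire_le h0 hj hj₁
  rw [wire_mirror, VertexSplitting.mirror, show (1 : ℤ) - 1 = 0 by ring,
    show (1 : ℤ) - -j = j + 1 by ring, show (1 : ℤ) - -j₁ = j₁ + 1 by ring] at h1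
  exact h1

/-- The commutant of a meet is a join, and the `R`-part of so long a right interval is all of `R`.
-/
theorem commutant_leftAlg_of_le (d : SplitData N l n₁ n₂ a L R) {k : ℤ} (h0 : 0 ≤ k)
    (hk : k ≤ n₁) : commutant (leftAlg a L k) = rightAlg a R (N - 1 - k) := by
  have hs := d.size
  rw [d.leftAlg_eq hk, commutant_inf d.sys.factor, d.commutant_left,
    d.sys.compl (by omega) (by omega), rightAlg, show (N : ℤ) - 1 - k + 1 = -k + N by ring]
  have h1 : R ≤ a 0 (-k + N) := d.right_le.trans (d.sys.mono le_rfl (by omega))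
  rw [inf_eq_right.2 h1]

theorem commutant_rightAlg_of_le (d : SplitData N l n₁ n₂ a L R) {j : ℤ} (h0 : 0 ≤ j)
    (hj : j ≤ n₂) : commutant (rightAlg a R j) = leftAlg a L (N - 1 - j) := by
  have h1 := d.mirror.commutant_leftAlg_of_le h0 hj
  rw [leftAlg_mirror, rightAlg_mirror] at h1
  exact h1

theorem commutant_leftAlg (d : SplitData N l n₁ n₂ a L R) {k : ℤ} (h0 : 0 ≤ k)
    (hk : k ≤ N - 1) : commutant (leftAlg a L k) = rightAlg a R (N - 1 - k) := by
  have hs := d.size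
  by_cases h : k ≤ n₁
  · exact d.commutant_leftAlg_of_le h0 h
  · rw [← commutant_commutant d.sys.factor (rightAlg a R _),
      d.commutant_rightAlg_of_le (by omega) (by omega), sub_sub_cancel]

theorem commutant_rightAlg (d : SplitData N l n₁ n₂ a L R) {j : ℤ} (h0 : 0 ≤ j)
    (hj : j ≤ N - 1) : commutant (rightAlg a R j) = leftAlg a L (N - 1 - j) := by
  have h1 := d.mirror.commutant_leftAlg h0 hj
  rw [leftAlg_mirror, rightAlg_mirror] at h1
  exact h1

theorem wire_le_leftAlg (d : SplitData N l n₁ n₂ a L R) {k : ℤ} (h0 : 0 ≤ k) :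
    wire a (-k) ≤ leftAlg a L k := by
  rcases h0.eq_or_lt with rfl | h0
  · exact (le_inf (d.sys.wire_le_right le_rfl (by omega)) (d.wire_le_left le_rfl (by omega))).trans
      le_sup_right
  · exact (d.sys.wire_le_right le_rfl (by omega)).trans le_sup_left

/-- Cut at `j + 1`, pull out `[j+1, j₁+1) ⊆ R` by the modular law, and separate the wire at `j₁ +
1`. Its commutant gives the bipartitions of long left intervals. -/
theorem right_inf_commutant_wire_le (d : SplitData N l n₁ n₂ a L R) {j j₁ : ℤ} (h0 : 0 ≤ j)
    (hj : j ≤ j₁) (hj₁ : j₁ ≤ n₂) :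
    R ⊓ a 0 (j₁ + 1) ⊓ commutant (wire a (j + 1)) ≤ (R ⊓ a 0 (j + 1)) ⊔ a (j + 1) (j₁ + 1) := by
  have hs := d.size
  have hl₁ := d.large_left
  rcases hj.eq_or_lt with rfl | hj
  · exact inf_le_left.trans le_sup_left
  have h1 : R ⊓ a 0 (j₁ + 1) ⊓ commutant (wire a (j + 1)) ≤
      R ⊓ (a (j + 1) (j₁ + 1) ⊔ a 0 (j + 1)) := by
    rw [inf_assoc, sup_comm]
    exact inf_le_inf le_rfl (d.sys.inf_commutant_wire_le (by omega) (by omega) (by omega))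
  have hF : a (j + 1) (j₁ + 1) ≤ R := (d.sys.mono (by omega) (by omega)).trans d.le_right
  have h2 : a 0 (j + 1) ⊔ centre (a (j + 1) (j₁ + 1)) ≤ a 0 (j + 1) ⊔ wire a (j₁ + 1) :=
    sup_le le_sup_left ((d.sys.centre_le_wires (by omega) (by omega)).trans
      (sup_le ((d.sys.wire_le_left (by omega) le_rfl).trans le_sup_left) le_sup_right))
  refine h1.trans ((inf_sup_le_sup_inf_centre d.sys.factor hF (le_commutant_comm.1
    (d.sys.comm (by omega) le_rfl (by omega) (by omega)))).trans (sup_le le_sup_right ?_))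
  refine (inf_le_inf le_rfl h2).trans ((d.right_inf_sup_wire_le h0 hj.le hj₁).trans
    (sup_le_sup le_rfl (d.sys.wire_le_left (by omega) le_rfl)))

theorem left_inf_le (d : SplitData N l n₁ n₂ a L R) {k k₂ : ℤ} (h0 : 0 ≤ k) (hk : k ≤ k₂)
    (hk₂ : k₂ ≤ n₁) :
    L ⊓ a (-k₂) 1 ⊓ a (-k) (N - k₂) ≤ (L ⊓ a (-k) 1) ⊔ wire a (-k₂) := by
  have hs := d.size
  have h1 := d.sys.inf_le_sup_wire (i := -k₂) (j := -k) (k := 1) (by omega) (by omega) (by omega)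
  rw [show -k₂ + (N : ℤ) = N - k₂ by ring] at h1
  rw [inf_assoc]
  exact (inf_le_inf le_rfl h1).trans (d.left_inf_sup_wire_le h0 hk hk₂)

theorem commutant_right_inf_le (d : SplitData N l n₁ n₂ a L R) {j : ℤ} (h0 : 0 ≤ j)
    (hj : j < n₂) : commutant (a 0 (j + 1) ⊓ R) ⊓ a (-n₁) (j + 1) ≤ L ⊔ wire a (j + 1) := by
  have hs := d.size
  refine commutant_le_commutant d.sys.factor ?_
  rw [commutant_sup, commutant_inf d.sys.factor, commutant_commutant d.sys.factor,
    d.commutant_left, d.sys.compl (by omega) (by omega), inf_comm (a 0 (j + 1))]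
  have h2 := d.right_inf_commutant_wire_le (j := j) (j₁ := n₂) h0 hj.le le_rfl
  rw [inf_eq_left.2 d.right_le] at h2
  exact h2.trans (sup_le_sup le_rfl (d.sys.mono le_rfl (by omega)))

/-- A long left interval cut at a short distance. The wire at `-n₁` enters but commutes with `[-k,
j+1)`, so the relative double commutant trades it for a centre. -/
theorem commutant_right_inf_le_of_le (d : SplitData N l n₁ n₂ a L R) {j k : ℤ} (h0 : 0 ≤ j)
    (hj : j < n₂) (hk : 0 ≤ k) (hkn : k ≤ n₁) :
    commutant (a 0 (j + 1) ⊓ R) ⊓ a (-k) (j + 1) ≤ (L ⊓ a (-k) 1) ⊔ wire a (j + 1) := by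
  have hs := d.size
  have h1 := d.commutant_right_inf_le h0 hj
  have hwR : wire a (j + 1) ≤ commutant L := by
    rw [d.commutant_left]
    exact (d.sys.wire_le_right (by omega) (by omega)).trans d.le_right
  have hU : a (-n₁) (-k) ≤ L := (d.sys.mono le_rfl (by omega)).trans d.le_left
  have h2 := sup_inf_commutant_le d.sys.factor hU hwR
  rw [d.sys.compl (by omega) (by omega)] at h2
  have h3 : L ⊓ a (-k) (-n₁ + N) ≤ (L ⊓ a (-k) 1) ⊔ wire a (-n₁) := by
    have h4 := d.left_inf_le hk hkn le_rfl
    rw [inf_eq_left.2 d.left_le, show (N : ℤ) - n₁ = -n₁ + N by ring] at h4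
    exact h4
  set V := (L ⊓ a (-k) 1) ⊔ wire a (j + 1) with hV
  have hVG : V ≤ a (-k) (j + 1) :=
    sup_le (inf_le_right.trans (d.sys.mono le_rfl (by omega)))
      (d.sys.wire_le_left (by omega) le_rfl)
  have hend : wire a (-n₁) ≤ commutant (a (-k) (j + 1)) := by
    rw [← d.wire_end]
    exact d.sys.wire_comm_interval (by omega) (by omega) (by omega) (by omega)
  have h5 : commutant (a 0 (j + 1) ⊓ R) ⊓ a (-k) (j + 1) ≤
      a (-k) (j + 1) ⊓ (V ⊔ wire a (-n₁)) := by
    refine le_inf inf_le_right ?_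
    refine (le_inf ((le_inf inf_le_left (inf_le_right.trans
      (d.sys.mono (by omega) le_rfl))).trans h1) (inf_le_right.trans
        (d.sys.mono le_rfl (by omega)))).trans (h2.trans ?_)
    exact sup_le (h3.trans (sup_le_sup le_sup_left le_rfl)) (le_sup_right.trans le_sup_left)
  refine h5.trans ((inf_sup_commutant_le d.sys.factor hVG hend).trans ?_)
  refine sup_le le_rfl ((d.sys.centre_le_wires (by omega) (by omega)).trans
    (sup_le ((le_inf (d.wire_le_left hk hkn) ?_).trans le_sup_left) le_sup_right))
  exact d.sys.wire_le_right le_rfl (by omega)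

/-- The bipartition of an interval ending with the left half of `0`. -/
theorem leftAlg_inf_le (d : SplitData N l n₁ n₂ a L R) {k k₂ : ℤ} (h0 : 0 ≤ k) (hk : k ≤ k₂)
    (hk₂ : k₂ ≤ N - 1) :
    leftAlg a L k₂ ⊓ a (-k) (N - k₂) ≤ leftAlg a L k ⊔ wire a (-k₂) := by
  have hs := d.size
  by_cases hkn₂ : k₂ ≤ n₁
  · rw [d.leftAlg_eq hkn₂, d.leftAlg_eq (hk.trans hkn₂), inf_comm (a (-k₂) 1), inf_comm (a (-k) 1)]
    exact d.left_inf_le h0 hk hkn₂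
  -- Beyond `p₋` a left interval is the commutant of a short right one, whose end `j + 1` is the cut
  -- `-k₂` of the cycle.
  obtain ⟨j, hj⟩ : ∃ j : ℤ, j = N - 1 - k₂ := ⟨_, rfl⟩
  have hR : leftAlg a L k₂ = commutant (a 0 (j + 1) ⊓ R) := by
    rw [← d.rightAlg_eq (by omega), d.commutant_rightAlg (by omega) (by omega), hj,
      sub_sub_cancel]
  have hper : wire a (-k₂) = wire a (j + 1) := by
    rw [← d.sys.wire_periodic (-k₂)]; congr 1; omega
  rw [hR, hper, show (N : ℤ) - k₂ = j + 1 by omega]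
  by_cases hkn : k ≤ n₁
  · rw [d.leftAlg_eq hkn, inf_comm (a (-k) 1)]
    exact d.commutant_right_inf_le_of_le (by omega) (by omega) h0 hkn
  · obtain ⟨j₁, hj₁⟩ : ∃ j₁ : ℤ, j₁ = N - 1 - k := ⟨_, rfl⟩
    have hR₁ : leftAlg a L k = commutant (a 0 (j₁ + 1) ⊓ R) := by
      rw [← d.rightAlg_eq (by omega), d.commutant_rightAlg (by omega) (by omega), hj₁,
        sub_sub_cancel]
    rw [hR₁]
    refine commutant_le_commutant d.sys.factor ?_
    rw [commutant_sup, commutant_commutant d.sys.factor,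
      commutant_inf d.sys.factor (commutant _) (a _ _), commutant_commutant d.sys.factor,
      d.sys.compl (by omega) (by omega), inf_comm (a 0 (j + 1)), inf_comm (a 0 (j₁ + 1))]
    refine (d.right_inf_commutant_wire_le (j := j) (j₁ := j₁) (by omega) (by omega)
      (by omega)).trans (sup_le_sup le_rfl (d.sys.mono le_rfl (by omega)))

theorem rightAlg_inf_le (d : SplitData N l n₁ n₂ a L R) {j j₂ : ℤ} (h0 : 0 ≤ j) (hj : j ≤ j₂)
    (hj₂ : j₂ ≤ N - 1) :
    rightAlg a R j₂ ⊓ a (j₂ + 1 - N) (j + 1) ≤ rightAlg a R j ⊔ wire a (j₂ + 1) := by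
  have h1 := d.mirror.leftAlg_inf_le h0 hj hj₂
  rw [wire_mirror, leftAlg_mirror, leftAlg_mirror, VertexSplitting.mirror,
    show (1 : ℤ) - (N - j₂) = j₂ + 1 - N by ring, show (1 : ℤ) - -j = j + 1 by ring,
    show (1 : ℤ) - -j₂ = j₂ + 1 by ring] at h1
  exact h1

/-- Removing an inner interval from an interval that starts with the right half of `0`. -/
theorem rightAlg_gap (d : SplitData N l n₁ n₂ a L R) {i j k : ℤ} (hj : 0 ≤ j) (hk : 0 ≤ k)
    (hji : j + 1 < i) (hik : i < N - k) :
    rightAlg a R (N - 1 - k) ⊓ a (i - N) (j + 1) ≤ rightAlg a R j ⊔ a i (N - k) := by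
  rw [← d.commutant_leftAlg hk (by omega)]
  have h1 : commutant (leftAlg a L k) ⊓ a (i - N) (j + 1) ≤
      (a (-k) (j + 1) ⊔ a (i - N) (-k)) ⊓ commutant (leftAlg a L k) := by
    refine le_inf ?_ inf_le_left
    rw [sup_comm]
    refine le_trans (le_inf inf_le_right (inf_le_left.trans
      (commutant_anti (d.wire_le_leftAlg hk))))
      (d.sys.inf_commutant_wire_le (by omega) (by omega) (by omega))
  refine h1.trans ((sup_inf_commutant_le d.sys.factor
    ((d.leftAlg_le k).trans (d.sys.mono le_rfl (by omega)))
    (le_commutant_comm.1 (d.sys.comm (by omega) le_rfl (by omega) (by omega)))).trans ?_)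
  have hG : a (i - N) (-k) = a i (N - k) := by
    rw [← d.sys.periodic]; congr 1 <;> ring
  have h2 := d.rightAlg_inf_le (j := j) (j₂ := N - 1 - k) hj (by omega) (by omega)
  rw [show (N : ℤ) - 1 - k + 1 - N = -k by ring, show (N : ℤ) - 1 - k + 1 = N - k by ring] at h2
  rw [d.commutant_leftAlg hk (by omega), inf_comm, hG]
  refine sup_le (h2.trans (sup_le_sup le_rfl ?_)) le_sup_right
  exact d.sys.wire_le_left (by omega) le_rfl

theorem leftAlg_gap (d : SplitData N l n₁ n₂ a L R) {i j k : ℤ} (hj : 0 ≤ j) (hk : 0 ≤ k)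
    (hji : j + 1 < i) (hik : i < N - k) :
    leftAlg a L (N - 1 - j) ⊓ a (-k) i ≤ leftAlg a L k ⊔ a (j + 1) i := by
  have h1 := d.mirror.rightAlg_gap (i := N + 1 - i) (j := k) (k := j) hk hj (by omega) (by omega)
  rw [rightAlg_mirror, rightAlg_mirror, VertexSplitting.mirror, VertexSplitting.mirror,
    show (1 : ℤ) - (k + 1) = -k by ring, show (1 : ℤ) - (N + 1 - i - N) = i by ring,
    show (1 : ℤ) - (N - j) = j + 1 - N by ring, show (1 : ℤ) - (N + 1 - i) = i - N by ring,
    ← d.sys.periodic (j + 1 - N), sub_add_cancel, sub_add_cancel] at h1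
  exact h1

/-- `L ∩ R` is the centre of `L`. It is localized at the vertex `0` up to the wire at the far end,
once within `L` and once within `R`; that wire is independent of `A_{0}`, so the two descriptions
can be intersected. -/
theorem centre_left_le (d : SplitData N l n₁ n₂ a L R) :
    L ⊓ R ≤ (L ⊓ R ⊓ a 0 1) ⊔ wire a (-n₁) := by
  have hs := d.size
  have hl₁ := d.large_left
  have hl₂ := d.large_right
  have h1 : L ⊓ R ≤ a 0 1 ⊔ wire a (-n₁) :=
    (inf_le_inf d.left_le (d.right_le.trans (d.sys.mono le_rfl (by omega)))).trans
      (d.sys.inf_le_sup_wire (i := -n₁) (j := 0) (k := 1) (by omega) (by omega) (by omega))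
  have h2 : L ⊓ R ≤ (L ⊓ a 0 1) ⊔ wire a (-n₁) := by
    have := d.left_inf_sup_wire_le (k := 0) (k₁ := n₁) le_rfl (by omega) le_rfl
    rw [neg_zero] at this
    exact (le_inf inf_le_left h1).trans this
  have h3 : L ⊓ R ≤ (R ⊓ a 0 1) ⊔ wire a (-n₁) := by
    have := d.right_inf_sup_wire_le (j := 0) (j₁ := n₂) le_rfl (by omega) le_rfl
    rw [zero_add, d.wire_end] at this
    exact (le_inf inf_le_right h1).trans this
  rcases Nat.eq_zero_or_pos l with hl | hl
  · rw [d.sys.wire_eq_bot hl, sup_bot_eq] at h2 ⊢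
    exact le_inf le_rfl (h2.trans inf_le_right)
  have hcomm : wire a (-n₁) ≤ commutant (a 0 1) := by
    rw [← d.wire_end]
    exact d.sys.wire_comm_interval (by omega) (by omega) (by omega) (by omega)
  have hu : Uncorrelated (wire a (-n₁)) (wire a 0 ⊔ wire a 1) :=
    d.sys.wire_uncorrelated_sup (by omega) (by omega) (by omega)
  have hc : wire a 0 ⊔ wire a 1 ≤ commutant (wire a (-n₁)) :=
    sup_le (d.sys.wire_comm (by omega) (by omega)) (d.sys.wire_comm (by omega) (by omega))
  refine (le_inf h2 h3).trans ((sup_inf_sup_le_of_uncorrelated (wire_comm_self _ _) hcomm le_rfl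
    inf_le_right inf_le_right ((hu.symm hc).mono
      (d.sys.centre_le_wires (by omega) (by omega)) le_rfl)).trans (sup_le_sup ?_ le_rfl))
  exact le_inf (le_inf (inf_le_left.trans inf_le_left) (inf_le_right.trans inf_le_left))
    (inf_le_left.trans inf_le_right)

/-- Duality gives the bound with an extra wire at `-n₁`. It cancels outright if `-k` is `l` away
from it, and otherwise conditionally on the wire at `-k`, which the bound contains anyway. -/
theorem centre_leftAlg_le_of_le (d : SplitData N l n₁ n₂ a L R) {k : ℤ} (h0 : 0 ≤ k)
    (hk : k ≤ n₁) : centre (leftAlg a L k) ≤ (L ⊓ R ⊓ a 0 1) ⊔ wire a (-k) := by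
  have hs := d.size
  have hl₁ := d.large_left
  have hl₂ := d.large_right
  have hwL := d.wire_le_left h0 hk
  have h1 : centre (leftAlg a L k) ≤ R ⊔ wire a (-k) := by
    have h2 := d.rightAlg_inf_le (j := 0) (j₂ := N - 1 - k) le_rfl (by omega) (by omega)
    rw [show (N : ℤ) - 1 - k + 1 - N = -k by ring, show (N : ℤ) - 1 - k + 1 = -k + N by ring,
      zero_add, d.sys.wire_periodic, d.rightAlg_eq (j := 0) (by omega)] at h2
    rw [centre, d.commutant_leftAlg h0 (by omega), inf_comm]
    exact (inf_le_inf le_rfl (d.leftAlg_le k)).trans (h2.trans (sup_le_sup inf_le_right le_rfl))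
  have h2 : centre (leftAlg a L k) ≤ L := by
    rw [d.leftAlg_eq hk]; exact (centre_le _).trans inf_le_right
  have h3 : centre (leftAlg a L k) ≤ ((L ⊓ R ⊓ a 0 1) ⊔ wire a (-k)) ⊔ wire a (-n₁) := by
    have h4 := sup_inf_commutant_le d.sys.factor (F := R) (F₁ := R) (G := wire a (-k)) le_rfl
      (by rw [d.commutant_right]; exact hwL)
    rw [d.commutant_right, inf_comm R L] at h4
    refine (le_inf h1 h2).trans (h4.trans (sup_le (d.centre_left_le.trans ?_) ?_))
    · exact sup_le_sup le_sup_left le_rfl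
    · exact le_sup_right.trans le_sup_left
  rcases Nat.eq_zero_or_pos l with hl | hl
  · simpa only [d.sys.wire_eq_bot hl, sup_bot_eq] using h3
  have hG : centre (leftAlg a L k) ≤ a (-k) 1 := (centre_le _).trans (d.leftAlg_le k)
  have hwV : wire a (-k) ≤ a (-k) 1 := d.sys.wire_le_right le_rfl (by omega)
  have hV : (L ⊓ R ⊓ a 0 1) ⊔ wire a (-k) ≤ a (-k) 1 :=
    sup_le (inf_le_right.trans (d.sys.mono (by omega) le_rfl)) hwV
  have hcomm : wire a (-n₁) ≤ commutant (a (-k) 1) := by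
    rw [← d.wire_end]
    exact d.sys.wire_comm_interval (by omega) (by omega) (by omega) (by omega)
  have hper' : wire a (N - k) = wire a (-k) := by
    rw [← d.sys.wire_periodic (-k)]; congr 1; ring
  by_cases hkl : k + l ≤ n₁
  · have hu : Uncorrelated (wire a (-n₁)) (wire a (-k) ⊔ wire a 1) :=
      d.sys.wire_uncorrelated_sup (by omega) (by omega) (by omega)
    have hc : wire a (-k) ⊔ wire a 1 ≤ commutant (wire a (-n₁)) :=
      sup_le (d.sys.wire_comm (by omega) (by omega)) (d.sys.wire_comm (by omega) (by omega))
    exact (le_inf hG h3).trans (inf_sup_le_of_uncorrelated (wire_comm_self _ _) hcomm hV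
      ((hu.symm hc).mono (d.sys.centre_le_wires (by omega) (by omega)) le_rfl))
  · have hwG : wire a (-k) ≤ centre (a (-k) 1) := by
      refine le_inf hwV ?_
      rw [← hper']
      exact d.sys.wire_comm_interval (by omega) (by omega) (by omega) (by omega)
    have hind : CondIndep (a (-k) 1) (wire a (-n₁)) (wire a (-k)) := by
      refine condIndep_of_uncorrelated (Z₁ := wire a 1) hcomm hwG
        (d.sys.wire_comm (by omega) (by omega)) (d.sys.centre_le_wires (by omega) (by omega)) ?_
      rw [← d.wire_end, ← hper', sup_comm]
      exact d.sys.wire_uncorrelated_sup (by omega) (by omega) (by omega)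
    have h5 := sup_inf_sup_le_of_condIndep (D₁ := ⊥) (V₁ := a (-k) 1) (wire_comm_self _ _) hcomm
      hwG bot_le le_rfl hV hwV le_sup_right hind
    rw [sup_bot_eq, sup_bot_eq] at h5
    exact (le_inf hG h3).trans (h5.trans inf_le_right)

theorem centre_leftAlg_le (d : SplitData N l n₁ n₂ a L R) {k : ℤ} (h0 : 0 ≤ k)
    (hk : k ≤ N - 1) : centre (leftAlg a L k) ≤ (L ⊓ R ⊓ a 0 1) ⊔ wire a (-k) := by
  have hs := d.size
  by_cases hkn : k ≤ n₁
  · exact d.centre_leftAlg_le_of_le h0 hkn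
  have h1 := d.mirror.centre_leftAlg_le_of_le (k := N - 1 - k) (by omega) (by omega)
  rw [leftAlg_mirror, ← d.commutant_leftAlg h0 hk, centre_commutant d.sys.factor, wire_mirror,
    show (1 : ℤ) - -(N - 1 - k) = -k + N by ring, d.sys.wire_periodic, inf_comm R L] at h1
  exact h1

theorem centre_rightAlg_le (d : SplitData N l n₁ n₂ a L R) {j : ℤ} (h0 : 0 ≤ j)
    (hj : j ≤ N - 1) : centre (rightAlg a R j) ≤ (L ⊓ R ⊓ a 0 1) ⊔ wire a (j + 1) := by
  have h1 := d.mirror.centre_leftAlg_le h0 hj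
  rw [leftAlg_mirror, wire_mirror, show (1 : ℤ) - -j = j + 1 by ring, inf_comm R L] at h1
  exact h1

end SplitData

/-! ### Intervals and connected components of a cycle. -/

section Interval

/-- The image in the cycle `ZMod M` of the integers of `[i, j)`. -/
def interval (M : ℕ) (i j : ℤ) : Set (ZMod M) :=
  (fun t : ℤ => (t : ZMod M)) '' Set.Ico i j

variable {M : ℕ}

theorem intCast_mem_interval {i j t : ℤ} (hi : i ≤ t) (hj : t < j) :
    (t : ZMod M) ∈ interval M i j :=
  ⟨t, ⟨hi, hj⟩, rfl⟩

theorem eq_of_intCast_eq {c s t : ℤ} (hs : c ≤ s) (hs' : s < c + M) (ht : c ≤ t)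
    (ht' : t < c + M) (h : (s : ZMod M) = t) : s = t := by
  rw [ZMod.intCast_eq_intCast_iff_dvd_sub] at h
  have h1 := Int.eq_zero_of_abs_lt_dvd h (by rw [abs_lt]; omega)
  omega

theorem intCast_mem_interval_iff {c i j t : ℤ} (hi : c ≤ i) (hj : j ≤ c + M) (ht : c ≤ t)
    (ht' : t < c + M) : (t : ZMod M) ∈ interval M i j ↔ i ≤ t ∧ t < j := by
  refine ⟨?_, fun h => intCast_mem_interval h.1 h.2⟩
  rintro ⟨s, ⟨h1, h2⟩, h⟩
  obtain rfl := eq_of_intCast_eq (by omega) (by omega) ht ht' h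
  exact ⟨h1, h2⟩

theorem notMem_interval {i j : ℤ} (hji : j < i + M) (hij : i < j) :
    ((i - 1 : ℤ) : ZMod M) ∉ interval M i j ∧ (j : ZMod M) ∉ interval M i j := by
  constructor
  · intro h
    have h' : (((i - 1 + M : ℤ)) : ZMod M) ∈ interval M i j := by simpa using h
    rw [intCast_mem_interval_iff le_rfl hji.le (by omega) (by omega)] at h'
    omega
  · intro h
    rw [intCast_mem_interval_iff le_rfl hji.le (by omega) (by omega)] at h
    omega

theorem exists_intCast_eq [NeZero M] (c : ℤ) (x : ZMod M) :
    ∃ t : ℤ, c ≤ t ∧ t < c + M ∧ (t : ZMod M) = x := by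
  have hM : 0 < (M : ℤ) := by exact_mod_cast Nat.pos_of_ne_zero (NeZero.ne M)
  refine ⟨c + ((x.cast : ℤ) - c) % M, ?_, ?_, ?_⟩
  · have := Int.emod_nonneg ((x.cast : ℤ) - c) hM.ne'; omega
  · have := Int.emod_lt_of_pos ((x.cast : ℤ) - c) hM; omega
  · rw [Int.cast_add, ZMod.intCast_mod, Int.cast_sub, ZMod.intCast_zmod_cast]; ring

theorem interval_add_mul_period (s i j : ℤ) :
    interval M (i + s * M) (j + s * M) = interval M i j := by
  ext x
  constructor
  · rintro ⟨t, ⟨h1, h2⟩, rfl⟩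
    exact ⟨t - s * M, ⟨by omega, by omega⟩, by simp⟩
  · rintro ⟨t, ⟨h1, h2⟩, rfl⟩
    exact ⟨t + s * M, ⟨by omega, by omega⟩, by simp⟩

theorem interval_add_period (i j : ℤ) : interval M (i + M) (j + M) = interval M i j := by
  simpa using interval_add_mul_period (M := M) 1 i j

/-- Walking along the interval, no single step leads from `S` to `T`. -/
theorem interval_subset_of_nonAdjacent {S T : Set (ZMod M)} (h : NonAdjacent S T) {i j : ℤ}
    (hi : (i : ZMod M) ∈ S) (hsub : interval M i j ⊆ S ∪ T) : interval M i j ⊆ S := by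
  rintro _ ⟨t, ⟨h1, h2⟩, rfl⟩
  induction t, h1 using Int.leInduction with
  | base => exact hi
  | succ t h1 ih =>
    refine (hsub (intCast_mem_interval (by omega) h2)).resolve_right fun ht => ?_
    exact (h _ (ih (by omega)) _ ht).1 (by push_cast; rfl)

theorem ncard_interval {i j : ℤ} (hj : j ≤ i + M) : (interval M i j).ncard = (j - i).toNat := by
  rw [interval, Set.InjOn.ncard_image, Set.ncard_eq_toFinset_card']
  · simp
  · rintro s ⟨h1, h2⟩ t ⟨h3, h4⟩ h
    exact eq_of_intCast_eq h1 (by omega) h3 (by omega) h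

theorem interval_mono {i i' j' j : ℤ} (hi : i ≤ i') (hj : j' ≤ j) :
    interval M i' j' ⊆ interval M i j :=
  Set.image_mono (Set.Ico_subset_Ico hi hj)

theorem interval_eq_empty {i j : ℤ} (h : j ≤ i) : interval M i j = ∅ := by
  rw [interval, Set.Ico_eq_empty (by omega), Set.image_empty]

theorem interval_succ (i : ℤ) : interval M i (i + 1) = {(i : ZMod M)} := by
  ext x
  constructor
  · rintro ⟨t, ⟨h1, h2⟩, rfl⟩
    obtain rfl : t = i := by omega
    rfl
  · rintro rfl
    exact intCast_mem_interval le_rfl (by omega)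

theorem interval_union {i j k : ℤ} (hij : i ≤ j) (hjk : j ≤ k) :
    interval M i j ∪ interval M j k = interval M i k := by
  rw [interval, interval, interval, ← Set.image_union, Set.Ico_union_Ico_eq_Ico hij hjk]

theorem interval_full [NeZero M] (i : ℤ) : interval M i (i + M) = Set.univ := by
  refine Set.eq_univ_of_forall fun x => ?_
  obtain ⟨t, h1, h2, rfl⟩ := exists_intCast_eq i x
  exact intCast_mem_interval h1 h2

theorem compl_interval [NeZero M] {i j : ℤ} (hij : i ≤ j) (hj : j ≤ i + M) :
    (interval M i j)ᶜ = interval M j (i + M) := by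
  ext x
  obtain ⟨t, h1, h2, rfl⟩ := exists_intCast_eq i x
  rw [Set.mem_compl_iff, intCast_mem_interval_iff le_rfl hj h1 h2,
    intCast_mem_interval_iff hij le_rfl h1 h2]
  omega

/-- The connected component of an integer in the preimage of a proper subset of the cycle. -/
theorem exists_component [NeZero M] {S : Set (ZMod M)} (hS : S ≠ Set.univ) {u : ℤ}
    (hu : (u : ZMod M) ∈ S) : ∃ i j : ℤ, i ≤ u ∧ u < j ∧ j < i + M ∧ interval M i j ⊆ S ∧
      ((i - 1 : ℤ) : ZMod M) ∉ S ∧ (j : ZMod M) ∉ S := by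
  classical
  obtain ⟨v, hv⟩ := (Set.ne_univ_iff_exists_notMem S).1 hS
  have hr : ∃ n : ℕ, ((u + 1 + n : ℤ) : ZMod M) ∉ S := by
    obtain ⟨t, h1, h2, rfl⟩ := exists_intCast_eq (u + 1) v
    exact ⟨(t - (u + 1)).toNat, by rwa [show u + 1 + ((t - (u + 1)).toNat : ℤ) = t by omega]⟩
  have hl : ∃ n : ℕ, ((u - 1 - n : ℤ) : ZMod M) ∉ S := by
    obtain ⟨t, h1, h2, rfl⟩ := exists_intCast_eq (u - M) v
    exact ⟨(u - 1 - t).toNat, by rwa [show u - 1 - ((u - 1 - t).toNat : ℤ) = t by omega]⟩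
  have hr1 := Nat.find_spec hr
  have hl1 := Nat.find_spec hl
  have hr2 : ∀ n < Nat.find hr, ((u + 1 + n : ℤ) : ZMod M) ∈ S := fun n hn =>
    not_not.1 (Nat.find_min hr hn)
  have hl2 : ∀ n < Nat.find hl, ((u - 1 - n : ℤ) : ZMod M) ∈ S := fun n hn =>
    not_not.1 (Nat.find_min hl hn)
  generalize Nat.find hr = p at *
  generalize Nat.find hl = q at *
  have hsub : ∀ t : ℤ, u - q ≤ t → t < u + 1 + p → (t : ZMod M) ∈ S := by
    intro t h1 h2
    rcases lt_trichotomy t u with h | rfl | h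
    · have := hl2 (u - 1 - t).toNat (by omega)
      rwa [show u - 1 - ((u - 1 - t).toNat : ℤ) = t by omega] at this
    · exact hu
    · have := hr2 (t - (u + 1)).toNat (by omega)
      rwa [show u + 1 + ((t - (u + 1)).toNat : ℤ) = t by omega] at this
  refine ⟨u - q, u + 1 + p, by omega, by omega, ?_, ?_, ?_, hr1⟩
  -- Otherwise the missing vertex on the left would reappear `M` steps later inside the interval.
  · by_contra hlt
    have hM : 0 < (M : ℤ) := by exact_mod_cast Nat.pos_of_ne_zero (NeZero.ne M)
    refine hl1 ?_
    have := hsub (u - 1 - q + M) (by omega) (by omega)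
    simpa using this
  · rintro x ⟨t, ⟨h1, h2⟩, rfl⟩
    exact hsub t h1 h2
  · rwa [show u - (q : ℤ) - 1 = u - 1 - q by ring]

theorem nonAdjacent_diff_interval {S : Set (ZMod M)} {i j : ℤ}
    (hi : ((i - 1 : ℤ) : ZMod M) ∉ S) (hj : (j : ZMod M) ∉ S) :
    NonAdjacent (interval M i j) (S \ interval M i j) := by
  rintro _ ⟨s, ⟨h1, h2⟩, rfl⟩ t ⟨htS, htC⟩
  constructor
  · rintro rfl
    rw [show ((s : ZMod M) + 1) = ((s + 1 : ℤ) : ZMod M) by push_cast; ring] at htS htC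
    rcases eq_or_ne (s + 1) j with h | h
    · exact hj (h ▸ htS)
    · exact htC (intCast_mem_interval (by omega) (by omega))
  · intro h
    have ht : t = ((s - 1 : ℤ) : ZMod M) := by
      push_cast; exact eq_sub_of_add_eq h.symm
    subst ht
    rcases eq_or_ne s i with h | h
    · exact hi (h ▸ htS)
    · exact htC (intCast_mem_interval (by omega) (by omega))

/-- Proper subsets of the cycle are obtained from the empty set by adding components. -/
theorem component_induction [NeZero M] {P : Set (ZMod M) → Prop} (empty : P ∅)
    (step : ∀ (i j : ℤ) (S : Set (ZMod M)), i < j → j < i + M → Disjoint (interval M i j) S →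
      NonAdjacent (interval M i j) S → interval M i j ∪ S ≠ Set.univ → P S →
      P (interval M i j ∪ S))
    {S : Set (ZMod M)} (hS : S ≠ Set.univ) : P S := by
  induction h : S.ncard using Nat.strong_induction_on generalizing S with
  | _ n ih =>
    rcases S.eq_empty_or_nonempty with rfl | ⟨x, hx⟩
    · exact empty
    obtain ⟨u, -, -, rfl⟩ := exists_intCast_eq 0 x
    obtain ⟨i, j, hiu, huj, hji, hsub, hi, hj⟩ := exists_component hS hx
    have hunion : interval M i j ∪ S \ interval M i j = S := Set.union_sdiff_cancel hsub
    have hlt : (S \ interval M i j).ncard < S.ncard :=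
      Set.ncard_lt_ncard ⟨Set.sdiff_subset, fun hle =>
        (hle hx).2 (intCast_mem_interval hiu huj)⟩ (Set.toFinite S)
    have hne : S \ interval M i j ≠ Set.univ := fun h =>
      hj ((Set.eq_univ_iff_forall.1 h _).1)
    have := step i j (S \ interval M i j) (by omega) hji Set.disjoint_sdiff_right
      (nonAdjacent_diff_interval hi hj) (by rwa [hunion]) (ih _ (h ▸ hlt) hne rfl)
    rwa [hunion] at this

theorem val_intCast_sub {s t : ℤ} (hst : s ≤ t) (ht : t < s + M) :
    ((t : ZMod M) - s).val = (t - s).toNat := by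
  rw [show ((t : ZMod M) - s) = (((t - s).toNat : ℕ) : ZMod M) by
    rw [← Int.cast_natCast, Int.toNat_of_nonneg (by omega)]; simp,
    ZMod.val_cast_of_lt (by omega)]

theorem arc_eq_interval [NeZero M] {i j : ℤ} (hij : i ≤ j) (hj : j < i + M) :
    arc (i : ZMod M) (j : ZMod M) = interval M i (j + 1) := by
  ext x
  obtain ⟨t, h1, h2, rfl⟩ := exists_intCast_eq i x
  rw [intCast_mem_interval_iff le_rfl (by omega) h1 h2]
  change ((t : ZMod M) - i).val ≤ _ ↔ _
  rw [val_intCast_sub hij hj, val_intCast_sub h1 h2]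
  omega

theorem exists_interval_eq_arc [NeZero M] (m n : ZMod M) :
    ∃ i j : ℤ, i < j ∧ j ≤ i + M ∧ (i : ZMod M) = m ∧ (j : ZMod M) = n + 1 ∧
      arc m n = interval M i j := by
  obtain ⟨i, -, -, rfl⟩ := exists_intCast_eq 0 m
  obtain ⟨j, h1, h2, rfl⟩ := exists_intCast_eq i n
  exact ⟨i, j + 1, by omega, by omega, rfl, by simp, arc_eq_interval h1 h2⟩

end Interval

/-- In a connected family, the algebra of a proper subset of the cycle is generated by those of
its components. -/
theorem eq_iSup_component {M : ℕ} [NeZero M] {B : Set (ZMod M) → StarSubalgebra ℂ Ω}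
    (hB : VertexSplitting.IsConnected B) (mono : ∀ {S T : Set (ZMod M)}, S ⊆ T → B S ≤ B T)
    (empty : B ∅ = ⊥) {S : Set (ZMod M)} (hS : S ≠ Set.univ) :
    B S = ⨆ C ∈ {C : Set (ZMod M) | IsComponent S C}, B C := by
  refine le_antisymm ?_ (iSup₂_le fun C ⟨_, _, _, h, _⟩ => mono h)
  refine component_induction (P := fun S => B S ≤ ⨆ C ∈ {C | IsComponent S C}, B C)
    (by rw [empty]; exact bot_le) ?_ hS
  intro i j S hij hji hdisj hadj hne ih
  rw [hB _ _ hdisj hadj]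
  have hi : ((i : ℤ) : ZMod M) ∈ interval M i j := intCast_mem_interval le_rfl hij
  have hj : ((j - 1 : ℤ) : ZMod M) ∈ interval M i j := intCast_mem_interval (by omega) (by omega)
  have hlast : ((j : ℤ) : ZMod M) = ((j - 1 : ℤ) : ZMod M) + 1 := by push_cast; ring
  refine sup_le (le_iSup₂_of_le (interval M i j)
    ⟨i, ((j - 1 : ℤ) : ZMod M), ?_, Set.subset_union_left, ?_, ?_⟩ le_rfl)
    (ih.trans (iSup₂_le fun C ⟨m, n, hC, hCS, hm, hn⟩ => le_iSup₂_of_le C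
      ⟨m, n, hC, hCS.trans Set.subset_union_right, ?_, ?_⟩ le_rfl))
  · rw [arc_eq_interval (by omega) (by omega), sub_add_cancel]
  · rintro (h | h)
    · exact (notMem_interval hji hij).1 (by push_cast; exact h)
    · exact (hadj _ hi _ h).2 (by ring)
  · rw [← hlast]
    rintro (h | h)
    · exact (notMem_interval hji hij).2 h
    · exact (hadj _ hj _ h).1 hlast
  · rintro (h | h)
    · have hmS : m ∈ S := hCS (by rw [hC]; simp [arc])
      exact (hadj _ h _ hmS).1 (by ring)
    · exact hm h
  · rintro (h | h)
    · have hnS : n ∈ S := hCS (by rw [hC]; simp [arc])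
      exact (hadj _ h _ hnS).2 rfl
    · exact hn h

/-! ### From intervals to arbitrary sets of vertices. -/

/-- A connected family over the cycle `ZMod M` that satisfies the partition rules and strong
connectedness on intervals. -/
structure CycleFamily (M : ℕ) (B : Set (ZMod M) → StarSubalgebra ℂ Ω) : Prop where
  factor : IsFactor Ω
  nontrivial : 2 ≤ M
  mono : ∀ {S T : Set (ZMod M)}, S ⊆ T → B S ≤ B T
  connected : VertexSplitting.IsConnected B
  empty : B ∅ = ⊥
  full : B Set.univ = ⊤
  compl : ∀ {i j : ℤ}, i < j → j < i + M →
    commutant (B (interval M i j)) = B (interval M j (i + M))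
  gap : ∀ {i j k m : ℤ}, i < j → j < k → k < m → m < i + M →
    B (interval M i m) ⊓ commutant (B (interval M j k)) ≤
      B (interval M i j) ⊔ B (interval M k m)
  bipartition : ∀ {i j k : ℤ}, i < j → j < k → k < i + M →
    B (interval M i k) ⊓ commutant (B (interval M i j)) ≤
      B (interval M j k) ⊔ centre (B (interval M i k))
  centre_le : ∀ {i j : ℤ}, i < j → j < i + M → centre (B (interval M i j)) ≤
    (B (interval M (i - 1) i) ⊓ B (interval M i (i + 1))) ⊔
      (B (interval M (j - 1) j) ⊓ B (interval M j (j + 1)))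

namespace CycleFamily

variable {M : ℕ} {B : Set (ZMod M) → StarSubalgebra ℂ Ω}

theorem neZero (h : CycleFamily M B) : NeZero M := ⟨by have := h.nontrivial; omega⟩

theorem le_commutant (h : CycleFamily M B) {i j : ℤ} (hij : i < j) (hji : j < i + M)
    {T : Set (ZMod M)} (hT : Disjoint (interval M i j) T) :
    B T ≤ commutant (B (interval M i j)) := by
  have := h.neZero
  rw [h.compl hij hji, ← compl_interval hij.le hji.le]
  exact h.mono (Set.subset_compl_iff_disjoint_left.2 hT)

variable [FiniteDimensional ℂ Ω]

/-- Add an interval `C` to `S`. If `S` is non-empty, non-adjacency makes the component of `Sᶜ`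
around `C` exceed `C` on both sides, so `gap` computes the commutant of `C` there; the other
components commute with it. -/
theorem commutant_eq_of_ne_univ (h : CycleFamily M B) {S : Set (ZMod M)} (hS : S ≠ Set.univ) :
    commutant (B S) = B Sᶜ := by
  have := h.neZero
  refine component_induction (P := fun S => commutant (B S) = B Sᶜ) ?_ ?_ hS
  · rw [h.empty, Set.compl_empty, h.full, commutant_bot]
  intro i j S hij hji hdisj hadj hne ih
  rw [h.connected _ _ hdisj hadj, commutant_sup, ih]
  refine le_antisymm ?_ (le_inf ?_ (h.mono (Set.compl_subset_compl.2 Set.subset_union_right)))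
  · rcases S.eq_empty_or_nonempty with rfl | ⟨x, hx⟩
    · rw [Set.union_empty, compl_interval hij.le hji.le, h.compl hij hji]
      exact inf_le_left
    have hSc : Sᶜ ≠ Set.univ := fun h => Set.eq_univ_iff_forall.1 h x hx
    have hmem : ∀ t : ℤ, i ≤ t → t < j → ((t : ℤ) : ZMod M) ∈ interval M i j := fun t h1 h2 =>
      intCast_mem_interval h1 h2
    have hsub : ∀ t : ℤ, i - 1 ≤ t → t ≤ j → (t : ZMod M) ∈ Sᶜ := by
      intro t h1 h2 ht
      rcases lt_or_ge t i with h3 | h3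
      · exact (hadj _ (hmem i le_rfl hij) _ ht).2 (by
          rw [show t = i - 1 by omega]; push_cast; ring)
      rcases lt_or_ge t j with h4 | h4
      · exact Set.disjoint_left.1 hdisj (hmem t h3 h4) ht
      · exact (hadj _ (hmem (j - 1) (by omega) (by omega)) _ ht).1 (by
          rw [show t = j by omega]; push_cast; ring)
    obtain ⟨i', m, h1, h2, h3, hK, hi', hm⟩ := exists_component hSc (hsub i (by omega) hij.le)
    have hi'i : i' < i := by
      by_contra hlt
      exact hi' (hsub _ (by omega) (by omega))
    have hjm : j < m := by
      by_contra hlt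
      exact hm (hsub _ (by omega) (by omega))
    have hunion : Sᶜ = interval M i' m ∪ Sᶜ \ interval M i' m :=
      (Set.union_sdiff_cancel hK).symm
    rw [hunion, h.connected _ _ Set.disjoint_sdiff_right (nonAdjacent_diff_interval hi' hm),
      inf_comm]
    have hmid : Disjoint (interval M i j) (interval M i' i ∪ interval M j m) := by
      rw [Set.disjoint_right]
      rintro _ (⟨t, ⟨ht1, ht2⟩, rfl⟩ | ⟨t, ⟨ht1, ht2⟩, rfl⟩) ht <;>
      · rw [intCast_mem_interval_iff (c := i') (by omega) (by omega) (by omega) (by omega)] at ht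
        omega
    have hout : interval M i' i ∪ interval M j m ⊆ interval M i' m :=
      Set.union_subset (interval_mono le_rfl (by omega)) (interval_mono (by omega) le_rfl)
    refine (sup_inf_commutant_le h.factor (h.mono (interval_mono hi'i.le hjm.le))
      (h.le_commutant (by omega) h3 Set.disjoint_sdiff_right)).trans
        (sup_le ((h.gap hi'i hij hjm h3).trans (sup_le ?_ ?_)) ?_)
    · refine h.mono fun x hx => ?_
      rintro (hx' | hx')
      · exact Set.disjoint_left.1 hmid hx' (Or.inl hx)
      · exact hK (hout (Or.inl hx)) hx'
    · refine h.mono fun x hx => ?_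
      rintro (hx' | hx')
      · exact Set.disjoint_left.1 hmid hx' (Or.inr hx)
      · exact hK (hout (Or.inr hx)) hx'
    · refine h.mono fun x hx => ?_
      rintro (hx' | hx')
      · exact hx.2 (interval_mono hi'i.le hjm.le hx')
      · exact hx.1 hx'
  · exact h.le_commutant hij hji
      (Set.disjoint_left.2 fun x hx hx' => hx' (Or.inl hx))

theorem commutant_eq (h : CycleFamily M B) (S : Set (ZMod M)) : commutant (B S) = B Sᶜ := by
  rcases eq_or_ne S Set.univ with rfl | hS
  · rw [h.full, Set.compl_univ, h.empty, commutant_top h.factor]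
  · exact h.commutant_eq_of_ne_univ hS

/-- By duality the centre of `B Y` is `B Y ∩ B Yᶜ`, and the two vertices at the cut lie one in each.
-/
theorem wire_le_centre_left (h : CycleFamily M B) {Y : Set (ZMod M)} {i : ℤ}
    (hi : (i : ZMod M) ∈ Y) (hi' : ((i - 1 : ℤ) : ZMod M) ∉ Y) :
    B (interval M (i - 1) i) ⊓ B (interval M i (i + 1)) ≤ centre (B Y) := by
  have h1 := interval_succ (M := M) (i - 1)
  rw [sub_add_cancel] at h1
  rw [centre, h.commutant_eq, interval_succ, h1, inf_comm]
  exact inf_le_inf (h.mono (Set.singleton_subset_iff.2 hi))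
    (h.mono (Set.singleton_subset_iff.2 hi'))

theorem wire_le_centre_right (h : CycleFamily M B) {Y : Set (ZMod M)} {j : ℤ}
    (hj : ((j - 1 : ℤ) : ZMod M) ∈ Y) (hj' : (j : ZMod M) ∉ Y) :
    B (interval M (j - 1) j) ⊓ B (interval M j (j + 1)) ≤ centre (B Y) := by
  have h1 := interval_succ (M := M) (j - 1)
  rw [sub_add_cancel] at h1
  rw [centre, h.commutant_eq, interval_succ, h1]
  exact inf_le_inf (h.mono (Set.singleton_subset_iff.2 hj))
    (h.mono (Set.singleton_subset_iff.2 hj'))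

theorem stronglyConnected (h : CycleFamily M B) : IsStronglyConnected B := by
  have := h.neZero
  have hM := h.nontrivial
  intro m n hmn
  obtain ⟨i, j, hij, hji, rfl, hj, harc⟩ := exists_interval_eq_arc m n
  obtain rfl : n = ((j - 1 : ℤ) : ZMod M) := by push_cast; exact eq_sub_of_add_eq hj.symm
  have hji' : j < i + M := by
    refine lt_of_le_of_ne hji fun h => hmn ?_
    rw [← hj, h]; simp
  -- By duality, what two adjacent vertices share is automatically central in both.
  have hcut : ∀ c : ℤ, centre (B {((c - 1 : ℤ) : ZMod M)}) ⊓ centre (B {(c : ZMod M)}) =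
      B (interval M (c - 1) c) ⊓ B (interval M c (c + 1)) := by
    intro c
    have h1 := interval_succ (M := M) (c - 1)
    rw [sub_add_cancel] at h1
    have hn := notMem_interval (M := M) (i := c) (j := c + 1) (by omega) (by omega)
    have hn' := notMem_interval (M := M) (i := c - 1) (j := c) (by omega) (by omega)
    rw [← h1, ← interval_succ c]
    refine le_antisymm (inf_le_inf (VertexSplitting.centre_le _) (VertexSplitting.centre_le _))
      (le_inf (h.wire_le_centre_right ?_ hn'.2) (h.wire_le_centre_left ?_ hn.1))
    · exact intCast_mem_interval le_rfl (by omega)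
    · exact intCast_mem_interval le_rfl (by omega)
  have hn := notMem_interval hji' hij
  have e1 : (i : ZMod M) - 1 = ((i - 1 : ℤ) : ZMod M) := by push_cast; rfl
  rw [harc, ← hj, e1, hcut, hcut]
  exact le_antisymm (h.centre_le hij hji') (sup_le
    (h.wire_le_centre_left (intCast_mem_interval le_rfl hij) hn.1)
    (h.wire_le_centre_right (intCast_mem_interval (by omega) (by omega)) hn.2))

/-- The relative commutant of a subinterval in an interval. -/
theorem inf_commutant_le (h : CycleFamily M B) {i' i j m : ℤ} (h1 : i' ≤ i) (h2 : i < j)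
    (h3 : j ≤ m) (h4 : m < i' + M) :
    B (interval M i' m) ⊓ commutant (B (interval M i j)) ≤
      (B (interval M i' i) ⊔ B (interval M j m)) ⊔ centre (B (interval M i' m)) := by
  rcases h1.eq_or_lt with rfl | h1
  · rcases h3.eq_or_lt with rfl | h3
    · exact le_sup_right
    · exact (h.bipartition h2 h3 h4).trans (sup_le_sup le_sup_right le_rfl)
  · rcases h3.eq_or_lt with rfl | h3
    · exact (bipartition_symm h.factor (h.mono (interval_mono le_rfl h2.le))
        (h.bipartition h1 h2 h4)).trans (sup_le_sup le_sup_left le_rfl)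
    · exact (h.gap h1 h2 h3 h4).trans le_sup_left

/-- Work in the component of the interval in its union with `T`. The wire at an end of that
component lies in `T`, unless the component ends where the interval does; then the cut is also an
end in `Y` and the wire is central in `B Y`. -/
theorem inf_commutant_interval_le (h : CycleFamily M B) {i j : ℤ} (hij : i < j)
    {T Y : Set (ZMod M)} (hT : Disjoint (interval M i j) T)
    (hY : Y ≠ Set.univ) (hsub : interval M i j ∪ T ⊆ Y)
    (hadj : NonAdjacent (interval M i j) (Y \ (interval M i j ∪ T))) :
    B (interval M i j ∪ T) ⊓ commutant (B (interval M i j)) ≤ B T ⊔ centre (B Y) := by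
  have := h.neZero
  have hX : interval M i j ∪ T ≠ Set.univ := fun h => hY (Set.univ_subset_iff.1 (h ▸ hsub))
  have hmem : ∀ t : ℤ, i ≤ t → t < j → ((t : ℤ) : ZMod M) ∈ interval M i j := fun t h1 h2 =>
    intCast_mem_interval h1 h2
  obtain ⟨i', m, h1, h2, h3, hK, hi', hm⟩ := exists_component hX (Or.inl (hmem i le_rfl hij))
  have hjm : j ≤ m := by
    by_contra hlt
    exact hm (Or.inl (hmem m (by omega) (by omega)))
  have hpart : ∀ t : ℤ, i' ≤ t → t < m → (t < i ∨ j ≤ t) → (t : ZMod M) ∈ T := by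
    intro t ht1 ht2 ht
    refine (hK (intCast_mem_interval ht1 ht2)).resolve_left fun hc => ?_
    rw [intCast_mem_interval_iff (c := i') (by omega) (by omega) (by omega) (by omega)] at hc
    omega
  have hl : interval M i' i ⊆ T := by
    rintro _ ⟨t, ⟨ht1, ht2⟩, rfl⟩
    exact hpart t ht1 (by omega) (Or.inl ht2)
  have hr : interval M j m ⊆ T := by
    rintro _ ⟨t, ⟨ht1, ht2⟩, rfl⟩
    exact hpart t (by omega) ht2 (Or.inr ht1)
  have hunion := (Set.union_sdiff_cancel hK).symm
  rw [hunion, h.connected _ _ Set.disjoint_sdiff_right (nonAdjacent_diff_interval hi' hm)]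
  refine (sup_inf_commutant_le h.factor (h.mono (interval_mono h1 hjm))
    (h.le_commutant (by omega) h3 Set.disjoint_sdiff_right)).trans (sup_le
      ((h.inf_commutant_le h1 hij hjm h3).trans (sup_le
        ((sup_le (h.mono hl) (h.mono hr)).trans le_sup_left)
        ((h.centre_le (by omega) h3).trans (sup_le ?_ ?_)))) ?_)
  · rcases h1.eq_or_lt with rfl | h1
    · refine le_trans (h.wire_le_centre_left (hsub (Or.inl (hmem _ le_rfl hij))) ?_) le_sup_right
      intro hc
      exact (hadj _ (hmem _ le_rfl hij) _ ⟨hc, hi'⟩).2 (by push_cast; ring)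
    · exact inf_le_right.trans
        ((h.mono ((interval_mono le_rfl (by omega)).trans hl)).trans le_sup_left)
  · rcases hjm.eq_or_lt with rfl | hjm
    · refine le_trans (h.wire_le_centre_right
        (hsub (Or.inl (hmem _ (by omega) (by omega)))) ?_) le_sup_right
      intro hc
      exact (hadj _ (hmem (j - 1) (by omega) (by omega)) _ ⟨hc, hm⟩).1 (by push_cast; ring)
    · exact inf_le_left.trans
        ((h.mono ((interval_mono (by omega) le_rfl).trans hr)).trans le_sup_left)
  · refine (h.mono fun x hx => ?_).trans le_sup_left
    exact hx.1.resolve_left fun hc => hx.2 (interval_mono h1 hjm hc)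

/-- Components of `S` are stripped one at a time, the total set, and so the centre allowed in the
bound, staying fixed. -/
theorem inf_commutant_le_of_ne_univ (h : CycleFamily M B) {S : Set (ZMod M)}
    (hS : S ≠ Set.univ) : ∀ T : Set (ZMod M), Disjoint S T → S ∪ T ≠ Set.univ →
      commutant (B S) ⊓ B (S ∪ T) ≤ B T ⊔ centre (B (S ∪ T)) := by
  have := h.neZero
  refine component_induction (P := fun S => ∀ T : Set (ZMod M), Disjoint S T →
    S ∪ T ≠ Set.univ → commutant (B S) ⊓ B (S ∪ T) ≤ B T ⊔ centre (B (S ∪ T))) ?_ ?_ hS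
  · intro T _ _
    rw [Set.empty_union]
    exact inf_le_right.trans le_sup_left
  intro i j S hij hji hdisj hadj hne ih T hT hY
  have hCT : Disjoint (interval M i j) T := hT.mono_left Set.subset_union_left
  have hST : Disjoint S T := hT.mono_left Set.subset_union_right
  have hassoc : interval M i j ∪ S ∪ T = S ∪ (interval M i j ∪ T) := by
    rw [Set.union_comm (interval M i j) S, Set.union_assoc]
  rw [h.connected _ _ hdisj hadj, commutant_sup]
  rw [hassoc] at hY ⊢
  have h1 := ih (interval M i j ∪ T) (Set.disjoint_union_right.2 ⟨hdisj.symm, hST⟩) hY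
  rw [inf_assoc]
  refine (inf_le_inf le_rfl h1).trans ?_
  rw [inf_comm]
  refine (sup_inf_commutant_le h.factor (h.mono Set.subset_union_left)
    ((centre_le_commutant _).trans (commutant_anti (h.mono Set.subset_union_right)))).trans
      (sup_le (h.inf_commutant_interval_le hij hCT hY Set.subset_union_right ?_) le_sup_right)
  intro s hs t ht
  exact hadj s hs t (ht.1.resolve_right ht.2)

theorem isPartition (h : CycleFamily M B) : IsPartition B := by
  refine ⟨h.full, fun S T hST => isBipartition_iff.2
    ⟨h.mono Set.subset_union_left, h.mono Set.subset_union_right, ?_⟩⟩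
  refine le_antisymm ?_ (sup_le (le_inf ?_ (h.mono Set.subset_union_right)) (le_inf ?_
    (VertexSplitting.centre_le _)))
  · by_cases hY : S ∪ T = Set.univ
    · have hTS : T = Sᶜ :=
        (IsCompl.of_eq (Set.disjoint_iff_inter_eq_empty.1 hST) hY).compl_eq.symm
      rw [h.commutant_eq, ← hTS]
      exact inf_le_left.trans le_sup_left
    · exact h.inf_commutant_le_of_ne_univ
        (fun hS => hY (by rw [hS, Set.univ_union])) T hST hY
  · rw [h.commutant_eq]
    exact h.mono (Set.subset_compl_iff_disjoint_left.2 hST)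
  · exact (centre_le_commutant _).trans (commutant_anti (h.mono Set.subset_union_left))

end CycleFamily

/-! ### Cuts of the original cycle inside the split cycle. -/

section Cut

/-- The position in the split cycle of the cut `p` of the original cycle. -/
def splitCut (N : ℕ) (p : ℤ) : ℤ := p + 1 + (p - 1) / N

/-- The lift of `collapse` to the integers. -/
def mergeVertex (N : ℕ) (t : ℤ) : ℤ := t - 1 - (t - 1) / (N + 1)

variable {N : ℕ}

theorem splitCut_add (hN : 0 < N) (p : ℤ) : splitCut N (p + N) = splitCut N p + (N + 1) := by
  unfold splitCut
  rw [show p + N - 1 = p - 1 + N * 1 by ring, Int.add_mul_ediv_left _ _ (by omega)]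
  ring

theorem mergeVertex_add (t s : ℤ) :
    mergeVertex N (t + (N + 1) * s) = mergeVertex N t + N * s := by
  unfold mergeVertex
  rw [show t + (N + 1) * s - 1 = t - 1 + (N + 1) * s by ring,
    Int.add_mul_ediv_left _ _ (by omega)]
  ring

theorem splitCut_of_nonpos {p : ℤ} (h1 : -N < p) (h2 : p ≤ 0) : splitCut N p = p := by
  unfold splitCut
  have : (p - 1) / (N : ℤ) = -1 := by
    rw [Int.ediv_eq_iff_of_pos (by omega)]; constructor <;> linarith
  omega

theorem splitCut_of_pos {p : ℤ} (h1 : 0 < p) (h2 : p ≤ N) : splitCut N p = p + 1 := by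
  unfold splitCut
  rw [Int.ediv_eq_zero_of_lt (by omega) (by omega)]
  ring

/-- This adjunction is what makes the preimage of an interval under `collapse` an interval. -/
theorem splitCut_le_iff (hN : 0 < N) (p t : ℤ) : splitCut N p ≤ t ↔ p ≤ mergeVertex N t := by
  unfold splitCut mergeVertex
  have hN' : (0 : ℤ) < N := by exact_mod_cast hN
  have h1 := Int.emod_nonneg (p - 1) hN'.ne'
  have h2 := Int.emod_lt_of_pos (p - 1) hN'
  have h3 := Int.mul_ediv_add_emod (p - 1) N
  have h4 := Int.emod_nonneg (t - 1) (b := N + 1) (by omega)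
  have h5 := Int.emod_lt_of_pos (t - 1) (b := N + 1) (by omega)
  have h6 := Int.mul_ediv_add_emod (t - 1) (N + 1)
  generalize (p - 1) / (N : ℤ) = b at *
  generalize (t - 1) / ((N : ℤ) + 1) = a at *
  generalize (p - 1) % (N : ℤ) = s at *
  generalize (t - 1) % ((N : ℤ) + 1) = r at *
  rcases lt_trichotomy a b with h | rfl | h
  · constructor <;> intro h' <;> nlinarith
  · constructor <;> intro h' <;> linarith
  · constructor <;> intro h' <;> nlinarith

theorem splitCut_strictMono (hN : 0 < N) : StrictMono (splitCut N) := by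
  intro p q h
  unfold splitCut
  have := Int.ediv_le_ediv (a := p - 1) (b := q - 1) (c := (N : ℤ)) (by omega) (by omega)
  omega

/-- The only cut missed is the new one, between `-1/4` and `1/4`. -/
theorem exists_splitCut_eq (hN : 0 < N) (c : ℤ) :
    (∃ p, splitCut N p = c) ∨ ∃ s : ℤ, c = 1 + s * (N + 1 : ℕ) := by
  have h4 := Int.emod_nonneg (c - 1) (b := N + 1) (by omega)
  have h5 := Int.emod_lt_of_pos (c - 1) (b := N + 1) (by omega)
  have h6 := Int.mul_ediv_add_emod (c - 1) (N + 1)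
  generalize (c - 1) / ((N : ℤ) + 1) = q at *
  generalize (c - 1) % ((N : ℤ) + 1) = r at *
  rcases h4.eq_or_lt with rfl | h4
  · exact Or.inr ⟨q, by push_cast; linarith⟩
  · refine Or.inl ⟨N * q + r, ?_⟩
    have : (N * q + r - 1) / (N : ℤ) = q := by
      rw [Int.ediv_eq_iff_of_pos (by omega)]; constructor <;> nlinarith
    unfold splitCut
    rw [this]
    linarith

theorem collapse_intCast (hN : 0 < N) (t : ℤ) :
    collapse N (t : ZMod (N + 1)) = (mergeVertex N t : ZMod N) := by
  have h4 := Int.emod_nonneg t (b := N + 1) (by omega)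
  have h5 := Int.emod_lt_of_pos t (b := N + 1) (by omega)
  have h6 := Int.mul_ediv_add_emod t (N + 1)
  generalize t / ((N : ℤ) + 1) = q at *
  generalize t % ((N : ℤ) + 1) = r at *
  obtain ⟨r, rfl⟩ := Int.eq_ofNat_of_zero_le h4
  have ht : (t : ZMod (N + 1)) = (r : ZMod (N + 1)) := by
    rw [← h6]
    have : (((N : ℤ) + 1 : ℤ) : ZMod (N + 1)) = 0 := by
      have := ZMod.natCast_self (N + 1); push_cast at this ⊢; exact this
    rw [Int.cast_add, Int.cast_mul, this, zero_mul, zero_add, Int.cast_natCast]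
  have hm : mergeVertex N t = mergeVertex N r + N * q := by
    rw [← mergeVertex_add]; congr 1; linarith
  rw [ht, hm, collapse, ZMod.val_cast_of_lt (by omega), Int.cast_add, Int.cast_mul,
    Int.cast_natCast (R := ZMod N) N, ZMod.natCast_self, zero_mul, add_zero, ← Int.cast_natCast]
  congr 1
  unfold mergeVertex
  -- At residue `0` the truncated `0 - 1 = 0` of `collapse` matches the floor quotient `-1` in
  -- `mergeVertex`.
  rcases Nat.eq_zero_or_pos r with rfl | hr
  · have : ((0 : ℕ) - 1 : ℤ) / ((N : ℤ) + 1) = -1 := by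
      rw [Int.ediv_eq_iff_of_pos (by omega)]; constructor <;> push_cast <;> linarith
    rw [this]; simp
  · rw [Int.ediv_eq_zero_of_lt (by omega) (by omega)]
    omega

theorem preimage_collapse_interval (hN : 0 < N) (p q : ℤ) :
    collapse N ⁻¹' interval N p q = interval (N + 1) (splitCut N p) (splitCut N q) := by
  ext x
  constructor
  · rintro ⟨s, ⟨h1, h2⟩, hs⟩
    obtain ⟨t, -, -, rfl⟩ := exists_intCast_eq 0 x
    dsimp only at hs
    rw [collapse_intCast hN, ZMod.intCast_eq_intCast_iff_dvd_sub] at hs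
    obtain ⟨m, hm⟩ := hs
    refine ⟨t + (N + 1) * -m, ⟨?_, ?_⟩, ?_⟩
    · rw [splitCut_le_iff hN, mergeVertex_add]; linarith
    · rw [← not_le, splitCut_le_iff hN, mergeVertex_add]; linarith
    · have : (((N : ℤ) + 1 : ℤ) : ZMod (N + 1)) = 0 := by
        have := ZMod.natCast_self (N + 1); push_cast at this ⊢; exact this
      change ((t + (N + 1) * -m : ℤ) : ZMod (N + 1)) = _
      rw [Int.cast_add, Int.cast_mul, this, zero_mul, add_zero]
  · rintro ⟨t, ⟨h1, h2⟩, rfl⟩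
    rw [Set.mem_preimage, collapse_intCast hN]
    rw [splitCut_le_iff hN] at h1
    rw [← not_le, splitCut_le_iff hN, not_le] at h2
    exact intCast_mem_interval h1 h2

end Cut

/-! ### The partition rules on the intervals of the split cycle. -/

/-- The values on the intervals of the split cycle of the family that splits the vertex `0`. -/
structure SplitIntervals (N l n₁ n₂ : ℕ) (a : ℤ → ℤ → StarSubalgebra ℂ Ω)
    (L R : StarSubalgebra ℂ Ω) (b : ℤ → ℤ → StarSubalgebra ℂ Ω) : Prop where
  data : SplitData N l n₁ n₂ a L R
  mono : ∀ {i i' j' j : ℤ}, i ≤ i' → j' ≤ j → b i' j' ≤ b i j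
  periodic : ∀ s i j : ℤ, b (i + s * (N + 1 : ℕ)) (j + s * (N + 1 : ℕ)) = b i j
  unsplit : ∀ p q : ℤ, b (splitCut N p) (splitCut N q) = a p q
  left : ∀ {i : ℤ}, -N < i → i ≤ 0 → b i 1 = leftAlg a L (-i)
  right : ∀ {j : ℤ}, 2 ≤ j → j ≤ N + 1 → b 1 j = rightAlg a R (j - 2)

namespace SplitIntervals

variable {N l n₁ n₂ : ℕ} {a b : ℤ → ℤ → StarSubalgebra ℂ Ω} {L R : StarSubalgebra ℂ Ω}

theorem pos (h : SplitIntervals N l n₁ n₂ a L R b) : 0 < N := by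
  have := h.data.sys.large; omega

theorem after (h : SplitIntervals N l n₁ n₂ a L R b) {i j : ℤ} (hi : 2 ≤ i) (hij : i ≤ j)
    (hj : j ≤ N + 1) : b i j = a (i - 1) (j - 1) := by
  rw [← h.unsplit, splitCut_of_pos (by omega) (by omega), splitCut_of_pos (by omega) (by omega),
    sub_add_cancel, sub_add_cancel]

theorem before (h : SplitIntervals N l n₁ n₂ a L R b) {i j : ℤ} (hi : -N < i) (hij : i ≤ j)
    (hj : j ≤ 0) : b i j = a i j := by
  rw [← h.unsplit, splitCut_of_nonpos (by omega) (by omega),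
    splitCut_of_nonpos (by omega) (by omega)]

theorem around (h : SplitIntervals N l n₁ n₂ a L R b) {i j : ℤ} (hi : -N < i) (hi' : i ≤ 0)
    (hj : 2 ≤ j) (hj' : j ≤ N + 1) : b i j = a i (j - 1) := by
  rw [← h.unsplit, splitCut_of_nonpos (by omega) (by omega),
    splitCut_of_pos (by omega) (by omega), sub_add_cancel]

/-- The wire at a cut of the split cycle. -/
def cutWire (b : ℤ → ℤ → StarSubalgebra ℂ Ω) (c : ℤ) : StarSubalgebra ℂ Ω :=
  b (c - 1) c ⊓ b c (c + 1)

theorem cutWire_periodic (h : SplitIntervals N l n₁ n₂ a L R b) (s c : ℤ) :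
    cutWire b (c + s * (N + 1 : ℕ)) = cutWire b c := by
  unfold cutWire
  rw [add_sub_right_comm, add_right_comm, h.periodic, h.periodic]

theorem le_cutWire_one (h : SplitIntervals N l n₁ n₂ a L R b) :
    L ⊓ R ⊓ a 0 1 ≤ cutWire b 1 := by
  have hpos := h.pos
  rw [cutWire, sub_self, h.left (by omega) le_rfl, h.right (by omega) (by omega)]
  exact le_inf (le_trans (le_inf inf_le_right (inf_le_left.trans inf_le_left)) le_sup_right)
    (le_trans (le_inf inf_le_right (inf_le_left.trans inf_le_right)) le_sup_right)

variable [FiniteDimensional ℂ Ω]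

theorem commutant_left (h : SplitIntervals N l n₁ n₂ a L R b) {i : ℤ} (hi : -N < i)
    (hi' : i ≤ 0) : commutant (b i 1) = b 1 (i + (N + 1 : ℕ)) := by
  rw [h.left hi hi', h.data.commutant_leftAlg (by omega) (by omega),
    h.right (by omega) (by omega)]
  congr 1; push_cast; ring

theorem commutant_right (h : SplitIntervals N l n₁ n₂ a L R b) {j : ℤ} (hj : 2 ≤ j)
    (hj' : j ≤ N + 1) : commutant (b 1 j) = b j (1 + (N + 1 : ℕ)) := by
  have h1 := h.periodic 1 (j - (N + 1 : ℕ)) 1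
  rw [one_mul, sub_add_cancel] at h1
  rw [h1, ← commutant_commutant h.data.sys.factor (b (j - _) 1),
    h.commutant_left (by push_cast; omega) (by push_cast; omega), sub_add_cancel]

theorem compl (h : SplitIntervals N l n₁ n₂ a L R b) {i j : ℤ} (hij : i < j)
    (hj : j < i + (N + 1 : ℕ)) : commutant (b i j) = b j (i + (N + 1 : ℕ)) := by
  -- With two old ends this is duality in the original partition; otherwise a shift by periods
  -- brings the new cut to `1`.
  rcases exists_splitCut_eq h.pos i with ⟨p, rfl⟩ | ⟨s, rfl⟩
  · rcases exists_splitCut_eq h.pos j with ⟨q, rfl⟩ | ⟨s, rfl⟩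
    · have hpq := (splitCut_strictMono h.pos).lt_iff_lt.1 hij
      push_cast at hj ⊢
      rw [← splitCut_add h.pos] at hj ⊢
      have hqp := (splitCut_strictMono h.pos).lt_iff_lt.1 hj
      rw [h.unsplit, h.unsplit, h.data.sys.compl hpq.le hqp.le]
    · generalize splitCut N p = i at *
      obtain ⟨i, rfl⟩ : ∃ i', i = i' + s * (N + 1 : ℕ) := ⟨i - s * (N + 1 : ℕ), by ring⟩
      rw [add_right_comm, h.periodic, h.periodic, h.commutant_left (by omega) (by omega)]
  · obtain ⟨j, rfl⟩ : ∃ j', j = j' + s * (N + 1 : ℕ) := ⟨j - s * (N + 1 : ℕ), by ring⟩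
    rw [add_right_comm, h.periodic, h.periodic, h.commutant_right (by omega) (by omega)]

theorem gap_of_left_end (h : SplitIntervals N l n₁ n₂ a L R b) {j k m : ℤ} (hij : 1 < j)
    (hjk : j < k) (hkm : k < m) (hm : m ≤ N + 1) :
    b 1 m ⊓ commutant (b j k) ≤ b 1 j ⊔ b k m := by
  have h1 := h.data.rightAlg_gap (i := k - 1) (j := j - 2) (k := N + 1 - m) (by omega) (by omega)
    (by omega) (by omega)
  rw [h.right (by omega) hm, h.right (by omega) (by omega), h.after (by omega) (by omega)
    (by omega), h.after (by omega) (by omega) (by omega), h.data.sys.compl (by omega) (by omega)]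
  rw [← h.data.sys.periodic (k - 1 - N)] at h1
  convert h1 using 3 <;> ring

theorem gap_of_right_end (h : SplitIntervals N l n₁ n₂ a L R b) {i j k : ℤ} (hi : -N < i)
    (hij : i < j) (hjk : j < k) (hk : k ≤ 0) :
    b i 1 ⊓ commutant (b j k) ≤ b i j ⊔ b k 1 := by
  have h1 := h.data.leftAlg_gap (i := j + N) (j := i + N - 1) (k := -k) (by omega) (by omega)
    (by omega) (by omega)
  rw [h.left hi (by omega), h.left (by omega) hk, h.before (by omega) (by omega) (by omega),
    h.before (by omega) (by omega) (by omega), h.data.sys.compl (by omega) (by omega), sup_comm]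
  rw [sub_add_cancel, h.data.sys.periodic] at h1
  convert h1 using 3 <;> ring

theorem gap_of_inner_left (h : SplitIntervals N l n₁ n₂ a L R b) {i k m : ℤ} (hi : i ≤ 0)
    (hk : 1 < k) (hkm : k < m) (hm : m < i + (N + 1)) :
    b i m ⊓ commutant (b 1 k) ≤ b i 1 ⊔ b k m := by
  have h1 := h.data.leftAlg_gap (i := m - 1) (j := k - 2) (k := -i) (by omega) (by omega)
    (by omega) (by omega)
  rw [h.left (by omega) hi, h.right (by omega) (by omega), h.around (by omega) (by omega)
    (by omega) (by omega), h.after (by omega) (by omega) (by omega),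
    h.data.commutant_rightAlg (by omega) (by omega), inf_comm]
  convert h1 using 3 <;> ring

theorem gap_of_inner_right (h : SplitIntervals N l n₁ n₂ a L R b) {i j m : ℤ}
    (hij : i < j) (hj : j ≤ 0) (hm : 1 < m) (hm' : m < i + (N + 1)) :
    b i m ⊓ commutant (b j 1) ≤ b i j ⊔ b 1 m := by
  have h1 := h.data.rightAlg_gap (i := i + N) (j := m - 2) (k := -j) (by omega) (by omega)
    (by omega) (by omega)
  rw [h.left (by omega) hj, h.right (by omega) (by omega), h.around (by omega) (by omega)
    (by omega) (by omega), h.before (by omega) (by omega) (by omega),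
    h.data.commutant_leftAlg (by omega) (by omega), inf_comm, sup_comm]
  rw [show (N : ℤ) - -j = j + N by ring, h.data.sys.periodic] at h1
  convert h1 using 3 <;> ring

/-- The four cuts lie within less than a period, so at most one of them is new; each of its four
positions has its own lemma. -/
theorem gap (h : SplitIntervals N l n₁ n₂ a L R b) {i j k m : ℤ} (hij : i < j) (hjk : j < k)
    (hkm : k < m) (hm : m < i + (N + 1 : ℕ)) :
    b i m ⊓ commutant (b j k) ≤ b i j ⊔ b k m := by
  by_cases hs : ∃ s : ℤ, i = 1 + s * (N + 1 : ℕ) ∨ j = 1 + s * (N + 1 : ℕ) ∨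
      k = 1 + s * (N + 1 : ℕ) ∨ m = 1 + s * (N + 1 : ℕ)
  · obtain ⟨s, hs⟩ := hs
    obtain ⟨i, rfl⟩ : ∃ i', i = i' + s * (N + 1 : ℕ) := ⟨i - s * (N + 1 : ℕ), by ring⟩
    obtain ⟨j, rfl⟩ : ∃ j', j = j' + s * (N + 1 : ℕ) := ⟨j - s * (N + 1 : ℕ), by ring⟩
    obtain ⟨k, rfl⟩ : ∃ k', k = k' + s * (N + 1 : ℕ) := ⟨k - s * (N + 1 : ℕ), by ring⟩
    obtain ⟨m, rfl⟩ : ∃ m', m = m' + s * (N + 1 : ℕ) := ⟨m - s * (N + 1 : ℕ), by ring⟩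
    simp only [h.periodic]
    rcases hs with hs | hs | hs | hs <;> obtain rfl := add_right_cancel hs
    · exact h.gap_of_left_end (by omega) (by omega) (by omega) (by omega)
    · exact h.gap_of_inner_left (by omega) (by omega) (by omega) (by omega)
    · exact h.gap_of_inner_right (by omega) (by omega) (by omega) (by omega)
    · exact h.gap_of_right_end (by omega) (by omega) (by omega) (by omega)
  · push Not at hs
    obtain ⟨i, rfl⟩ := (exists_splitCut_eq h.pos i).resolve_right fun ⟨s, h'⟩ => (hs s).1 h'
    obtain ⟨j, rfl⟩ := (exists_splitCut_eq h.pos j).resolve_right fun ⟨s, h'⟩ => (hs s).2.1 h'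
    obtain ⟨k, rfl⟩ := (exists_splitCut_eq h.pos k).resolve_right fun ⟨s, h'⟩ => (hs s).2.2.1 h'
    obtain ⟨m, rfl⟩ := (exists_splitCut_eq h.pos m).resolve_right fun ⟨s, h'⟩ => (hs s).2.2.2 h'
    push_cast at hm
    rw [← splitCut_add h.pos] at hm
    rw [(splitCut_strictMono h.pos).lt_iff_lt] at hij hjk hkm hm
    rw [h.unsplit, h.unsplit, h.unsplit, h.unsplit, h.data.sys.compl hjk.le (by omega)]
    exact h.data.sys.gap hij hjk hkm hm

/-- Old wires survive. The delicate cuts are the two around the split vertex, whose wires must lie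
in the half vertices: `wire_le_leftAlg` and its mirror. -/
theorem wire_le (h : SplitIntervals N l n₁ n₂ a L R b) (p : ℤ) :
    wire a p ≤ cutWire b (splitCut N p) := by
  have hpos := h.pos
  obtain ⟨s, p, h1, h2, rfl⟩ : ∃ s p₀ : ℤ, 0 < p₀ ∧ p₀ ≤ N ∧ p = p₀ + N * s := by
    have h1 := Int.emod_nonneg (p - 1) (b := N) (by omega)
    have h2 := Int.emod_lt_of_pos (p - 1) (b := N) (by omega)
    have h3 := Int.mul_ediv_add_emod (p - 1) N
    exact ⟨(p - 1) / N, (p - 1) % N + 1, by omega, by omega, by linarith⟩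
  have hcut : splitCut N (p + N * s) = splitCut N p + s * (N + 1 : ℕ) := by
    unfold splitCut
    rw [add_sub_right_comm, Int.add_mul_ediv_left _ _ (by omega)]
    push_cast; ring
  have hwire : wire a (p + N * s) = wire a p := by
    clear hcut
    induction s using Int.induction_on with
    | zero => simp
    | succ n ih =>
      rw [← ih, ← h.data.sys.wire_periodic (p + N * n)]
      congr 1; ring
    | pred n ih =>
      rw [← ih, ← h.data.sys.wire_periodic (p + N * (-n - 1))]
      congr 1; ring
  rw [hcut, hwire, h.cutWire_periodic, splitCut_of_pos h1 h2, cutWire, add_sub_cancel_right]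
  refine le_inf ?_ ?_
  · rcases eq_or_ne p 1 with rfl | hp
    · rw [h.right (by omega) (by omega), ← leftAlg_mirror]
      have h3 := h.data.mirror.wire_le_leftAlg (k := 0) le_rfl
      rwa [wire_mirror] at h3
    · rw [h.after (by omega) (by omega) (by omega), add_sub_cancel_right]
      exact inf_le_left.trans (centre_le _)
  · rcases eq_or_ne p N with rfl | hp
    · have h3 : b (N + 1) (N + 1 + 1) = b 0 1 := by
        rw [← h.periodic 1 0 1]; congr 1 <;> push_cast <;> ring
      have h4 := h.data.sys.wire_periodic 0
      rw [zero_add] at h4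
      rw [h3, h4, h.left (by omega) le_rfl, neg_zero]
      simpa using h.data.wire_le_leftAlg (k := 0) le_rfl
    · rw [h.after (by omega) (by omega) (by omega), add_sub_cancel_right, add_sub_cancel_right]
      exact inf_le_right.trans (centre_le _)

theorem centre_le_left (h : SplitIntervals N l n₁ n₂ a L R b) {i : ℤ} (hi : -N < i)
    (hi' : i ≤ 0) : centre (b i 1) ≤ cutWire b i ⊔ cutWire b 1 := by
  have h1 := h.data.centre_leftAlg_le (k := -i) (by omega) (by omega)
  have h2 := h.wire_le i
  rw [splitCut_of_nonpos hi hi'] at h2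
  rw [neg_neg] at h1
  rw [h.left hi hi', sup_comm]
  exact h1.trans (sup_le_sup h.le_cutWire_one h2)

theorem centre_le_right (h : SplitIntervals N l n₁ n₂ a L R b) {j : ℤ} (hj : 2 ≤ j)
    (hj' : j ≤ N + 1) : centre (b 1 j) ≤ cutWire b 1 ⊔ cutWire b j := by
  have h1 := h.data.centre_rightAlg_le (j := j - 2) (by omega) (by omega)
  have h2 := h.wire_le (j - 1)
  rw [splitCut_of_pos (by omega) (by omega), sub_add_cancel] at h2
  rw [show j - 2 + 1 = j - 1 by ring] at h1
  rw [h.right hj hj']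
  exact h1.trans (sup_le_sup h.le_cutWire_one h2)

theorem centre_le_cutWire (h : SplitIntervals N l n₁ n₂ a L R b) {i j : ℤ} (hij : i < j)
    (hj : j < i + (N + 1 : ℕ)) : centre (b i j) ≤ cutWire b i ⊔ cutWire b j := by
  rcases exists_splitCut_eq h.pos i with ⟨p, rfl⟩ | ⟨s, rfl⟩
  · rcases exists_splitCut_eq h.pos j with ⟨q, rfl⟩ | ⟨s, rfl⟩
    · have hpq := (splitCut_strictMono h.pos).lt_iff_lt.1 hij
      push_cast at hj
      rw [← splitCut_add h.pos] at hj
      have hqp := (splitCut_strictMono h.pos).lt_iff_lt.1 hj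
      rw [h.unsplit]
      exact (h.data.sys.centre_le_wires hpq.le hqp.le).trans
        (sup_le_sup (h.wire_le p) (h.wire_le q))
    · generalize splitCut N p = i at *
      obtain ⟨i, rfl⟩ : ∃ i', i = i' + s * (N + 1 : ℕ) := ⟨i - s * (N + 1 : ℕ), by ring⟩
      rw [h.periodic, h.cutWire_periodic, h.cutWire_periodic]
      exact h.centre_le_left (by omega) (by omega)
  · obtain ⟨j, rfl⟩ : ∃ j', j = j' + s * (N + 1 : ℕ) := ⟨j - s * (N + 1 : ℕ), by ring⟩
    rw [h.periodic, h.cutWire_periodic, h.cutWire_periodic]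
    exact h.centre_le_right (by omega) (by omega)

theorem cutWire_le_centre_left (h : SplitIntervals N l n₁ n₂ a L R b) {i j : ℤ} (hij : i < j)
    (hj : j < i + (N + 1 : ℕ)) : cutWire b i ≤ centre (b i j) := by
  have h1 := h.periodic 1 (i - 1) i
  rw [centre, h.compl hij hj, cutWire, inf_comm, ← h1]
  exact inf_le_inf (h.mono le_rfl (by omega)) (h.mono (by omega) (by omega))

theorem cutWire_le_centre_right (h : SplitIntervals N l n₁ n₂ a L R b) {i j : ℤ} (hij : i < j)
    (hj : j < i + (N + 1 : ℕ)) : cutWire b j ≤ centre (b i j) := by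
  rw [centre, h.compl hij hj, cutWire]
  exact inf_le_inf (h.mono (by omega) le_rfl) (h.mono le_rfl (by omega))

theorem bipartition_of_right_end (h : SplitIntervals N l n₁ n₂ a L R b) {i j : ℤ} (hi : -N < i)
    (hij : i < j) (hj : j ≤ 0) :
    b i 1 ⊓ commutant (b i j) ≤ b j 1 ⊔ centre (b i 1) := by
  have h1 := h.data.leftAlg_inf_le (k := -j) (k₂ := -i) (by omega) (by omega) (by omega)
  have h2 := h.wire_le i
  rw [splitCut_of_nonpos hi (by omega)] at h2
  replace h2 := h2.trans (h.cutWire_le_centre_left (j := 1) (by omega) (by omega))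
  rw [neg_neg, neg_neg, show (N : ℤ) - -i = i + N by ring, ← h.left hi (by omega),
    ← h.left (by omega) hj, ← h.data.sys.compl (by omega) (by omega),
    ← h.before hi hij.le hj] at h1
  exact h1.trans (sup_le_sup le_rfl h2)

theorem bipartition_of_inner (h : SplitIntervals N l n₁ n₂ a L R b) {i k : ℤ} (hi : i ≤ 0)
    (hk : 1 < k) (hk' : k < i + (N + 1)) :
    b i k ⊓ commutant (b i 1) ≤ b 1 k ⊔ centre (b i k) := by
  have h1 := h.data.rightAlg_inf_le (j := k - 2) (j₂ := i + N - 1) (by omega) (by omega)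
    (by omega)
  have h2 := h.wire_le i
  rw [splitCut_of_nonpos (by omega) hi] at h2
  replace h2 := h2.trans (h.cutWire_le_centre_left (j := k) (by omega) (by push_cast; omega))
  rw [sub_add_cancel, add_sub_cancel_right, h.data.sys.wire_periodic,
    show k - 2 + 1 = k - 1 by ring, ← h.right (by omega) (by omega),
    ← h.around (by omega) hi (by omega) (by omega), inf_comm] at h1
  rw [h.commutant_left (by omega) hi, h.right (by push_cast; omega) (by push_cast; omega),
    show i + ((N + 1 : ℕ) : ℤ) - 2 = i + N - 1 by push_cast; ring]
  exact h1.trans (sup_le_sup le_rfl h2)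

theorem bipartition_of_left_end (h : SplitIntervals N l n₁ n₂ a L R b) {j k : ℤ} (hj : 1 < j)
    (hjk : j < k) (hk : k ≤ N + 1) :
    b 1 k ⊓ commutant (b 1 j) ≤ b j k ⊔ centre (b 1 k) := by
  refine bipartition_symm h.data.sys.factor (h.mono hj.le le_rfl) ?_
  have h1 := h.data.rightAlg_inf_le (j := j - 2) (j₂ := k - 2) (by omega) (by omega) (by omega)
  have h2 := h.wire_le (k - 1)
  rw [splitCut_of_pos (by omega) (by omega), sub_add_cancel] at h2
  replace h2 := h2.trans
    (h.cutWire_le_centre_right (i := 1) (by omega) (by push_cast; omega))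
  rw [show k - 2 + 1 = k - 1 by ring, show j - 2 + 1 = j - 1 by ring,
    ← h.data.sys.periodic, sub_add_cancel, ← h.data.sys.compl (by omega) (by omega),
    ← h.after (by omega) hjk.le (by omega), ← h.right (by omega) hk,
    ← h.right (by omega) (by omega)] at h1
  exact h1.trans (sup_le_sup le_rfl h2)

theorem bipartition (h : SplitIntervals N l n₁ n₂ a L R b) {i j k : ℤ} (hij : i < j)
    (hjk : j < k) (hk : k < i + (N + 1 : ℕ)) :
    b i k ⊓ commutant (b i j) ≤ b j k ⊔ centre (b i k) := by
  by_cases hs : ∃ s : ℤ, i = 1 + s * (N + 1 : ℕ) ∨ j = 1 + s * (N + 1 : ℕ) ∨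
      k = 1 + s * (N + 1 : ℕ)
  · obtain ⟨s, hs⟩ := hs
    obtain ⟨i, rfl⟩ : ∃ i', i = i' + s * (N + 1 : ℕ) := ⟨i - s * (N + 1 : ℕ), by ring⟩
    obtain ⟨j, rfl⟩ : ∃ j', j = j' + s * (N + 1 : ℕ) := ⟨j - s * (N + 1 : ℕ), by ring⟩
    obtain ⟨k, rfl⟩ : ∃ k', k = k' + s * (N + 1 : ℕ) := ⟨k - s * (N + 1 : ℕ), by ring⟩
    simp only [h.periodic]
    rcases hs with hs | hs | hs <;> obtain rfl := add_right_cancel hs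
    · exact h.bipartition_of_left_end (by omega) (by omega) (by omega)
    · exact h.bipartition_of_inner (by omega) (by omega) (by omega)
    · exact h.bipartition_of_right_end (by omega) (by omega) (by omega)
  · push Not at hs
    obtain ⟨i, rfl⟩ := (exists_splitCut_eq h.pos i).resolve_right fun ⟨s, h'⟩ => (hs s).1 h'
    obtain ⟨j, rfl⟩ := (exists_splitCut_eq h.pos j).resolve_right fun ⟨s, h'⟩ => (hs s).2.1 h'
    obtain ⟨k, rfl⟩ := (exists_splitCut_eq h.pos k).resolve_right fun ⟨s, h'⟩ => (hs s).2.2 h'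
    push_cast at hk
    rw [← splitCut_add h.pos] at hk
    rw [(splitCut_strictMono h.pos).lt_iff_lt] at hij hjk hk
    rw [h.unsplit, h.unsplit, h.unsplit, h.data.sys.compl hij.le (by omega)]
    exact h.data.sys.bipartition hij.le hjk.le hk.le

end SplitIntervals

/-! ### Extracting the interval data from the hypotheses. -/

theorem IsPartition.mono {V : Type*} {A : Set V → StarSubalgebra ℂ Ω} (h : IsPartition A)
    {S T : Set V} (hST : S ⊆ T) : A S ≤ A T := by
  have h1 := (h.2 S (T \ S) Set.disjoint_sdiff_right).1
  rwa [Set.union_sdiff_cancel hST] at h1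

section Partition

variable [FiniteDimensional ℂ Ω]

theorem IsPartition.commutant_eq {V : Type*} {A : Set V → StarSubalgebra ℂ Ω}
    (hΩ : IsFactor Ω) (h : IsPartition A) (S : Set V) : commutant (A S) = A Sᶜ := by
  have h1 := (isBipartition_iff.1 (h.2 S Sᶜ disjoint_compl_right)).2.2
  rwa [Set.union_compl_self, h.1, inf_top_eq, hΩ, sup_bot_eq] at h1

theorem IsPartition.empty {V : Type*} {A : Set V → StarSubalgebra ℂ Ω}
    (hΩ : IsFactor Ω) (h : IsPartition A) : A ∅ = ⊥ := by
  rw [← Set.compl_univ, ← h.commutant_eq hΩ, h.1, commutant_top hΩ]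

/-- The algebras of the intervals in a connected partition of a factor over a cycle. -/
theorem intervalSystem {N l : ℕ} {A : Set (ZMod N) → StarSubalgebra ℂ Ω} (hΩ : IsFactor Ω)
    (hN : 4 * l + 1 ≤ N) (hA : IsPartition A) (hconn : VertexSplitting.IsConnected A)
    (hcorr : HasCorrelationLengthLE cycleDist l A) :
    IntervalSystem N l fun i j => A (interval N i j) := by
  have : NeZero N := ⟨by omega⟩
  have compl : ∀ {i j : ℤ}, i ≤ j → j ≤ i + N →
      commutant (A (interval N i j)) = A (interval N j (i + N)) := fun h1 h2 => by
    rw [hA.commutant_eq hΩ, compl_interval h1 h2]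
  refine ⟨hΩ, hN, fun i j => by rw [interval_add_period],
    fun h1 h2 => hA.mono (interval_mono h1 h2),
    fun h => by rw [interval_eq_empty h, hA.empty hΩ], fun i => by rw [interval_full, hA.1],
    compl, ?_, ?_, ?_⟩
  · intro i j k h1 h2 h3
    have hdisj : Disjoint (interval N i j) (interval N j k) := by
      rw [← Set.subset_compl_iff_disjoint_left, compl_interval h1 (by omega)]
      exact interval_mono le_rfl h3
    have h4 := (isBipartition_iff.1 (hA.2 _ _ hdisj)).2.2
    rw [interval_union h1 h2, compl h1 (by omega), inf_comm] at h4
    exact h4.le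
  · intro i j k m h1 h2 h3 h4
    have hsplit : ∀ {i j k m : ℤ}, i < j → j < k → k < m → m < i + N →
        A (interval N i j ∪ interval N k m) = A (interval N i j) ⊔ A (interval N k m) := by
      intro i j k m h1 h2 h3 h4
      refine hconn _ _ ?_ ?_
      · rw [← Set.subset_compl_iff_disjoint_left, compl_interval (by omega) (by omega)]
        exact interval_mono (by omega) (by omega)
      · rintro _ ⟨s, ⟨hs1, hs2⟩, rfl⟩ _ ⟨t, ⟨ht1, ht2⟩, rfl⟩
        constructor
        · intro h
          have h' : ((t : ℤ) : ZMod N) = ((s + 1 : ℤ) : ZMod N) := by push_cast; exact h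
          have := eq_of_intCast_eq (c := i) (by omega) (by omega) (by omega) (by omega) h'
          omega
        · intro h
          have h' : ((s + N : ℤ) : ZMod N) = ((t + 1 : ℤ) : ZMod N) := by push_cast; simpa using h
          have := eq_of_intCast_eq (c := t + 1) (by omega) (by omega) (by omega) (by omega) h'
          omega
    -- Both factors of the meet are commutants, of `[m - N, i)` and `[j, k)`. Connectedness joins
    -- these two into one set, with complement `[i, j) ∪ [k, m)`, to which connectedness applies
    -- again.
    have e1 := compl (i := m - N) (j := i) (by omega) (by omega)
    have e2 := compl (i := j) (j := k) (by omega) (by omega)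
    rw [sub_add_cancel] at e1
    rw [← e1, ← e2, ← commutant_sup, ← hsplit (by omega) (by omega) (by omega) (by omega),
      ← hsplit (by omega) (by omega) (by omega) (by omega), hA.commutant_eq hΩ]
    refine hA.mono fun x hx => ?_
    obtain ⟨t, ht1, ht2, rfl⟩ := exists_intCast_eq (m - N) x
    by_contra hc
    refine hx ?_
    rcases lt_or_ge t i with h | h
    · exact Or.inl (intCast_mem_interval ht1 h)
    rcases lt_or_ge t j with h' | h'
    · exact absurd (Or.inl (intCast_mem_interval h h')) hc
    rcases lt_or_ge t k with h'' | h''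
    · exact Or.inr (intCast_mem_interval h' h'')
    · exact absurd (Or.inr (intCast_mem_interval h'' (by omega))) hc
  · intro i j k m h1 h2 h3 h4
    refine (hcorr (interval N i j)).mono le_rfl (hA.mono ?_)
    rintro _ ⟨t, ⟨ht1, ht2⟩, rfl⟩ _ ⟨s, ⟨hs1, hs2⟩, rfl⟩
    have e1 := val_intCast_sub (M := N) (s := s) (t := t) (by omega) (by omega)
    have e2 := val_intCast_sub (M := N) (s := t) (t := s + N) (by omega) (by omega)
    rw [Int.cast_add, Int.cast_natCast, ZMod.natCast_self, add_zero] at e2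
    unfold cycleDist
    rw [e1, e2]
    omega

end Partition

theorem splitData {N l : ℕ} {A : Set (ZMod N) → StarSubalgebra ℂ Ω} {L : StarSubalgebra ℂ Ω}
    (hsys : IntervalSystem N l fun i j => A (interval N i j))
    (hinc_left : A (arc (pMinus N) (-1)) ≤ L) (hinc_right : L ≤ A (arc (pMinus N) 0))
    (hrestr : L = A (arc (pMinus N) 0) ⊓
      commutant (commutant L ⊓ A (arc 0 (qPlus N l)))) :
    SplitData N l (N / 2) ((N - 1) / 2) (fun i j => A (interval N i j)) L (commutant L) := by
  have hN := hsys.large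
  have : NeZero N := ⟨by omega⟩
  have hp : pMinus N = ((-(N / 2 : ℕ) : ℤ) : ZMod N) := by
    rw [pMinus, Int.cast_neg, Int.cast_natCast]
  have hq : qPlus N l = (((N - 1) / 2 : ℕ) - l : ℤ) := by
    rw [qPlus, pPlus, Int.cast_sub, Int.cast_natCast, Int.cast_natCast]
  have e1 : arc (pMinus N) 0 = interval N (-(N / 2 : ℕ)) 1 := by
    have := arc_eq_interval (M := N) (i := -(N / 2 : ℕ)) (j := 0) (by omega) (by omega)
    rwa [Int.cast_zero, ← hp, zero_add] at this
  have e2 : arc 0 (qPlus N l) = interval N 0 (((N - 1) / 2 : ℕ) - l + 1) := by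
    have := arc_eq_interval (M := N) (i := 0) (j := ((N - 1) / 2 : ℕ) - l) (by omega) (by omega)
    rwa [Int.cast_zero, ← hq] at this
  rw [e1, e2] at hrestr
  rw [e1] at hinc_right
  refine ⟨hsys, by omega, by omega, by omega, rfl, ?_, hinc_right, hrestr.ge⟩
  -- For `N = 1` the arc from `p₋` to `-1` is the whole cycle rather than empty, but then the
  -- required inclusion concerns the empty interval.
  rcases Nat.eq_zero_or_pos (N / 2) with h | h
  · rw [h]
    exact (hsys.empty (i := -(0 : ℕ)) (j := 0) (by simp)).le.trans bot_le
  · have e3 := arc_eq_interval (M := N) (i := -(N / 2 : ℕ)) (j := -1) (by omega) (by omega)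
    rw [← hp, Int.cast_neg, Int.cast_one, neg_add_cancel] at e3
    rwa [e3] at hinc_left

/-! ### Fibres of the collapsing map. -/

section Fibres

variable {N : ℕ}

theorem mergeVertex_of_nonpos {t : ℤ} (h1 : -N ≤ t) (h2 : t ≤ 0) : mergeVertex N t = t := by
  unfold mergeVertex
  have : (t - 1) / ((N : ℤ) + 1) = -1 := by
    rw [Int.ediv_eq_iff_of_pos (by omega)]; constructor <;> linarith
  omega

theorem mergeVertex_of_pos {t : ℤ} (h1 : 0 < t) (h2 : t ≤ N + 1) :
    mergeVertex N t = t - 1 := by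
  unfold mergeVertex
  rw [Int.ediv_eq_zero_of_lt (by omega) (by omega), sub_zero]

theorem collapse_of_nonpos (hN : 0 < N) {t : ℤ} (h1 : -N ≤ t) (h2 : t ≤ 0) :
    collapse N (t : ZMod (N + 1)) = t := by
  rw [collapse_intCast hN, mergeVertex_of_nonpos h1 h2]

theorem collapse_add_one (hN : 0 < N) {t : ℤ} (h1 : 0 ≤ t) (h2 : t ≤ N) :
    collapse N ((t + 1 : ℤ) : ZMod (N + 1)) = t := by
  rw [collapse_intCast hN, mergeVertex_of_pos (by omega) (by omega), add_sub_cancel_right]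

theorem preimage_collapse_singleton (hN : 0 < N) (s : ℤ) :
    collapse N ⁻¹' {(s : ZMod N)} = interval (N + 1) (splitCut N s) (splitCut N (s + 1)) := by
  rw [← interval_succ, preimage_collapse_interval hN]

/-- The last vertex of a fibre is followed by the first vertex of the next, so non-adjacency
descends to the original cycle. -/
theorem exists_collapse_eq (hN : 0 < N) (v : ZMod N) :
    ∃ x : ZMod (N + 1), collapse N x = v ∧ collapse N (x + 1) = v + 1 := by
  have : NeZero N := ⟨by omega⟩
  obtain ⟨s, -, -, rfl⟩ := exists_intCast_eq 0 v
  have hmono := splitCut_strictMono hN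
  have h1 := hmono (show s < s + 1 by omega)
  have h2 := hmono (show s + 1 < s + 1 + 1 by omega)
  refine ⟨((splitCut N (s + 1) - 1 : ℤ) : ZMod (N + 1)), ?_, ?_⟩
  · have : ((splitCut N (s + 1) - 1 : ℤ) : ZMod (N + 1)) ∈ collapse N ⁻¹' {(s : ZMod N)} := by
      rw [preimage_collapse_singleton hN]
      exact intCast_mem_interval (by omega) (by omega)
    exact this
  · have : ((splitCut N (s + 1) : ℤ) : ZMod (N + 1)) ∈ collapse N ⁻¹' {((s + 1 : ℤ) : ZMod N)} := by
      rw [preimage_collapse_singleton hN]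
      exact intCast_mem_interval le_rfl h2
    simpa using this

/-- The vertices whose fibre in the split cycle is contained in `S`. -/
def fullFibres (N : ℕ) (S : Set (ZMod (N + 1))) : Set (ZMod N) :=
  {v | collapse N ⁻¹' {v} ⊆ S}

theorem mem_fullFibres {S : Set (ZMod (N + 1))} {v : ZMod N} :
    v ∈ fullFibres N S ↔ collapse N ⁻¹' {v} ⊆ S :=
  Iff.rfl

theorem fullFibres_mono {S T : Set (ZMod (N + 1))} (h : S ⊆ T) :
    fullFibres N S ⊆ fullFibres N T :=
  fun _ hv => hv.trans h

theorem fullFibres_preimage (hN : 0 < N) (S : Set (ZMod N)) :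
    fullFibres N (collapse N ⁻¹' S) = S := by
  ext v
  constructor
  · intro hv
    obtain ⟨x, rfl, -⟩ := exists_collapse_eq hN v
    exact hv (Set.mem_singleton _)
  · rintro hv x rfl
    exact hv

theorem fullFibres_left (hN : 0 < N) {i : ℤ} (hi : -N < i) (hi' : i ≤ 0) :
    fullFibres N (interval (N + 1) i 1) = interval N i 0 := by
  have : NeZero N := ⟨by omega⟩
  ext v
  obtain ⟨s, h1, h2, rfl⟩ := exists_intCast_eq i v
  rw [intCast_mem_interval_iff le_rfl (by omega) h1 h2]
  constructor
  · intro hv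
    refine ⟨h1, ?_⟩
    by_contra hs
    have h3 := hv (collapse_add_one hN (t := s) (by omega) (by omega))
    rw [intCast_mem_interval_iff (c := i) le_rfl (by push_cast; omega) (by omega)
      (by push_cast; omega)] at h3
    omega
  · rintro ⟨-, hs⟩
    rw [mem_fullFibres, preimage_collapse_singleton hN, splitCut_of_nonpos (by omega) (by omega),
      splitCut_of_nonpos (by omega) (by omega)]
    exact interval_mono h1 (by omega)

theorem zero_notMem_interval {j : ℤ} (hj : 2 ≤ j) (hj' : j ≤ N + 1) :
    ((0 : ℤ) : ZMod (N + 1)) ∉ interval (N + 1) 1 j := by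
  have := (notMem_interval (M := N + 1) (i := 1) (j := j) (by push_cast; omega) (by omega)).1
  rwa [sub_self] at this

theorem fullFibres_right (hN : 0 < N) {j : ℤ} (hj : 2 ≤ j) (hj' : j ≤ N + 1) :
    fullFibres N (interval (N + 1) 1 j) = interval N 1 (j - 1) := by
  have : NeZero N := ⟨by omega⟩
  ext v
  obtain ⟨s, h1, h2, rfl⟩ := exists_intCast_eq 0 v
  rw [intCast_mem_interval_iff (c := 0) (by omega) (by omega) h1 h2]
  constructor
  · intro hv
    have h0 : s ≠ 0 := by
      rintro rfl
      exact zero_notMem_interval hj hj' (hv (collapse_of_nonpos hN (by omega) le_rfl))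
    have h3 := hv (collapse_add_one hN (t := s) (by omega) (by omega))
    rw [intCast_mem_interval_iff (c := 1) le_rfl (by push_cast; omega) (by omega)
      (by push_cast; omega)] at h3
    omega
  · rintro ⟨h3, h4⟩
    rw [mem_fullFibres, preimage_collapse_singleton hN, splitCut_of_pos (by omega) (by omega),
      splitCut_of_pos (by omega) (by omega)]
    exact interval_mono (by omega) (by omega)

/-- A fibre is an interval, so it cannot be shared between two non-adjacent sets. -/
theorem fullFibres_union (hN : 0 < N) {S T : Set (ZMod (N + 1))} (hadj : NonAdjacent S T) :
    fullFibres N (S ∪ T) ⊆ fullFibres N S ∪ fullFibres N T := by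
  have : NeZero N := ⟨by omega⟩
  have hadj' : NonAdjacent T S := fun t ht s hs => (hadj s hs t ht).symm
  intro v hv
  obtain ⟨s, -, -, rfl⟩ := exists_intCast_eq 0 v
  have h1 := splitCut_strictMono hN (show s < s + 1 by omega)
  rw [mem_fullFibres, preimage_collapse_singleton hN] at hv
  rw [Set.mem_union, mem_fullFibres, mem_fullFibres, preimage_collapse_singleton hN]
  rcases hv (intCast_mem_interval le_rfl h1) with h | h
  · exact Or.inl (interval_subset_of_nonAdjacent hadj h hv)
  · exact Or.inr (interval_subset_of_nonAdjacent hadj' h (hv.trans (Set.union_comm _ _).subset))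

theorem disjoint_fullFibres (hN : 0 < N) {S T : Set (ZMod (N + 1))} (h : Disjoint S T) :
    Disjoint (fullFibres N S) (fullFibres N T) := by
  refine Set.disjoint_left.2 fun v hS hT => ?_
  obtain ⟨x, rfl, -⟩ := exists_collapse_eq hN v
  exact Set.disjoint_left.1 h (hS (Set.mem_singleton _)) (hT (Set.mem_singleton _))

theorem nonAdjacent_fullFibres (hN : 0 < N) {S T : Set (ZMod (N + 1))} (h : NonAdjacent S T) :
    NonAdjacent (fullFibres N S) (fullFibres N T) := by
  intro v hv u hu
  constructor
  · rintro rfl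
    obtain ⟨x, hx, hx'⟩ := exists_collapse_eq hN v
    exact (h x (hv hx) (x + 1) (hu hx')).1 rfl
  · rintro rfl
    obtain ⟨x, hx, hx'⟩ := exists_collapse_eq hN u
    exact (h (x + 1) (hv hx') x (hu hx)).2 rfl

end Fibres

/-! ### The split family. -/

/-- The family over the split cycle: the algebra of `S` is generated by that of the vertices with
full fibre and by those of the intervals of `S` that end or start at the split vertex. -/
noncomputable def splitFamily (N : ℕ) (A : Set (ZMod N) → StarSubalgebra ℂ Ω)
    (L R : StarSubalgebra ℂ Ω) (S : Set (ZMod (N + 1))) : StarSubalgebra ℂ Ω :=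
  A (fullFibres N S) ⊔
    ((⨆ i ∈ {i : ℤ | -N < i ∧ i ≤ 0 ∧ interval (N + 1) i 1 ⊆ S}, A (interval N i 1) ⊓ L) ⊔
      ⨆ j ∈ {j : ℤ | 2 ≤ j ∧ j ≤ N + 1 ∧ interval (N + 1) 1 j ⊆ S}, A (interval N 0 (j - 1)) ⊓ R)

section SplitFamily

variable {N : ℕ} {A : Set (ZMod N) → StarSubalgebra ℂ Ω} {L R : StarSubalgebra ℂ Ω}

theorem splitFamily_le {S : Set (ZMod (N + 1))} {F : StarSubalgebra ℂ Ω}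
    (h : A (fullFibres N S) ≤ F)
    (hl : ∀ i : ℤ, -N < i → i ≤ 0 → interval (N + 1) i 1 ⊆ S → A (interval N i 1) ⊓ L ≤ F)
    (hr : ∀ j : ℤ, 2 ≤ j → j ≤ N + 1 → interval (N + 1) 1 j ⊆ S →
      A (interval N 0 (j - 1)) ⊓ R ≤ F) : splitFamily N A L R S ≤ F :=
  sup_le h (sup_le (iSup₂_le fun i hi => hl i hi.1 hi.2.1 hi.2.2)
    (iSup₂_le fun j hj => hr j hj.1 hj.2.1 hj.2.2))

theorem left_le_splitFamily {S : Set (ZMod (N + 1))} {i : ℤ} (h1 : -N < i) (h2 : i ≤ 0)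
    (h3 : interval (N + 1) i 1 ⊆ S) : A (interval N i 1) ⊓ L ≤ splitFamily N A L R S :=
  le_sup_of_le_right (le_sup_of_le_left (le_iSup₂_of_le i ⟨h1, h2, h3⟩ le_rfl))

theorem right_le_splitFamily {S : Set (ZMod (N + 1))} {j : ℤ} (h1 : 2 ≤ j) (h2 : j ≤ N + 1)
    (h3 : interval (N + 1) 1 j ⊆ S) : A (interval N 0 (j - 1)) ⊓ R ≤ splitFamily N A L R S :=
  le_sup_of_le_right (le_sup_of_le_right (le_iSup₂_of_le j ⟨h1, h2, h3⟩ le_rfl))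

theorem splitFamily_mono (hA : IsPartition A) {S T : Set (ZMod (N + 1))} (h : S ⊆ T) :
    splitFamily N A L R S ≤ splitFamily N A L R T :=
  splitFamily_le ((hA.mono (fullFibres_mono h)).trans le_sup_left)
    (fun _ h1 h2 h3 => left_le_splitFamily h1 h2 (h3.trans h))
    (fun _ h1 h2 h3 => right_le_splitFamily h1 h2 (h3.trans h))

theorem splitFamily_preimage (hN : 0 < N) (hA : IsPartition A) (S : Set (ZMod N)) :
    splitFamily N A L R (collapse N ⁻¹' S) = A S := by
  refine le_antisymm (splitFamily_le (by rw [fullFibres_preimage hN]) ?_ ?_)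
    (le_sup_of_le_left (by rw [fullFibres_preimage hN]))
  · intro i h1 h2 h3
    refine inf_le_left.trans (hA.mono ?_)
    rintro _ ⟨s, ⟨h4, h5⟩, rfl⟩
    have := h3 (intCast_mem_interval h4 h5)
    rwa [Set.mem_preimage, collapse_of_nonpos hN (by omega) (by omega)] at this
  · intro j h1 h2 h3
    refine inf_le_left.trans (hA.mono ?_)
    rintro _ ⟨s, ⟨h4, h5⟩, rfl⟩
    have := h3 (intCast_mem_interval (t := s + 1) (by omega) (by omega))
    rwa [Set.mem_preimage, collapse_add_one hN (by omega) (by omega)] at this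

theorem splitFamily_left (hN : 0 < N) (hA : IsPartition A) {i : ℤ} (hi : -N < i) (hi' : i ≤ 0) :
    splitFamily N A L R (interval (N + 1) i 1) =
      leftAlg (fun i j => A (interval N i j)) L (-i) := by
  have hn := notMem_interval (M := N + 1) (i := i) (j := 1) (by push_cast; omega) (by omega)
  unfold leftAlg
  rw [neg_neg]
  refine le_antisymm (splitFamily_le ?_ ?_ ?_) (sup_le ?_ (left_le_splitFamily hi hi' subset_rfl))
  · rw [fullFibres_left hN hi hi']
    exact le_sup_left
  · intro k h1 h2 h3
    have hik : i ≤ k := by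
      by_contra hlt
      exact hn.1 (h3 (intCast_mem_interval (by omega) (by omega)))
    exact le_sup_of_le_right (inf_le_inf_right _ (hA.mono (interval_mono hik le_rfl)))
  · intro j h1 h2 h3
    exact absurd (h3 (intCast_mem_interval le_rfl (by omega))) hn.2
  · exact le_sup_of_le_left (by rw [fullFibres_left hN hi hi'])

theorem splitFamily_right (hN : 0 < N) (hA : IsPartition A) {j : ℤ} (hj : 2 ≤ j)
    (hj' : j ≤ N + 1) : splitFamily N A L R (interval (N + 1) 1 j) =
      rightAlg (fun i j => A (interval N i j)) R (j - 2) := by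
  have hn := notMem_interval (M := N + 1) (i := 1) (j := j) (by push_cast; omega) (by omega)
  unfold rightAlg
  rw [show j - 2 + 1 = j - 1 by ring]
  refine le_antisymm (splitFamily_le ?_ ?_ ?_) (sup_le ?_ (right_le_splitFamily hj hj' subset_rfl))
  · rw [fullFibres_right hN hj hj']
    exact le_sup_left
  · intro i h1 h2 h3
    exact absurd (h3 (intCast_mem_interval h2 (by omega))) (zero_notMem_interval hj hj')
  · intro k h1 h2 h3
    have hkj : k ≤ j := by
      by_contra hlt
      exact hn.2 (h3 (intCast_mem_interval (by omega) (by omega)))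
    exact le_sup_of_le_right (inf_le_inf_right _ (hA.mono (interval_mono le_rfl (by omega))))
  · exact le_sup_of_le_left (by rw [fullFibres_right hN hj hj'])

/-- Each generator is attached to a fibre or to an interval, which lies wholly in one of two
non-adjacent sets. -/
theorem splitFamily_connected (hN : 0 < N) (hA : IsPartition A)
    (hconn : VertexSplitting.IsConnected A) :
    VertexSplitting.IsConnected (splitFamily N A L R) := by
  intro S T hdisj hadj
  have hadj' : NonAdjacent T S := fun t ht s hs => (hadj s hs t ht).symm
  have hsub : ∀ {i j : ℤ}, i < j → interval (N + 1) i j ⊆ S ∪ T →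
      interval (N + 1) i j ⊆ S ∨ interval (N + 1) i j ⊆ T := by
    intro i j hij h
    rcases h (intCast_mem_interval le_rfl hij) with h' | h'
    · exact Or.inl (interval_subset_of_nonAdjacent hadj h' h)
    · exact Or.inr (interval_subset_of_nonAdjacent hadj' h'
        (h.trans (Set.union_comm _ _).subset))
  refine le_antisymm (splitFamily_le ?_ ?_ ?_) (sup_le
    (splitFamily_mono hA Set.subset_union_left) (splitFamily_mono hA Set.subset_union_right))
  · refine (hA.mono (fullFibres_union hN hadj)).trans ?_
    rw [hconn _ _ (disjoint_fullFibres hN hdisj) (nonAdjacent_fullFibres hN hadj)]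
    exact sup_le_sup le_sup_left le_sup_left
  · intro i h1 h2 h3
    rcases hsub (by omega) h3 with h | h
    · exact le_sup_of_le_left (left_le_splitFamily h1 h2 h)
    · exact le_sup_of_le_right (left_le_splitFamily h1 h2 h)
  · intro j h1 h2 h3
    rcases hsub (by omega) h3 with h | h
    · exact le_sup_of_le_left (right_le_splitFamily h1 h2 h)
    · exact le_sup_of_le_right (right_le_splitFamily h1 h2 h)

/-- Distances factor through `collapse`: the far set is a union of fibres, and enlarging `S` to the
union of the fibres it meets leaves the far set unchanged. -/
theorem splitFamily_correlationLength {l : ℕ} (hN : 0 < N) (hA : IsPartition A)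
    (hcorr : HasCorrelationLengthLE cycleDist l A) :
    HasCorrelationLengthLE (splitDist N) l (splitFamily N A L R) := by
  intro S
  have h1 : {x | ∀ s ∈ S, l < splitDist N s x} =
      collapse N ⁻¹' {v | ∀ u ∈ collapse N '' S, l < cycleDist u v} := by
    ext x
    simp [splitDist]
  rw [h1, splitFamily_preimage hN hA]
  refine (hcorr (collapse N '' S)).mono ?_ le_rfl
  rw [← splitFamily_preimage (L := L) (R := R) hN hA]
  exact splitFamily_mono hA (Set.subset_preimage_image _ _)

theorem splitIntervals {l n₁ n₂ : ℕ} (hA : IsPartition A)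
    (d : SplitData N l n₁ n₂ (fun i j => A (interval N i j)) L R) :
    SplitIntervals N l n₁ n₂ (fun i j => A (interval N i j)) L R
      fun i j => splitFamily N A L R (interval (N + 1) i j) := by
  have hN : 0 < N := by have := d.sys.large; omega
  exact
    { data := d
      mono := fun h1 h2 => splitFamily_mono hA (interval_mono h1 h2)
      periodic := fun s i j => by rw [interval_add_mul_period]
      unsplit := fun p q => by
        rw [← preimage_collapse_interval hN, splitFamily_preimage hN hA]
      left := splitFamily_left hN hA
      right := splitFamily_right hN hA }

theorem ne_univ_of_forall_ne_arc {M : ℕ} [NeZero M] {S : Set (ZMod M)}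
    (h : ∀ m n : ZMod M, S ≠ arc m n) : S ≠ Set.univ := by
  rintro rfl
  have hM := NeZero.pos M
  have h1 := arc_eq_interval (M := M) (i := 0) (j := M - 1) (by omega) (by omega)
  have h2 := interval_full (M := M) 0
  rw [sub_add_cancel] at h1
  rw [zero_add] at h2
  exact h _ _ (h2.symm.trans h1.symm)

theorem arc_neg_zero (M k : ℕ) (hk : k < M) :
    arc (-(k : ZMod M)) 0 = interval M (-k) 1 := by
  have : NeZero M := ⟨by omega⟩
  have h := arc_eq_interval (M := M) (i := -k) (j := 0) (by omega) (by omega)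
  rwa [Int.cast_neg, Int.cast_natCast, Int.cast_zero, zero_add] at h

theorem arc_one (M k : ℕ) (hk : k < M) :
    arc (1 : ZMod M) ((k : ZMod M) + 1) = interval M 1 (k + 2) := by
  have : NeZero M := ⟨by omega⟩
  have h := arc_eq_interval (M := M) (i := 1) (j := k + 1) (by omega) (by omega)
  rw [Int.cast_add, Int.cast_natCast, Int.cast_one] at h
  rw [h]; congr 1

theorem arc_zero (M k : ℕ) (hk : k < M) :
    arc (0 : ZMod M) (k : ZMod M) = interval M 0 (k + 1) := by
  have : NeZero M := ⟨by omega⟩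
  have h := arc_eq_interval (M := M) (i := 0) (j := k) (by omega) (by omega)
  rwa [Int.cast_natCast, Int.cast_zero] at h

/-! ### The rules determine the family. -/

theorem SplitRules.left_eq {B B' : Set (ZMod (N + 1)) → StarSubalgebra ℂ Ω}
    (h : SplitRules N A L B) (h' : SplitRules N A L B') {i : ℤ} (hi : -N < i) (hi' : i ≤ 0)
    (hsmall : -i ≤ (N / 2 : ℕ)) :
    B (interval (N + 1) i 1) = B' (interval (N + 1) i 1) := by
  obtain ⟨k, hk⟩ := Int.eq_ofNat_of_zero_le (show 0 ≤ -i by omega)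
  obtain rfl : i = -k := by omega
  rw [← arc_neg_zero _ _ (by omega), h.left k (by omega), h'.left k (by omega)]

theorem SplitRules.right_eq {B B' : Set (ZMod (N + 1)) → StarSubalgebra ℂ Ω}
    (h : SplitRules N A L B) (h' : SplitRules N A L B') {j : ℤ} (hj : 2 ≤ j) (hj' : j ≤ N + 1)
    (hsmall : j - 2 ≤ ((N - 1) / 2 : ℕ)) :
    B (interval (N + 1) 1 j) = B' (interval (N + 1) 1 j) := by
  obtain ⟨k, hk⟩ := Int.eq_ofNat_of_zero_le (show 0 ≤ j - 2 by omega)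
  obtain rfl : j = k + 2 := by omega
  rw [← arc_one _ _ (by omega), h.right k (by omega), h'.right k (by omega)]

theorem SplitRules.large_interval {B : Set (ZMod (N + 1)) → StarSubalgebra ℂ Ω}
    (h : SplitRules N A L B) {i j : ℤ} (hij : i < j) (hj : j ≤ i + (N + 1 : ℕ))
    (hlarge : N < 2 * (j - i)) :
    B (interval (N + 1) i j) = commutant (B (interval (N + 1) j (i + (N + 1 : ℕ)))) := by
  have h1 := arc_eq_interval (M := N + 1) (i := i) (j := j - 1) (by omega) (by omega)
  rw [sub_add_cancel] at h1
  have h2 := h.large (i : ZMod (N + 1)) ((j - 1 : ℤ) : ZMod (N + 1))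
  rw [h1, ncard_interval hj, compl_interval hij.le hj] at h2
  exact h2 (by omega)

/-- Two old ends: rule 1. One end at the new cut: rule 2 or 3 if the interval is short, and
otherwise rule 4, the complement being a short interval on the other side of the cut. -/
theorem SplitRules.interval_eq (hN : 0 < N) {B B' : Set (ZMod (N + 1)) → StarSubalgebra ℂ Ω}
    (h : SplitRules N A L B) (h' : SplitRules N A L B') {i j : ℤ} (hij : i < j)
    (hj : j < i + (N + 1 : ℕ)) : B (interval (N + 1) i j) = B' (interval (N + 1) i j) := by
  rcases exists_splitCut_eq hN i with ⟨p, rfl⟩ | ⟨s, rfl⟩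
  · rcases exists_splitCut_eq hN j with ⟨q, rfl⟩ | ⟨s, rfl⟩
    · rw [← preimage_collapse_interval hN, h.unsplit, h'.unsplit]
    · generalize splitCut N p = i at *
      obtain ⟨i, rfl⟩ : ∃ i', i = i' + s * (N + 1 : ℕ) := ⟨i - s * (N + 1 : ℕ), by ring⟩
      rw [interval_add_mul_period]
      by_cases hs : -i ≤ (N / 2 : ℕ)
      · exact h.left_eq h' (by omega) (by omega) hs
      · rw [h.large_interval (by omega) (by omega) (by omega),
          h'.large_interval (by omega) (by omega) (by omega),
          h.right_eq h' (by omega) (by omega) (by omega)]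
  · obtain ⟨j, rfl⟩ : ∃ j', j = j' + s * (N + 1 : ℕ) := ⟨j - s * (N + 1 : ℕ), by ring⟩
    rw [interval_add_mul_period]
    by_cases hs : j - 2 ≤ ((N - 1) / 2 : ℕ)
    · exact h.right_eq h' (by omega) (by omega) hs
    · have hshift := interval_add_period (M := N + 1) (j - (N + 1 : ℕ)) 1
      rw [sub_add_cancel] at hshift
      rw [h.large_interval (by omega) (by omega) (by omega),
        h'.large_interval (by omega) (by omega) (by omega), hshift,
        h.left_eq h' (by omega) (by omega) (by omega)]

theorem SplitRules.unique (hN : 0 < N) {B B' : Set (ZMod (N + 1)) → StarSubalgebra ℂ Ω}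
    (h : SplitRules N A L B) (h' : SplitRules N A L B') : B = B' := by
  have harc : ∀ m n : ZMod (N + 1), B (arc m n) = B' (arc m n) := by
    intro m n
    obtain ⟨i, j, hij, hji, -, -, harc⟩ := exists_interval_eq_arc m n
    rw [harc]
    rcases hji.eq_or_lt with rfl | hji
    · rw [interval_full, ← Set.preimage_univ (f := collapse N), h.unsplit, h'.unsplit]
    · exact h.interval_eq hN h' hij hji
  funext S
  by_cases hS : ∃ m n : ZMod (N + 1), S = arc m n
  · obtain ⟨m, n, rfl⟩ := hS
    exact harc m n
  · push Not at hS
    rw [h.nonInterval S hS, h'.nonInterval S hS]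
    refine iSup_congr fun C => iSup_congr fun hC => ?_
    obtain ⟨m, n, rfl, -⟩ := hC
    exact harc m n

variable [FiniteDimensional ℂ Ω]

theorem splitFamily_cycleFamily {l n₁ n₂ : ℕ} (hA : IsPartition A)
    (hconn : VertexSplitting.IsConnected A)
    (d : SplitData N l n₁ n₂ (fun i j => A (interval N i j)) L R) :
    CycleFamily (N + 1) (splitFamily N A L R) := by
  have hN : 0 < N := by have := d.sys.large; omega
  have h := splitIntervals hA d
  exact
    { factor := d.sys.factor
      nontrivial := by omega
      mono := splitFamily_mono hA
      connected := splitFamily_connected hN hA hconn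
      empty := by
        rw [← Set.preimage_empty (f := collapse N), splitFamily_preimage hN hA,
          hA.empty d.sys.factor]
      full := by
        rw [← Set.preimage_univ (f := collapse N), splitFamily_preimage hN hA, hA.1]
      compl := h.compl
      gap := h.gap
      bipartition := h.bipartition
      centre_le := h.centre_le_cutWire }

theorem splitFamily_splitRules {l : ℕ} (hA : IsPartition A)
    (hconn : VertexSplitting.IsConnected A)
    (d : SplitData N l (N / 2) ((N - 1) / 2) (fun i j => A (interval N i j)) L (commutant L)) :
    SplitRules N A L (splitFamily N A L (commutant L)) := by
  have hN : 0 < N := by have := d.sys.large; omega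
  have h := splitFamily_cycleFamily hA hconn d
  refine ⟨splitFamily_preimage hN hA, ?_, ?_, ?_, ?_⟩
  · intro k hk
    rw [arc_neg_zero _ _ (by omega), arc_neg_zero _ _ (by omega),
      splitFamily_left hN hA (by omega) (by omega), neg_neg, d.leftAlg_eq (by omega)]
  · intro k hk
    rw [arc_one _ _ (by omega), arc_zero _ _ (by omega),
      splitFamily_right hN hA (by omega) (by omega), add_sub_cancel_right, d.rightAlg_eq (by omega)]
  -- Duality holds for all sets, so the size condition of rule 4 plays no role here.
  · intro m n _
    rw [h.commutant_eq, compl_compl]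
  · intro S hS
    exact eq_iSup_component h.connected h.mono h.empty (ne_univ_of_forall_ne_arc hS)

end SplitFamily

end VertexSplitting

open VertexSplitting in
theorem mainTheorem3 {Ω : Type*} [CStarAlgebra Ω] [FiniteDimensional ℂ Ω] (hΩ : IsFactor Ω)
    (N l : ℕ) (hN : 4 * l + 1 ≤ N)
    (A : Set (ZMod N) → StarSubalgebra ℂ Ω)
    (hpart : IsPartition A) (hconn : VertexSplitting.IsConnected A)
    (hcorr : HasCorrelationLengthLE cycleDist l A)
    (L : StarSubalgebra ℂ Ω)
    (hinc_left : A (arc (pMinus N) (-1)) ≤ L) (hinc_right : L ≤ A (arc (pMinus N) 0))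
    (hrestr : L = A (arc (pMinus N) 0) ⊓
      commutant (commutant L ⊓ A (arc 0 (qPlus N l)))) :
    ∃ B : Set (ZMod (N + 1)) → StarSubalgebra ℂ Ω,
      SplitRules N A L B ∧
      (∀ B' : Set (ZMod (N + 1)) → StarSubalgebra ℂ Ω, SplitRules N A L B' → B' = B) ∧
      IsPartition B ∧ VertexSplitting.IsConnected B ∧ IsStronglyConnected B ∧
      HasCorrelationLengthLE (splitDist N) l B := by
  have hN' : 0 < N := by omega
  have d := splitData (intervalSystem hΩ hN hpart hconn hcorr) hinc_left hinc_right hrestr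
  have hB := splitFamily_cycleFamily hpart hconn d
  have hrules := splitFamily_splitRules hpart hconn d
  exact ⟨_, hrules, fun B' h' => h'.unique hN' hrules, hB.isPartition, hB.connected,
    hB.stronglyConnected, splitFamily_correlationLength hN' hpart hcorr⟩
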